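/- **Setting.** Let $n,m\ge 0$. Let $U\subseteq\mathbb R^n$ be measurable with Lebesgue-null boundary and let $\mathcal D$ be a probability distribution on $U$ with density $p\ge 0$, where $p$ is smooth in the interior $\mathring U$ and $\sup_{x\in\mathring U}|x^\beta\,\partial^\alpha p(x)|<\infty$ for all multi-indices $\alpha,\beta$. Let $\Theta\subseteq\mathbb R^m$ be compact, let $O\supseteq\Theta$ be open, and for $\theta\in O$ let $\varphi_\theta:U\to U$ be a diffeomorphism (a bijective differentiable function with differentiable inverse) such that $(\theta,s)\mapsto\varphi_\theta(s)$ is smooth on $O\times\mathring U$, it and all its partial derivatives are bounded there by polynomials in $(\theta,s)$, and $\inf_{\theta\in O,\,s\in\mathring U}|\det \mathrm J\varphi_\theta(s)|>0$. **Expressions.** Let $\mathrm{Op}$ be the set of smooth functions $f:\mathbb R^k\to\mathbb R$ ($k\ge 0$) which, together with all their partial derivatives, are bounded by polynomials. Expressions are generated by $$F::=z_j\mid f(F,\dots,F)\mid \mathbf{if}\ F<0\ \mathbf{then}\ F\ \mathbf{else}\ F\qquad(1\le j\le n,\ f\in\mathrm{Op}),$$ and $[\![F]\!]:\mathbb R^n\to\mathbb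 R$ is the evident interpretation. For $\eta>0$ the $\eta$-smoothing $[\![F]\!]_\eta$ is defined in the same way, except that with $\sigma_\eta(x)=1/(1+e^{-x/\eta})$ $$[\![\mathbf{if}\ F<0\ \mathbf{then}\ G\ \mathbf{else}\ H]\!]_\eta=\sigma_\eta(-[\![F]\!]_\eta)\cdot[\![G]\!]_\eta+\sigma_\eta([\![F]\!]_\eta)\cdot[\![H]\!]_\eta .$$ *Safe guards* are generated by $G::=f(z_{i_1},\dots,z_{i_k})\mid\mathbf{if}\ G<0\ \mathbf{then}\ G\ \mathbf{else}\ G$, where $f\in\mathrm{Op}$ is nonzero almost everywhere and $i_1,\dots,i_k$ are pairwise distinct. *Safe expressions* are generated by $S::=z_j\mid f(S,\dots,S)\mid\mathbf{if}\ G<0\ \mathbf{then}\ S\ \mathbf{else}\ S$ with $f\in\mathrm{Op}$ and $G$ a safe guard. The classes $\mathcal E_0\subseteq\mathcal E_1\subseteq\cdots$ of expressions of guard-nesting depth at most $\ell$ are the least ones with: $z_j\in\mathcal E_0$; $f(F_1,\dots,F_k)\in\mathcal E_\ell$ if $F_1,\dots,F_k\in\mathcal E_\ell$; $(\mathbf{if}\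 F<0\ \mathbf{then}\ G\ \mathbf{else}\ H)\in\mathcal E_{\ell+1}$ if $F\in\mathcal E_\ell$ and $G,H\in\mathcal E_{\ell+1}$; and $\mathcal E_\ell\subseteq\mathcal E_{\ell+1}$. **Theorem (Correctness of Diagonalisation SGD).** Let $\ell\ge 1$, let $F\in\mathcal E_\ell$ be a safe expression, and let $0<\epsilon<\frac1\ell$. Let $\gamma_k>0$ with $\gamma_k\in\Theta(1/k)$ and $\eta_k>0$ with $\eta_k\in\Theta(k^{-\frac1\ell+\epsilon})$. Let $s_0,s_1,\dots$ be independent samples from $\mathcal D$, let $\theta_0\in\mathbb R^m$, and let $$\theta_{k+1}=\theta_k-\gamma_k\,\nabla_\theta\big([\![F]\!]_{\eta_k}(\varphi_\theta(s_k))\big)\big|_{\theta=\theta_k}$$ for as long as the iterates stay in $\Theta$. Then the unsmoothed objective $g(\theta)=\mathbb E_{s\sim\mathcal D}\big[[\![F]\!](\varphi_\theta(s))\big]$ is well defined (the expectation is that of an integrable function) and differentiable at every $\theta\in\Theta$, and almost surely either $\liminf_{i\to\infty}\|\nabla g(\theta_i)\|=0$ or $\theta_i\notin\Theta$ for some $i$.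 -/

import Mathlib

open MeasureTheory ProbabilityTheory Filter Topology Asymptotics Set
open scoped ContDiff ENNReal

namespace DSGD

/-- Syntactic expressions in the variables `z_1, …, z_n`: variables, applications of a primitive
operation to expressions, and conditionals `if F < 0 then G else H`.  The primitive operations are
all smooth functions `ℝ^k → ℝ` (for any arity `k`, constants included as `k = 0`) all of whose
derivatives are bounded by polynomials. -/
inductive Expr (n : ℕ) : Type
  | var (j : Fin n) : Expr n
  | app {k : ℕ} (f : (Fin k → ℝ) → ℝ) (hf : Function.HasTemperateGrowth f)
      (args : Fin k → Expr n) : Expr n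
  | ite (F G H : Expr n) : Expr n

namespace Expr

variable {n : ℕ}

/-- The standard interpretation of an expression as a function `ℝ^n → ℝ`. -/
noncomputable def sem : Expr n → (Fin n → ℝ) → ℝ
  | var j, x => x j
  | app f _ args, x => f (fun i => (args i).sem x)
  | ite F G H, x => if F.sem x < 0 then G.sem x else H.sem x

/-- The `η`-smoothing of an expression: the conditional is interpolated by the logistic
sigmoid `x ↦ 1 / (1 + exp (- x / η))`. -/
noncomputable def smooth (η : ℝ) : Expr n → (Fin n → ℝ) → ℝ
  | var j, x => x j
  | app f _ args, x => f (fun i => (args i).smooth η x)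
  | ite F G H, x =>
      Real.sigmoid (-F.smooth η x / η) * G.smooth η x
        + Real.sigmoid (F.smooth η x / η) * H.smooth η x

/-- Safe guards: built by conditionals from primitive operations which are nonzero almost
everywhere and are applied to pairwise distinct variables. -/
inductive SafeGuard : Expr n → Prop
  | app {k : ℕ} (f : (Fin k → ℝ) → ℝ) (hf : Function.HasTemperateGrowth f) (i : Fin k → Fin n)
      (hi : Function.Injective i) (hne : ∀ᵐ y : Fin k → ℝ, f y ≠ 0) :
      SafeGuard (Expr.app f hf (fun j => Expr.var (i j)))
  | ite {F G H : Expr n} (hF : SafeGuard F) (hG : SafeGuard G) (hH : SafeGuard H) :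
      SafeGuard (Expr.ite F G H)

/-- Safe expressions: all guards of conditionals are safe guards. -/
inductive Safe : Expr n → Prop
  | var (j : Fin n) : Safe (Expr.var j)
  | app {k : ℕ} (f : (Fin k → ℝ) → ℝ) (hf : Function.HasTemperateGrowth f)
      (args : Fin k → Expr n) (hargs : ∀ i, Safe (args i)) : Safe (Expr.app f hf args)
  | ite {F G H : Expr n} (hF : SafeGuard F) (hG : Safe G) (hH : Safe H) :
      Safe (Expr.ite F G H)

/-- `HasDepth ℓ F`: the guards of the conditionals in `F` are nested to depth at most `ℓ`. -/
inductive HasDepth : ℕ → Expr n → Prop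
  | var (j : Fin n) : HasDepth 0 (Expr.var j)
  | app {ℓ k : ℕ} (f : (Fin k → ℝ) → ℝ) (hf : Function.HasTemperateGrowth f)
      (args : Fin k → Expr n) (hargs : ∀ i, HasDepth ℓ (args i)) :
      HasDepth ℓ (Expr.app f hf args)
  | ite {ℓ : ℕ} {F G H : Expr n} (hF : HasDepth ℓ F) (hG : HasDepth (ℓ + 1) G)
      (hH : HasDepth (ℓ + 1) H) : HasDepth (ℓ + 1) (Expr.ite F G H)
  | succ {ℓ : ℕ} {F : Expr n} (hF : HasDepth ℓ F) : HasDepth (ℓ + 1) F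

end Expr

/-- `f` is a (generalised) Schwartz function on `U ⊆ ℝ^n`: `U` is measurable with Lebesgue-null
boundary, `f` is smooth in the interior of `U`, and all derivatives of `f` decrease there faster
than any power of `‖x‖`. -/
structure IsSchwartzOn {n : ℕ} (f : (Fin n → ℝ) → ℝ) (U : Set (Fin n → ℝ)) : Prop where
  measurableSet : MeasurableSet U
  frontier_null : volume (frontier U) = 0
  contDiffOn : ContDiffOn ℝ ∞ f (interior U)
  decay : ∀ k l : ℕ, ∃ C : ℝ, ∀ x ∈ interior U, ‖x‖ ^ k * ‖iteratedFDeriv ℝ l f x‖ ≤ C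

/-- The measure on `ℝ^n` concentrated on `U` with Lebesgue density `p`. -/
noncomputable def densityMeasure {n : ℕ} (p : (Fin n → ℝ) → ℝ) (U : Set (Fin n → ℝ)) :
    Measure (Fin n → ℝ) :=
  (volume.restrict U).withDensity (fun x => ENNReal.ofReal (p x))

/-- `f` restricts to a diffeomorphism `U → U`: a bijective differentiable function with
differentiable inverse. -/
def IsDiffeoOn {n : ℕ} (f : (Fin n → ℝ) → (Fin n → ℝ)) (U : Set (Fin n → ℝ)) : Prop :=
  BijOn f U U ∧ DifferentiableOn ℝ f U ∧ ∃ g, InvOn g f U U ∧ DifferentiableOn ℝ g U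

/-- `f` is smooth on the open set `W`, and `f` and all of its derivatives are bounded on `W` by
polynomials. -/
def IsSmoothPolyBoundedOn {E G : Type*} [NormedAddCommGroup E] [NormedSpace ℝ E]
    [NormedAddCommGroup G] [NormedSpace ℝ G] (f : E → G) (W : Set E) : Prop :=
  ContDiffOn ℝ ∞ f W ∧
    ∀ l : ℕ, ∃ (N : ℕ) (C : ℝ), ∀ x ∈ W, ‖iteratedFDeriv ℝ l f x‖ ≤ C * (1 + ‖x‖) ^ N

/-- The unsmoothed objective `θ ↦ 𝔼_{s ∼ 𝒟} [⟦F⟧(φ_θ(s))]`. -/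
noncomputable def objective {m n : ℕ} (𝒟 : Measure (Fin n → ℝ))
    (φ : EuclideanSpace ℝ (Fin m) → (Fin n → ℝ) → (Fin n → ℝ)) (F : Expr n)
    (θ : EuclideanSpace ℝ (Fin m)) : ℝ :=
  ∫ s, F.sem (φ θ s) ∂𝒟

/-- The iterates of Diagonalisation SGD started at `θ₀`, with step sizes `γ`, accuracy
coefficients `η` and samples `s`. -/
noncomputable def iterate {m n : ℕ}
    (φ : EuclideanSpace ℝ (Fin m) → (Fin n → ℝ) → (Fin n → ℝ)) (F : Expr n) (γ η : ℕ → ℝ)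
    (θ₀ : EuclideanSpace ℝ (Fin m)) (s : ℕ → Fin n → ℝ) : ℕ → EuclideanSpace ℝ (Fin m)
  | 0 => θ₀
  | k + 1 =>
      iterate φ F γ η θ₀ s k
        - γ k • gradient (fun t => F.smooth (η k) (φ t (s k))) (iterate φ F γ η θ₀ s k)

end DSGD

/-! The run is stochastic gradient descent whose gradient estimates have vanishing bias and a
variance that may grow. With step sizes of order 1/k it suffices that the bias at step k tends to
zero uniformly in θ and that the second moments B_k satisfy ∑ γ_k² B_k < ∞. Expected values of a
bounded potential then decrease by at least γ_k δ²/2 times the probability of staying in Θ with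
gradient norm at least δ, up to a summable error. Since ∑ γ_k diverges, that behaviour has
probability zero (`ae_exists_notMem_active`, fed by `exists_descent`).

Second moments. Let w be a polynomially decaying weight and e a direction. The sum (∂_e u)² + |∂_e²
u| (`gauge`) is stable under products and compositions up to polynomial factors. A conditional
multiplies by σ_η(u), and the crude bound σ_η' ≤ 1/η would cost η⁻² per nesting level. The gain is
an integration by parts (`WeightBdd.sigmoidDeriv_mul_sq`): ∫ σ_η'(u) (∂_e u)² w = ∫ ∂_e(σ_η(u)) ∂_e
u · w = -∫ σ_η(u) ∂_e(∂_e u · w), which is controlled by the gauge of u with no loss in η. Each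
level therefore costs a single η⁻¹, so depth ℓ gives O(η^(-ℓ)) (`Expr.HasDepth.weightBdd_gauge`),
and γ_k² η_k^(-ℓ) is of order k^(-1-εℓ), which is summable.

Bias and differentiability. The unsmoothed integrand is discontinuous, so the θ-dependence is moved
to the density: substituting y = φ_θ(s) gives E[u(φ_θ(s))] = ∫ u(y) Q(θ, y) dy, where Q is twice
differentiable in θ with rapidly decaying derivatives (`Reparam.exists_kernel`). Hence the objective
has bounded first and second derivatives for every measurable polynomially bounded u. Safe guards
vanish only on null sets, so smoothings converge almost everywhere (`Expr.Safe.ae_tendsto`), and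
dominated convergence makes their gradients converge uniformly in θ (`Reparam.exists_gradient`). -/

namespace DSGD

/-! ### Polynomial bounds uniform over a family. -/

/-- A family of functions bounded by a common polynomial. -/
def PolyBdd {ι X G : Type*} [Norm X] [Norm G] (u : ι → X → G) : Prop :=
  ∃ (C : ℝ) (N : ℕ), 0 ≤ C ∧ ∀ i y, ‖u i y‖ ≤ C * (1 + ‖y‖) ^ N

namespace PolyBdd

variable {ι X G : Type*} [NormedAddCommGroup X] [NormedAddCommGroup G]

lemma mono {H : Type*} [NormedAddCommGroup H] {u : ι → X → G} {v : ι → X → H} (hu : PolyBdd u)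
    (h : ∀ i y, ‖v i y‖ ≤ ‖u i y‖) : PolyBdd v := by
  obtain ⟨C, N, hC, hu⟩ := hu
  exact ⟨C, N, hC, fun i y => (h i y).trans (hu i y)⟩

lemma const (c : ℝ) : PolyBdd (fun (_ : ι) (_ : X) => c) :=
  ⟨|c|, 0, abs_nonneg c, fun i y => by simp⟩

lemma add {u v : ι → X → G} (hu : PolyBdd u) (hv : PolyBdd v) :
    PolyBdd (fun i y => u i y + v i y) := by
  obtain ⟨C, N, hC, hu⟩ := hu
  obtain ⟨D, M, hD, hv⟩ := hv
  refine ⟨C + D, N + M, by positivity, fun i y => ?_⟩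
  have h1 : (1 : ℝ) ≤ 1 + ‖y‖ := by linarith [norm_nonneg y]
  calc ‖u i y + v i y‖ ≤ C * (1 + ‖y‖) ^ N + D * (1 + ‖y‖) ^ M :=
        (norm_add_le _ _).trans (add_le_add (hu i y) (hv i y))
    _ ≤ C * (1 + ‖y‖) ^ (N + M) + D * (1 + ‖y‖) ^ (N + M) := by
        gcongr <;> first | exact h1 | omega
    _ = _ := by ring

lemma mul {u v : ι → X → ℝ} (hu : PolyBdd u) (hv : PolyBdd v) :
    PolyBdd (fun i y => u i y * v i y) := by
  obtain ⟨C, N, hC, hu⟩ := hu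
  obtain ⟨D, M, hD, hv⟩ := hv
  refine ⟨C * D, N + M, by positivity, fun i y => ?_⟩
  calc ‖u i y * v i y‖ ≤ (C * (1 + ‖y‖) ^ N) * (D * (1 + ‖y‖) ^ M) := by
        rw [norm_mul]; gcongr; exacts [hu i y, hv i y]
    _ = _ := by ring

lemma pow {u : ι → X → ℝ} (hu : PolyBdd u) (k : ℕ) : PolyBdd (fun i y => u i y ^ k) := by
  induction k with
  | zero => simpa using const 1
  | succ k ih => simpa only [pow_succ] using ih.mul hu

lemma sum {κ : Type*} (s : Finset κ) {u : κ → ι → X → ℝ} (hu : ∀ j ∈ s, PolyBdd (u j)) :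
    PolyBdd (fun i y => ∑ j ∈ s, u j i y) := by
  classical
  induction s using Finset.induction_on with
  | empty => simpa using const 0
  | insert a s ha ih =>
    simp only [Finset.sum_insert ha]
    exact (hu a (by simp)).add (ih fun j hj => hu j (by simp [hj]))

lemma pi {k : ℕ} {u : Fin k → ι → X → ℝ} (hu : ∀ j, PolyBdd (u j)) :
    PolyBdd (fun i y j => u j i y) := by
  have : PolyBdd (fun i y => ∑ j : Fin k, |u j i y|) :=
    sum _ fun j _ => (hu j).mono fun i y => by simp
  refine this.mono fun i y => ?_
  have h0 : 0 ≤ ∑ j : Fin k, |u j i y| := Finset.sum_nonneg fun _ _ => abs_nonneg _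
  rw [Real.norm_of_nonneg h0]
  refine (pi_norm_le_iff_of_nonneg h0).2 fun j => ?_
  exact Finset.single_le_sum (f := fun j => |u j i y|) (fun _ _ => abs_nonneg _) (Finset.mem_univ j)

lemma comp {Y : Type*} [NormedAddCommGroup Y] {f : Y → G} {u : ι → X → Y}
    (hf : ∃ (N : ℕ) (C : ℝ), ∀ z, ‖f z‖ ≤ C * (1 + ‖z‖) ^ N) (hu : PolyBdd u) :
    PolyBdd (fun i y => f (u i y)) := by
  obtain ⟨N, D, hf⟩ := hf
  obtain ⟨C, M, hC, hu⟩ := hu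
  refine ⟨|D| * (1 + C) ^ N, M * N, by positivity, fun i y => ?_⟩
  have h1 : (1 : ℝ) ≤ (1 + ‖y‖) ^ M := one_le_pow₀ (by linarith [norm_nonneg y])
  calc ‖f (u i y)‖ ≤ D * (1 + ‖u i y‖) ^ N := hf _
    _ ≤ |D| * ((1 + C) * (1 + ‖y‖) ^ M) ^ N := by
        gcongr
        · exact le_abs_self D
        · nlinarith [hu i y]
    _ = _ := by rw [mul_pow, ← pow_mul]; ring

end PolyBdd

/-! ### Polynomially decaying weights. -/

/-- The polynomially decaying weight `(1 + ∑ i, y i ^ 2) ^ (-K)`. -/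
noncomputable def weight {n : ℕ} (K : ℕ) (y : Fin n → ℝ) : ℝ := ((1 + ∑ i, y i ^ 2) ^ K)⁻¹

section weight

variable {n : ℕ}

lemma one_le_base (y : Fin n → ℝ) : 1 ≤ 1 + ∑ i, y i ^ 2 := by
  linarith [Finset.sum_nonneg fun (i : Fin n) (_ : i ∈ Finset.univ) => sq_nonneg (y i)]

lemma base_pos (y : Fin n → ℝ) : 0 < 1 + ∑ i, y i ^ 2 := one_pos.trans_le (one_le_base y)

lemma weight_pos (K : ℕ) (y : Fin n → ℝ) : 0 < weight K y :=
  inv_pos.2 (pow_pos (base_pos y) K)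

lemma weight_anti {K L : ℕ} (h : K ≤ L) (y : Fin n → ℝ) : weight L y ≤ weight K y :=
  inv_anti₀ (pow_pos (base_pos y) K) (pow_le_pow_right₀ (one_le_base y) h)

lemma weight_add (K L : ℕ) (y : Fin n → ℝ) : weight (K + L) y = weight K y * weight L y := by
  simp [weight, pow_add, mul_comm]

lemma one_add_norm_sq_le (y : Fin n → ℝ) : (1 + ‖y‖) ^ 2 ≤ 2 * (1 + ∑ i, y i ^ 2) := by
  have h0 := base_pos y
  have : ‖y‖ ≤ √(∑ i, y i ^ 2) := by
    refine (pi_norm_le_iff_of_nonneg (Real.sqrt_nonneg _)).2 fun i => ?_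
    rw [Real.norm_eq_abs]
    refine Real.abs_le_sqrt ?_
    exact Finset.single_le_sum (f := fun i => y i ^ 2) (fun _ _ => sq_nonneg _) (Finset.mem_univ i)
  have h2 : ‖y‖ ^ 2 ≤ ∑ i, y i ^ 2 := by
    calc ‖y‖ ^ 2 ≤ √(∑ i, y i ^ 2) ^ 2 := by gcongr
      _ = _ := Real.sq_sqrt (Finset.sum_nonneg fun _ _ => sq_nonneg _)
  nlinarith [sq_nonneg (1 - ‖y‖)]

lemma base_le (y : Fin n → ℝ) : 1 + ∑ i, y i ^ 2 ≤ (1 + n) * (1 + ‖y‖) ^ 2 := by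
  have : ∑ i, y i ^ 2 ≤ n * ‖y‖ ^ 2 := by
    calc ∑ i, y i ^ 2 ≤ ∑ _i : Fin n, ‖y‖ ^ 2 := by
          refine Finset.sum_le_sum fun i _ => ?_
          rw [← sq_abs]
          gcongr
          exact norm_le_pi_norm y i
      _ = _ := by simp
  have h := norm_nonneg y
  nlinarith [mul_nonneg (Nat.cast_nonneg (α := ℝ) n) h]

lemma pow_mul_weight_le (N K : ℕ) (y : Fin n → ℝ) :
    (1 + ‖y‖) ^ N * weight (N + K) y ≤ 2 ^ N * weight K y := by
  have h1 : 1 ≤ 1 + ‖y‖ := by linarith [norm_nonneg y]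
  have h2 : (1 + ‖y‖) ^ N ≤ 2 ^ N * (1 + ∑ i, y i ^ 2) ^ N := by
    rw [← mul_pow]
    gcongr
    refine le_trans ?_ (one_add_norm_sq_le y)
    nlinarith
  rw [weight_add, ← mul_assoc]
  gcongr
  · exact (weight_pos K y).le
  · rw [weight, ← div_eq_mul_inv, div_le_iff₀ (pow_pos (base_pos y) N)]
    exact h2

lemma inv_pow_le_weight (K : ℕ) (y : Fin n → ℝ) :
    ((1 + ‖y‖) ^ (2 * K))⁻¹ ≤ (1 + n) ^ K * weight K y := by
  have h1 : 0 < (1 + ‖y‖) := by linarith [norm_nonneg y]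
  rw [weight, ← div_eq_mul_inv, le_div_iff₀ (pow_pos (base_pos y) K),
    inv_mul_le_iff₀ (by positivity), pow_mul, ← mul_pow]
  refine pow_le_pow_left₀ (base_pos y).le ?_ K
  rw [mul_comm]
  exact base_le y

lemma contDiff_weight (K : ℕ) : ContDiff ℝ ∞ (weight (n := n) K) := by
  unfold weight
  refine ContDiff.inv (by fun_prop) fun y => (pow_pos (base_pos y) K).ne'

lemma continuous_weight (K : ℕ) : Continuous (weight (n := n) K) := (contDiff_weight K).continuous

/-- The logarithmic derivative is bounded because |2 ∑ y_i e_i| ≤ (1 + ∑ e_i²)(1 + ∑ y_i²).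
Derivatives that fall on the weight during integration by parts are therefore harmless. -/
lemma abs_fderiv_weight_le (e : Fin n → ℝ) (K : ℕ) :
    ∃ C, 0 ≤ C ∧ ∀ y, |fderiv ℝ (weight K) y e| ≤ C * weight K y := by
  refine ⟨K * (1 + ∑ i, e i ^ 2), mul_nonneg (by positivity) (base_pos e).le, fun y => ?_⟩
  have hb := base_pos y
  have h1 : HasFDerivAt (fun y : Fin n → ℝ => 1 + ∑ i, y i ^ 2)
      (∑ i, (2 * y i) • ContinuousLinearMap.proj (R := ℝ) (φ := fun _ : Fin n => ℝ) i) y := by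
    refine (HasFDerivAt.fun_sum fun i _ => ?_).const_add 1
    have h := ((ContinuousLinearMap.proj (R := ℝ) (φ := fun _ : Fin n => ℝ) i).hasFDerivAt
      (x := y)).pow 2
    simpa using h
  have h2 : HasDerivAt (fun q : ℝ => (q ^ K)⁻¹)
      (-(K * (1 + ∑ i, y i ^ 2) ^ (K - 1)) / ((1 + ∑ i, y i ^ 2) ^ K) ^ 2) (1 + ∑ i, y i ^ 2) :=
    (hasDerivAt_pow K _).inv (pow_pos hb K).ne'
  have h3 := (h2.comp_hasFDerivAt y h1).fderiv
  have h4 : (fun q : ℝ => (q ^ K)⁻¹) ∘ (fun y : Fin n → ℝ => 1 + ∑ i, y i ^ 2) = weight K := rfl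
  rw [h4] at h3
  rw [h3]
  simp only [smul_apply, sum_apply, ContinuousLinearMap.proj_apply, smul_eq_mul]
  have h5 : |∑ i, 2 * y i * e i| ≤ (1 + ∑ i, e i ^ 2) * (1 + ∑ i, y i ^ 2) := by
    have : |∑ i, 2 * y i * e i| ≤ ∑ i, y i ^ 2 + ∑ i, e i ^ 2 := by
      rw [← Finset.sum_add_distrib]
      refine (Finset.abs_sum_le_sum_abs _ _).trans (Finset.sum_le_sum fun i _ => ?_)
      rw [abs_le]
      constructor <;> nlinarith [sq_nonneg (y i - e i), sq_nonneg (y i + e i)]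
    nlinarith [one_le_base y, one_le_base e]
  rcases Nat.eq_zero_or_pos K with rfl | hK
  · simp
  rw [abs_mul, abs_div, abs_neg, abs_of_nonneg (by positivity : (0 : ℝ) ≤ K * _),
    abs_of_nonneg (by positivity : (0 : ℝ) ≤ ((1 + ∑ i, y i ^ 2) ^ K) ^ 2), weight]
  calc _ ≤ K * (1 + ∑ i, y i ^ 2) ^ (K - 1) / ((1 + ∑ i, y i ^ 2) ^ K) ^ 2 *
        ((1 + ∑ i, e i ^ 2) * (1 + ∑ i, y i ^ 2)) := by gcongr
    _ = K * ((1 + ∑ i, e i ^ 2)) * ((1 + ∑ i, y i ^ 2) ^ (K - 1) * (1 + ∑ i, y i ^ 2)) /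
        ((1 + ∑ i, y i ^ 2) ^ K) ^ 2 := by ring
    _ = _ := by
      rw [← pow_succ, Nat.sub_add_cancel hK]
      field_simp

lemma integrable_pow_mul_weight (N : ℕ) {K : ℕ} (hK : N + n + 1 ≤ K) :
    Integrable (fun y : Fin n → ℝ => (1 + ‖y‖) ^ N * weight K y) := by
  have h : Integrable (fun y : Fin n → ℝ => (1 + ‖y‖) ^ (-((n : ℝ) + 1))) :=
    integrable_one_add_norm (by simp)
  have h0 : Continuous (weight (n := n) K) := continuous_weight K
  refine (h.const_mul (2 ^ (N + (n + 1)))).mono' (by fun_prop) (ae_of_all _ fun y => ?_)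
  have hp : 0 < 1 + ‖y‖ := by linarith [norm_nonneg y]
  have hw := weight_pos K y
  rw [Real.norm_of_nonneg (by positivity), Real.rpow_neg hp.le, ← div_eq_mul_inv,
    le_div_iff₀ (by positivity)]
  have := pow_mul_weight_le (N + (n + 1)) 0 y
  have h2 : ((1 + ‖y‖) : ℝ) ^ ((n : ℝ) + 1) = (1 + ‖y‖) ^ (n + 1) := by
    rw [← Real.rpow_natCast]; push_cast; rfl
  rw [h2]
  calc (1 + ‖y‖) ^ N * weight K y * (1 + ‖y‖) ^ (n + 1)
      = (1 + ‖y‖) ^ (N + (n + 1)) * weight K y := by ring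
    _ ≤ (1 + ‖y‖) ^ (N + (n + 1)) * weight (N + (n + 1) + 0) y := by
        gcongr; exact weight_anti (by omega) y
    _ ≤ _ := this
    _ = _ := by simp [weight]

end weight

end DSGD

namespace DSGD

/-! ### Regularity of expressions and convergence of their smoothings. -/

section Expr

variable {n : ℕ}

lemma Expr.contDiff_smooth (F : Expr n) (η : ℝ) : ContDiff ℝ ∞ (F.smooth η) := by
  induction F with
  | var j => exact contDiff_apply ℝ ℝ j
  | app f hf args ih =>
    exact hf.1.comp (contDiff_pi.2 fun i => ih i)
  | ite F G H ihF ihG ihH =>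
    have hs : ContDiff ℝ ∞ Real.sigmoid := contDiff_sigmoid.of_le le_top
    exact ((hs.comp (ihF.neg.div_const η)).mul ihG).add ((hs.comp (ihF.div_const η)).mul ihH)

/-- Sigmoid values lie in [0, 1], so the bound never sees η. This uniformity supplies the dominating
function when the accuracy tends to zero. -/
lemma Expr.polyBdd_smooth (F : Expr n) : PolyBdd (fun (η : ℝ) y => F.smooth η y) := by
  induction F with
  | var j =>
    refine ⟨1, 1, zero_le_one, fun η y => ?_⟩
    have := norm_le_pi_norm y j
    simp only [Expr.smooth]
    linarith
  | app f hf args ih =>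
    have h0 := hf.2 0
    simp only [norm_iteratedFDeriv_zero] at h0
    exact PolyBdd.comp h0 (PolyBdd.pi ih)
  | ite F G H ihF ihG ihH =>
    have key : ∀ (g : ℝ → (Fin n → ℝ) → ℝ) (H : Expr n),
        PolyBdd (fun (η : ℝ) y => H.smooth η y) →
        PolyBdd (fun η y => Real.sigmoid (g η y) * H.smooth η y) := by
      refine fun g H hH => hH.mono fun i y => ?_
      rw [norm_mul, Real.norm_of_nonneg (Real.sigmoid_nonneg _)]
      exact mul_le_of_le_one_left (norm_nonneg _) (Real.sigmoid_le_one _)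
    exact (key (fun η y => -F.smooth η y / η) G ihG).add (key (fun η y => F.smooth η y / η) H ihH)

lemma Expr.measurable_sem (F : Expr n) : Measurable F.sem := by
  induction F with
  | var j => exact measurable_pi_apply j
  | app f hf args ih => exact hf.1.continuous.measurable.comp (measurable_pi_lambda _ ih)
  | ite F G H ihF ihG ihH =>
    exact Measurable.ite (measurableSet_lt ihF measurable_const) ihG ihH

lemma Expr.polyBdd_sem (F : Expr n) : PolyBdd (fun (_ : Unit) y => F.sem y) := by
  induction F with
  | var j =>
    refine ⟨1, 1, zero_le_one, fun η y => ?_⟩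
    have := norm_le_pi_norm y j
    simp only [Expr.sem]
    linarith
  | app f hf args ih =>
    have h0 := hf.2 0
    simp only [norm_iteratedFDeriv_zero] at h0
    exact PolyBdd.comp (u := fun (_ : Unit) y i => (args i).sem y) h0 (PolyBdd.pi ih)
  | ite F G H ihF ihG ihH =>
    have habs : ∀ H : Expr n, PolyBdd (fun (_ : Unit) y => H.sem y) →
        PolyBdd (fun (_ : Unit) y => |H.sem y|) := fun H h => h.mono fun i y => by simp
    refine ((habs G ihG).add (habs H ihH)).mono fun i y => ?_
    have h : ‖(Expr.ite F G H).sem y‖ ≤ |G.sem y| + |H.sem y| := by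
      simp only [Expr.sem]
      split_ifs
      · exact le_add_of_nonneg_right (abs_nonneg (H.sem y))
      · exact le_add_of_nonneg_left (abs_nonneg (G.sem y))
    exact h.trans (le_abs_self _)

lemma tendsto_sigmoid_div {α : Type*} {l : Filter α} {u η : α → ℝ} {a : ℝ}
    (hη : Tendsto η l (𝓝[>] 0)) (hu : Tendsto u l (𝓝 a)) (ha : a ≠ 0) :
    Tendsto (fun k => Real.sigmoid (u k / η k)) l (𝓝 (if a < 0 then 0 else 1)) := by
  have hi : Tendsto (fun k => (η k)⁻¹) l atTop := tendsto_inv_nhdsGT_zero.comp hη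
  split_ifs with h
  · exact Real.tendsto_sigmoid_atBot.comp (hu.neg_mul_atTop h hi)
  · exact Real.tendsto_sigmoid_atTop.comp (hu.pos_mul_atTop (lt_of_le_of_ne (not_lt.1 h) ha.symm) hi)

/-- Away from zeros of the guard the two sigmoids tend to 0 and 1 according to its sign. At a zero
this argument fails, hence `h0`. -/
lemma Expr.tendsto_smooth_ite {α : Type*} {l : Filter α} {η : α → ℝ}
    (hη : Tendsto η l (𝓝[>] 0)) {F G H : Expr n} {y : Fin n → ℝ} (h0 : F.sem y ≠ 0)
    (hF : Tendsto (fun k => F.smooth (η k) y) l (𝓝 (F.sem y)))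
    (hG : Tendsto (fun k => G.smooth (η k) y) l (𝓝 (G.sem y)))
    (hH : Tendsto (fun k => H.smooth (η k) y) l (𝓝 (H.sem y))) :
    Tendsto (fun k => (Expr.ite F G H).smooth (η k) y) l (𝓝 ((Expr.ite F G H).sem y)) := by
  have h1 := ((tendsto_sigmoid_div hη hF.neg (neg_ne_zero.2 h0)).mul hG).add
    ((tendsto_sigmoid_div hη hF h0).mul hH)
  have h2 : (Expr.ite F G H).sem y = (if -F.sem y < 0 then 0 else 1) * G.sem y
      + (if F.sem y < 0 then 0 else 1) * H.sem y := by
    simp only [Expr.sem]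
    rcases lt_or_gt_of_ne h0 with h | h
    · simp [h, h.le]
    · simp [h, h.not_gt]
  rw [h2]
  exact h1

/-- Selecting pairwise distinct coordinates is a surjective linear map, and preimages of null sets
under such maps are null. -/
lemma ae_comp_injective_ne_zero {k : ℕ} {f : (Fin k → ℝ) → ℝ} (hf : Measurable f)
    {i : Fin k → Fin n} (hi : Function.Injective i) (hne : ∀ᵐ y : Fin k → ℝ, f y ≠ 0) :
    ∀ᵐ y : Fin n → ℝ, f (fun j => y (i j)) ≠ 0 := by
  have hsurj : Function.Surjective (LinearMap.funLeft ℝ ℝ i) :=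
    LinearMap.funLeft_surjective_of_injective ℝ ℝ i hi
  exact (ae_comp_linearMap_mem_iff (LinearMap.funLeft ℝ ℝ i) volume volume hsurj
    (s := {y | f y ≠ 0}) (hf (measurableSet_singleton 0).compl)).2 hne

lemma Expr.SafeGuard.ae_ne_zero {F : Expr n} (hF : F.SafeGuard) : ∀ᵐ y, F.sem y ≠ 0 := by
  induction hF with
  | app f hf i hi hne => exact ae_comp_injective_ne_zero hf.1.continuous.measurable hi hne
  | ite hF hG hH ihF ihG ihH =>
    filter_upwards [ihG, ihH] with y h1 h2
    simp only [Expr.sem]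
    split_ifs <;> assumption

lemma Expr.SafeGuard.ae_tendsto {α : Type*} {l : Filter α} {η : α → ℝ}
    (hη : Tendsto η l (𝓝[>] 0)) {F : Expr n} (hF : F.SafeGuard) :
    ∀ᵐ y, Tendsto (fun k => F.smooth (η k) y) l (𝓝 (F.sem y)) := by
  induction hF with
  | app f hf i hi hne => exact ae_of_all _ fun y => tendsto_const_nhds
  | ite hF hG hH ihF ihG ihH =>
    filter_upwards [hF.ae_ne_zero, ihF, ihG, ihH] with y h0 h1 h2 h3
    exact tendsto_smooth_ite hη h0 h1 h2 h3

lemma Expr.Safe.ae_tendsto {α : Type*} {l : Filter α} {η : α → ℝ}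
    (hη : Tendsto η l (𝓝[>] 0)) {F : Expr n} (hF : F.Safe) :
    ∀ᵐ y, Tendsto (fun k => F.smooth (η k) y) l (𝓝 (F.sem y)) := by
  induction hF with
  | var j => exact ae_of_all _ fun y => tendsto_const_nhds
  | app f hf args hargs ih =>
    filter_upwards [ae_all_iff.2 ih] with y hy
    exact (hf.1.continuous.tendsto _).comp (tendsto_pi_nhds.2 hy)
  | ite hF hG hH ihG ihH =>
    filter_upwards [hF.ae_ne_zero, hF.ae_tendsto hη, ihG, ihH] with y h0 h1 h2 h3
    exact tendsto_smooth_ite hη h0 h1 h2 h3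

end Expr

/-! ### Calculus of first and second directional derivatives. -/

section gauge

variable {n : ℕ}

/-- The square of the derivative of `u` in the direction `e` plus the absolute value of the second
derivative in this direction. -/
noncomputable def gauge (e : Fin n → ℝ) (u : (Fin n → ℝ) → ℝ) (y : Fin n → ℝ) : ℝ :=
  (fderiv ℝ u y e) ^ 2 + |fderiv ℝ (fun z => fderiv ℝ u z e) y e|

variable (e : Fin n → ℝ)

lemma gauge_nonneg (u : (Fin n → ℝ) → ℝ) (y : Fin n → ℝ) : 0 ≤ gauge e u y := by
  unfold gauge; positivity

lemma contDiff_fderiv_dir {u : (Fin n → ℝ) → ℝ} (hu : ContDiff ℝ ∞ u) :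
    ContDiff ℝ ∞ (fun z => fderiv ℝ u z e) :=
  (hu.fderiv_right (m := ∞) (by simp)).clm_apply contDiff_const

lemma continuous_gauge {u : (Fin n → ℝ) → ℝ} (hu : ContDiff ℝ ∞ u) : Continuous (gauge e u) :=
  ((contDiff_fderiv_dir e hu).continuous.pow 2).add
    (contDiff_fderiv_dir e (contDiff_fderiv_dir e hu)).continuous.abs

lemma gauge_add_le {u v : (Fin n → ℝ) → ℝ} (hu : ContDiff ℝ ∞ u) (hv : ContDiff ℝ ∞ v)
    (y : Fin n → ℝ) : gauge e (fun y => u y + v y) y ≤ 2 * (gauge e u y + gauge e v y) := by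
  have hu1 := hu.differentiable (by simp)
  have hv1 := hv.differentiable (by simp)
  have h1 : ∀ z, fderiv ℝ (fun y => u y + v y) z e = fderiv ℝ u z e + fderiv ℝ v z e := fun z => by
    rw [fderiv_fun_add (hu1 z) (hv1 z)]; rfl
  unfold gauge
  simp only [h1]
  rw [fderiv_fun_add ((contDiff_fderiv_dir e hu).differentiable (by simp) y)
    ((contDiff_fderiv_dir e hv).differentiable (by simp) y), add_apply]
  have := abs_add_le (fderiv ℝ (fun z => fderiv ℝ u z e) y e) (fderiv ℝ (fun z => fderiv ℝ v z e) y e)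
  have h2 := abs_nonneg (fderiv ℝ (fun z => fderiv ℝ u z e) y e)
  have h3 := abs_nonneg (fderiv ℝ (fun z => fderiv ℝ v z e) y e)
  nlinarith [sq_nonneg (fderiv ℝ u y e - fderiv ℝ v y e)]

lemma gauge_neg {u : (Fin n → ℝ) → ℝ} (y : Fin n → ℝ) : gauge e (fun y => -u y) y = gauge e u y := by
  simp [gauge]

/-- The cross term 2ab of the second derivative is absorbed by a² + b². This is why the gauge pairs
the square of the first derivative with the first power of the second. -/
lemma gauge_mul_le {u v : (Fin n → ℝ) → ℝ} (hu : ContDiff ℝ ∞ u) (hv : ContDiff ℝ ∞ v)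
    (y : Fin n → ℝ) : gauge e (fun y => u y * v y) y ≤
      (2 * v y ^ 2 + |v y| + 1) * gauge e u y + (2 * u y ^ 2 + |u y| + 1) * gauge e v y := by
  have hu1 := hu.differentiable (by simp)
  have hv1 := hv.differentiable (by simp)
  have hu2 := (contDiff_fderiv_dir e hu).differentiable (by simp)
  have hv2 := (contDiff_fderiv_dir e hv).differentiable (by simp)
  have h1 : ∀ z, fderiv ℝ (fun y => u y * v y) z e
      = u z * fderiv ℝ v z e + v z * fderiv ℝ u z e := fun z => by
    rw [fderiv_fun_mul (hu1 z) (hv1 z)]; rfl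
  unfold gauge
  simp only [h1]
  rw [fderiv_fun_add ((hu1 y).fun_mul (hv2 y)) ((hv1 y).fun_mul (hu2 y)),
    fderiv_fun_mul (hu1 y) (hv2 y), fderiv_fun_mul (hv1 y) (hu2 y)]
  simp only [add_apply, smul_apply, smul_eq_mul]
  generalize fderiv ℝ u y e = a
  generalize fderiv ℝ v y e = b
  generalize fderiv ℝ (fun z => fderiv ℝ u z e) y e = c
  generalize fderiv ℝ (fun z => fderiv ℝ v z e) y e = d
  generalize u y = s
  generalize v y = t
  have h2 : |s * d + b * a + (t * c + a * b)| ≤ |s| * |d| + |t| * |c| + (a ^ 2 + b ^ 2) := by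
    have h3 : |2 * (a * b)| ≤ a ^ 2 + b ^ 2 := by
      rw [abs_le]; constructor <;> nlinarith [sq_nonneg (a + b), sq_nonneg (a - b)]
    calc |s * d + b * a + (t * c + a * b)| = |s * d + t * c + 2 * (a * b)| := by ring_nf
      _ ≤ |s * d| + |t * c| + |2 * (a * b)| := abs_add_three _ _ _
      _ ≤ _ := by rw [abs_mul, abs_mul]; gcongr
  have h4 : (s * b + t * a) ^ 2 ≤ 2 * s ^ 2 * b ^ 2 + 2 * t ^ 2 * a ^ 2 := by
    nlinarith [sq_nonneg (s * b - t * a)]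
  have h5 : 0 ≤ |t| * a ^ 2 + (2 * t ^ 2 + 1) * |c| + |s| * b ^ 2 + (2 * s ^ 2 + 1) * |d| := by
    positivity
  nlinarith

/-- With a and b the vectors of first and second directional derivatives of the `u j`, the composite
has second derivative Df(b) + D²f(a, a). The part quadratic in a is again covered by the squares in
the gauge. -/
lemma gauge_comp_le {k : ℕ} {f : (Fin k → ℝ) → ℝ} (hf : ContDiff ℝ ∞ f)
    {u : Fin k → (Fin n → ℝ) → ℝ} (hu : ∀ j, ContDiff ℝ ∞ (u j)) (y : Fin n → ℝ) :
    gauge e (fun y => f (fun j => u j y)) y ≤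
      (‖fderiv ℝ f (fun j => u j y)‖ ^ 2 + ‖fderiv ℝ f (fun j => u j y)‖
        + ‖fderiv ℝ (fderiv ℝ f) (fun j => u j y)‖) * ∑ j, gauge e (u j) y := by
  have hf1 := hf.differentiable (by simp)
  have hf2 := (hf.fderiv_right (m := ∞) (by simp)).differentiable (by simp)
  have hu1 := fun j => (hu j).differentiable (by simp)
  have hu2 := fun j => (contDiff_fderiv_dir e (hu j)).differentiable (by simp)
  have hU : ∀ z, HasFDerivAt (fun z j => u j z) (ContinuousLinearMap.pi fun j => fderiv ℝ (u j) z) z :=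
    fun z => hasFDerivAt_pi.2 fun j => (hu1 j z).hasFDerivAt
  have h1 : ∀ z, fderiv ℝ (fun y => f (fun j => u j y)) z e
      = fderiv ℝ f (fun j => u j z) (fun j => fderiv ℝ (u j) z e) := fun z => by
    have := ((hf1 _).hasFDerivAt.comp z (hU z)).fderiv
    simp only [Function.comp_def] at this
    rw [this]; rfl
  have hV : HasFDerivAt (fun z j => fderiv ℝ (u j) z e)
      (ContinuousLinearMap.pi fun j => fderiv ℝ (fun z => fderiv ℝ (u j) z e) y) y :=
    hasFDerivAt_pi.2 fun j => (hu2 j y).hasFDerivAt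
  have h2 := (((hf2 _).hasFDerivAt.comp y (hU y)).clm_apply hV).fderiv
  simp only [Function.comp_def] at h2
  unfold gauge
  simp only [h1]
  rw [h2]
  simp only [add_apply, ContinuousLinearMap.comp_apply, ContinuousLinearMap.flip_apply]
  set a : Fin k → ℝ := fun j => fderiv ℝ (u j) y e with ha
  set b : Fin k → ℝ := fun j => fderiv ℝ (fun z => fderiv ℝ (u j) z e) y e with hb
  have e1 : (ContinuousLinearMap.pi fun j => fderiv ℝ (u j) y) e = a := rfl
  have e2 : (ContinuousLinearMap.pi fun j => fderiv ℝ (fun z => fderiv ℝ (u j) z e) y) e = b := rfl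
  rw [e1, e2]
  set A := fderiv ℝ f (fun j => u j y)
  set B := fderiv ℝ (fderiv ℝ f) (fun j => u j y)
  have hS : ∑ j, (fderiv ℝ (u j) y e ^ 2 + |fderiv ℝ (fun z => fderiv ℝ (u j) z e) y e|)
      = ∑ j, a j ^ 2 + ∑ j, |b j| := Finset.sum_add_distrib
  rw [hS]
  have hs0 : 0 ≤ ∑ j, a j ^ 2 := Finset.sum_nonneg fun _ _ => sq_nonneg _
  have ht0 : 0 ≤ ∑ j, |b j| := Finset.sum_nonneg fun _ _ => abs_nonneg _
  have hna : ‖a‖ ^ 2 ≤ ∑ j, a j ^ 2 := by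
    have : ‖a‖ ≤ √(∑ i, a i ^ 2) := by
      refine (pi_norm_le_iff_of_nonneg (Real.sqrt_nonneg _)).2 fun i => ?_
      exact Real.abs_le_sqrt
        (Finset.single_le_sum (f := fun i => a i ^ 2) (fun _ _ => sq_nonneg _) (Finset.mem_univ i))
    calc ‖a‖ ^ 2 ≤ √(∑ i, a i ^ 2) ^ 2 := by gcongr
      _ = _ := Real.sq_sqrt hs0
  have hnb : ‖b‖ ≤ ∑ j, |b j| := (pi_norm_le_iff_of_nonneg ht0).2 fun i =>
    Finset.single_le_sum (f := fun i => |b i|) (fun _ _ => abs_nonneg _) (Finset.mem_univ i)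
  have h3 : (A a) ^ 2 ≤ ‖A‖ ^ 2 * ∑ j, a j ^ 2 := by
    calc (A a) ^ 2 = ‖A a‖ ^ 2 := by simp
      _ ≤ (‖A‖ * ‖a‖) ^ 2 := by gcongr; exact A.le_opNorm a
      _ = ‖A‖ ^ 2 * ‖a‖ ^ 2 := mul_pow _ _ _
      _ ≤ _ := by gcongr
  have h4 : |A b| ≤ ‖A‖ * ∑ j, |b j| := (A.le_opNorm b).trans (by gcongr)
  have h5 : |(B a) a| ≤ ‖B‖ * ∑ j, a j ^ 2 := by
    calc |(B a) a| ≤ ‖B a‖ * ‖a‖ := (B a).le_opNorm a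
      _ ≤ ‖B‖ * ‖a‖ * ‖a‖ := by gcongr; exact B.le_opNorm a
      _ = ‖B‖ * ‖a‖ ^ 2 := by ring
      _ ≤ _ := by gcongr
  have h6 := abs_add_le (A b) ((B a) a)
  have h7 : 0 ≤ ‖A‖ * ∑ j, a j ^ 2 + (‖A‖ ^ 2 + ‖B‖) * ∑ j, |b j| := by positivity
  nlinarith

end gauge

end DSGD

namespace DSGD

/-! ### Weighted integrals of order η^(-ℓ). -/

section WeightBdd

variable {n : ℕ}

/-- A family `v η`, `0 < η ≤ 1`, of nonnegative continuous functions whose integrals against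
sufficiently fast decaying weights are `O(η ^ (-ℓ))`, and which is bounded by polynomials
times some power of `1 / η`. -/
structure WeightBdd (ℓ : ℕ) (v : Ioc (0 : ℝ) 1 → (Fin n → ℝ) → ℝ) : Prop where
  continuous : ∀ η, Continuous (v η)
  nonneg : ∀ η y, 0 ≤ v η y
  polyBdd : ∃ M : ℕ, PolyBdd (fun (η : Ioc (0 : ℝ) 1) y => (η : ℝ) ^ M * v η y)
  integral_le : ∃ K₀ : ℕ, ∀ K ≥ K₀, ∃ C, 0 ≤ C ∧
    ∀ η : Ioc (0 : ℝ) 1, ∫ y, v η y * weight K y ≤ C * ((η : ℝ) ^ ℓ)⁻¹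

namespace WeightBdd

variable {ℓ : ℕ} {v w R : Ioc (0 : ℝ) 1 → (Fin n → ℝ) → ℝ}

lemma integrable (hv : WeightBdd ℓ v) :
    ∃ K₀ : ℕ, ∀ K ≥ K₀, ∀ η, Integrable (fun y => v η y * weight K y) := by
  obtain ⟨M, C, N, hC, h⟩ := hv.polyBdd
  refine ⟨N + n + 1, fun K hK η => ?_⟩
  have hη : 0 < (η : ℝ) ^ M := pow_pos η.2.1 M
  refine ((integrable_pow_mul_weight N hK).const_mul (C / (η : ℝ) ^ M)).mono'
    ((hv.continuous η).mul (continuous_weight K)).aestronglyMeasurable (ae_of_all _ fun y => ?_)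
  have h1 := h η y
  have hw := (weight_pos K y).le
  rw [norm_mul, Real.norm_of_nonneg hη.le, ← le_div_iff₀' hη] at h1
  rw [norm_mul, Real.norm_of_nonneg hw]
  calc _ ≤ C * (1 + ‖y‖) ^ N / (η : ℝ) ^ M * weight K y := by gcongr
    _ = _ := by ring

lemma mono (hv : WeightBdd ℓ v) (hc : ∀ η, Continuous (w η)) (h0 : ∀ η y, 0 ≤ w η y)
    (h : ∀ η y, w η y ≤ v η y) : WeightBdd ℓ w := by
  refine ⟨hc, h0, ?_, ?_⟩
  · obtain ⟨M, hM⟩ := hv.polyBdd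
    refine ⟨M, hM.mono fun η y => ?_⟩
    have hη : 0 < (η : ℝ) ^ M := pow_pos η.2.1 M
    have := h η y
    rw [norm_mul, norm_mul, Real.norm_of_nonneg (h0 η y), Real.norm_of_nonneg (hv.nonneg η y)]
    gcongr
  · obtain ⟨K₀, hK₀⟩ := hv.integral_le
    obtain ⟨K₁, hK₁⟩ := hv.integrable
    refine ⟨max K₀ K₁, fun K hK => ?_⟩
    obtain ⟨C, hC, hCi⟩ := hK₀ K (le_of_max_le_left hK)
    refine ⟨C, hC, fun η => le_trans ?_ (hCi η)⟩
    refine integral_mono_of_nonneg (ae_of_all _ fun y => mul_nonneg (h0 η y) (weight_pos K y).le)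
      (hK₁ K (le_of_max_le_right hK) η) (ae_of_all _ fun y => ?_)
    exact mul_le_mul_of_nonneg_right (h η y) (weight_pos K y).le

lemma one_le_inv_pow (ℓ : ℕ) (η : Ioc (0 : ℝ) 1) : 1 ≤ ((η : ℝ) ^ ℓ)⁻¹ :=
  one_le_inv₀ (pow_pos η.2.1 ℓ) |>.2 (pow_le_one₀ η.2.1.le η.2.2)

lemma one (ℓ : ℕ) : WeightBdd ℓ (fun _ (_ : Fin n → ℝ) => 1) := by
  refine ⟨fun _ => continuous_const, fun _ _ => zero_le_one, ⟨0, ?_⟩, ⟨0, fun K _ => ?_⟩⟩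
  · simpa using PolyBdd.const 1
  · have h0 : 0 ≤ ∫ y : Fin n → ℝ, 1 * weight K y :=
      integral_nonneg fun y => by simpa using (weight_pos K y).le
    refine ⟨_, h0, fun η => le_mul_of_one_le_right h0 (one_le_inv_pow ℓ η)⟩

lemma add (hv : WeightBdd ℓ v) (hw : WeightBdd ℓ w) : WeightBdd ℓ (fun η y => v η y + w η y) := by
  refine ⟨fun η => (hv.continuous η).add (hw.continuous η),
    fun η y => add_nonneg (hv.nonneg η y) (hw.nonneg η y), ?_, ?_⟩
  · obtain ⟨M, hM⟩ := hv.polyBdd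
    obtain ⟨M', hM'⟩ := hw.polyBdd
    refine ⟨M + M', (hM.add hM').mono fun η y => ?_⟩
    have hη := fun M : ℕ => pow_pos η.2.1 M
    have hη1 := fun M : ℕ => pow_le_one₀ (n := M) η.2.1.le η.2.2
    have h1 := hv.nonneg η y
    have h2 := hw.nonneg η y
    have e1 := hη M
    have e2 := hη M'
    have f1 := hη1 M
    have f2 := hη1 M'
    rw [Real.norm_of_nonneg (by rw [pow_add]; positivity), Real.norm_of_nonneg (by positivity),
      pow_add]
    have g1 : (η : ℝ) ^ M * v η y * (η : ℝ) ^ M' ≤ (η : ℝ) ^ M * v η y :=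
      mul_le_of_le_one_right (by positivity) f2
    have g2 : (η : ℝ) ^ M' * w η y * (η : ℝ) ^ M ≤ (η : ℝ) ^ M' * w η y :=
      mul_le_of_le_one_right (by positivity) f1
    linarith
  · obtain ⟨K₀, hK₀⟩ := hv.integral_le
    obtain ⟨K₁, hK₁⟩ := hv.integrable
    obtain ⟨K₂, hK₂⟩ := hw.integral_le
    obtain ⟨K₃, hK₃⟩ := hw.integrable
    refine ⟨K₀ + K₁ + K₂ + K₃, fun K hK => ?_⟩
    obtain ⟨C, hC, hCi⟩ := hK₀ K (by omega)
    obtain ⟨D, hD, hDi⟩ := hK₂ K (by omega)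
    refine ⟨C + D, by positivity, fun η => ?_⟩
    simp only [add_mul]
    rw [integral_add (hK₁ K (by omega) η) (hK₃ K (by omega) η)]
    exact add_le_add (hCi η) (hDi η)

lemma sum {κ : Type*} (s : Finset κ) {v : κ → Ioc (0 : ℝ) 1 → (Fin n → ℝ) → ℝ}
    (hv : ∀ j ∈ s, WeightBdd ℓ (v j)) : WeightBdd ℓ (fun η y => ∑ j ∈ s, v j η y) := by
  classical
  induction s using Finset.induction_on with
  | empty =>
    exact (one ℓ).mono (fun _ => by simpa using continuous_const) (fun _ _ => by simp)
      (fun _ _ => by simp)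
  | insert a s ha ih =>
    simp only [Finset.sum_insert ha]
    exact (hv a (by simp)).add (ih fun j hj => hv j (by simp [hj]))

/-- Raising the weight exponent by N swallows the polynomial factor. For this reason `WeightBdd`
asks for bounds for all large K and not for a single one. -/
lemma mul_pow (hv : WeightBdd ℓ v) {C : ℝ} (hC : 0 ≤ C) (N : ℕ) :
    WeightBdd ℓ (fun η y => C * (1 + ‖y‖) ^ N * v η y) := by
  refine ⟨fun η => (by fun_prop : Continuous fun y : Fin n → ℝ => C * (1 + ‖y‖) ^ N).mul
    (hv.continuous η), fun η y => mul_nonneg (by positivity) (hv.nonneg η y), ?_, ?_⟩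
  · obtain ⟨M, D, L, hD, hM⟩ := hv.polyBdd
    refine ⟨M, C * D, N + L, by positivity, fun η y => ?_⟩
    calc _ = C * (1 + ‖y‖) ^ N * ‖(η : ℝ) ^ M * v η y‖ := by
          rw [← Real.norm_of_nonneg (by positivity : 0 ≤ C * (1 + ‖y‖) ^ N), ← norm_mul]
          congr 1
          ring
      _ ≤ C * (1 + ‖y‖) ^ N * (D * (1 + ‖y‖) ^ L) := by gcongr; exact hM η y
      _ = _ := by ring
  · obtain ⟨K₀, hK₀⟩ := hv.integral_le
    obtain ⟨K₁, hK₁⟩ := hv.integrable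
    refine ⟨N + (K₀ + K₁), fun K hK => ?_⟩
    obtain ⟨L, rfl⟩ := Nat.exists_eq_add_of_le hK
    obtain ⟨D, hD, hDi⟩ := hK₀ (K₀ + K₁ + L) (by omega)
    refine ⟨C * 2 ^ N * D, by positivity, fun η => ?_⟩
    calc _ ≤ ∫ y, C * 2 ^ N * (v η y * weight (K₀ + K₁ + L) y) := by
          refine integral_mono_of_nonneg (ae_of_all _ fun y => ?_)
            ((hK₁ (K₀ + K₁ + L) (by omega) η).const_mul _) (ae_of_all _ fun y => ?_)
          · exact mul_nonneg (mul_nonneg (by positivity) (hv.nonneg η y)) (weight_pos _ y).le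
          · have h1 := pow_mul_weight_le N (K₀ + K₁ + L) y
            have h2 := hv.nonneg η y
            rw [← add_assoc] at h1
            calc _ = C * v η y * ((1 + ‖y‖) ^ N * weight (N + (K₀ + K₁) + L) y) := by ring
              _ ≤ C * v η y * (2 ^ N * weight (K₀ + K₁ + L) y) := by gcongr
              _ = _ := by ring
      _ = C * 2 ^ N * ∫ y, v η y * weight (K₀ + K₁ + L) y := integral_const_mul _ _
      _ ≤ C * 2 ^ N * (D * ((η : ℝ) ^ ℓ)⁻¹) := by gcongr; exact hDi η
      _ = _ := by ring

lemma mono_mul (hv : WeightBdd ℓ v) (hR : PolyBdd R) (hc : ∀ η, Continuous (w η))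
    (h0 : ∀ η y, 0 ≤ w η y) (h : ∀ η y, w η y ≤ R η y * v η y) : WeightBdd ℓ w := by
  obtain ⟨C, N, hC, hR⟩ := hR
  refine (hv.mul_pow hC N).mono hc h0 fun η y => (h η y).trans ?_
  exact mul_le_mul_of_nonneg_right ((Real.le_norm_self _).trans (hR η y)) (hv.nonneg η y)

lemma inv_mul (hv : WeightBdd ℓ v) : WeightBdd (ℓ + 1) (fun η y => (η : ℝ)⁻¹ * v η y) := by
  refine ⟨fun η => continuous_const.mul (hv.continuous η),
    fun η y => mul_nonneg (inv_nonneg.2 η.2.1.le) (hv.nonneg η y), ?_, ?_⟩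
  · obtain ⟨M, hM⟩ := hv.polyBdd
    refine ⟨M + 1, hM.mono fun η y => le_of_eq ?_⟩
    have : (η : ℝ) ≠ 0 := η.2.1.ne'
    congr 1
    field_simp
    ring
  · obtain ⟨K₀, hK₀⟩ := hv.integral_le
    refine ⟨K₀, fun K hK => ?_⟩
    obtain ⟨C, hC, hCi⟩ := hK₀ K hK
    refine ⟨C, hC, fun η => ?_⟩
    have : 0 ≤ (η : ℝ)⁻¹ := inv_nonneg.2 η.2.1.le
    simp only [mul_assoc]
    rw [integral_const_mul]
    calc _ ≤ (η : ℝ)⁻¹ * (C * ((η : ℝ) ^ ℓ)⁻¹) := by gcongr; exact hCi η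
      _ = _ := by rw [pow_succ, mul_inv]; ring

lemma succ (hv : WeightBdd ℓ v) : WeightBdd (ℓ + 1) v :=
  hv.inv_mul.mono hv.continuous hv.nonneg fun η y =>
    le_mul_of_one_le_left (hv.nonneg η y) (one_le_inv₀ η.2.1 |>.2 η.2.2)

end WeightBdd

/-! ### The sigmoid and the integration by parts. -/

/-- The derivative `σ_η'(x)` of the logistic sigmoid `σ_η` with accuracy coefficient `η`. -/
noncomputable def sigmoidDeriv (η x : ℝ) : ℝ :=
  Real.sigmoid (x / η) * (1 - Real.sigmoid (x / η)) / η

lemma sigmoidDeriv_nonneg {η : ℝ} (hη : 0 < η) (x : ℝ) : 0 ≤ sigmoidDeriv η x := by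
  have h1 := Real.sigmoid_nonneg (x / η)
  have h2 := sub_nonneg.2 (Real.sigmoid_le_one (x / η))
  unfold sigmoidDeriv; positivity

lemma sigmoidDeriv_le {η : ℝ} (hη : 0 < η) (x : ℝ) : sigmoidDeriv η x ≤ η⁻¹ := by
  have h1 := Real.sigmoid_nonneg (x / η)
  have h2 := Real.sigmoid_le_one (x / η)
  rw [sigmoidDeriv, div_eq_mul_inv]
  exact mul_le_of_le_one_left (inv_nonneg.2 hη.le) (by nlinarith)

lemma continuous_sigmoidDeriv (η : ℝ) : Continuous (sigmoidDeriv η) := by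
  have : Continuous Real.sigmoid := continuous_sigmoid
  unfold sigmoidDeriv; fun_prop

lemma hasDerivAt_sigmoid_div (η x : ℝ) :
    HasDerivAt (fun x => Real.sigmoid (x / η)) (sigmoidDeriv η x) x := by
  have := (Real.hasDerivAt_sigmoid (x / η)).comp x ((hasDerivAt_id x).div_const η)
  exact this.congr_deriv (by simp [sigmoidDeriv, div_eq_mul_inv])

lemma hasDerivAt_sigmoidDeriv (η x : ℝ) :
    HasDerivAt (sigmoidDeriv η)
      (sigmoidDeriv η x * ((1 - 2 * Real.sigmoid (x / η)) / η)) x := by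
  have h := hasDerivAt_sigmoid_div η x
  have := (h.fun_mul (h.const_sub 1)).div_const η
  exact this.congr_deriv (by simp only [sigmoidDeriv]; ring)

variable (e : Fin n → ℝ)

lemma fderiv_sigmoid_div {u : (Fin n → ℝ) → ℝ} (hu : ContDiff ℝ ∞ u) (η : ℝ) (y : Fin n → ℝ) :
    fderiv ℝ (fun y => Real.sigmoid (u y / η)) y e = sigmoidDeriv η (u y) * fderiv ℝ u y e := by
  have := ((hasDerivAt_sigmoid_div η (u y)).comp_hasFDerivAt y
    (hu.differentiable (by simp) y).hasFDerivAt).fderiv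
  simp only [Function.comp_def] at this
  rw [this]; rfl

/-- From 0 ≤ σ_η' ≤ 1/η and |σ_η''| ≤ σ_η'/η. One factor σ_η'(u) is deliberately kept in front of
(∂_e u)², so that `WeightBdd.sigmoidDeriv_mul_sq` can save a power of 1/η. -/
lemma gauge_sigmoid_le {u : (Fin n → ℝ) → ℝ} (hu : ContDiff ℝ ∞ u) {η : ℝ} (hη : 0 < η)
    (y : Fin n → ℝ) : gauge e (fun y => Real.sigmoid (u y / η)) y ≤
      2 * (η⁻¹ * (sigmoidDeriv η (u y) * fderiv ℝ u y e ^ 2 + gauge e u y)) := by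
  unfold gauge
  simp only [fderiv_sigmoid_div e hu]
  have h1 := (hasDerivAt_sigmoidDeriv η (u y)).comp_hasFDerivAt y
    (hu.differentiable (by simp) y).hasFDerivAt
  have h2 := (h1.mul ((contDiff_fderiv_dir e hu).differentiable (by simp) y).hasFDerivAt).fderiv
  have h3 : ((sigmoidDeriv η ∘ u) * fun z => fderiv ℝ u z e)
      = fun y => sigmoidDeriv η (u y) * fderiv ℝ u y e := rfl
  rw [h3] at h2
  rw [h2]
  simp only [add_apply, smul_apply, smul_eq_mul, Function.comp_apply]
  have hs0 := Real.sigmoid_nonneg (u y / η)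
  have hs1 := Real.sigmoid_le_one (u y / η)
  have hT0 := sigmoidDeriv_nonneg hη (u y)
  have hT1 := sigmoidDeriv_le hη (u y)
  have hi : 0 < η⁻¹ := inv_pos.2 hη
  have hc : |(1 - 2 * Real.sigmoid (u y / η)) / η| ≤ η⁻¹ := by
    rw [abs_div, abs_of_pos hη, div_eq_mul_inv]
    refine mul_le_of_le_one_left hi.le (abs_le.2 ⟨by linarith, by linarith⟩)
  generalize (1 - 2 * Real.sigmoid (u y / η)) / η = c at hc
  generalize sigmoidDeriv η (u y) = T at *
  generalize fderiv ℝ u y e = a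
  generalize fderiv ℝ (fun z => fderiv ℝ u z e) y e = b
  have h4 : |T * b + a * (T * c * a)| ≤ η⁻¹ * |b| + η⁻¹ * (T * a ^ 2) := by
    refine (abs_add_le _ _).trans (add_le_add ?_ ?_)
    · rw [abs_mul, abs_of_nonneg hT0]; gcongr
    · rw [show a * (T * c * a) = c * (T * a ^ 2) by ring, abs_mul,
        abs_of_nonneg (by positivity : 0 ≤ T * a ^ 2)]
      gcongr
  have h5 : (T * a) ^ 2 ≤ η⁻¹ * (T * a ^ 2) := by
    rw [show (T * a) ^ 2 = T * (T * a ^ 2) by ring]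
    gcongr
  have h6 : 0 ≤ η⁻¹ * |b| + 2 * (η⁻¹ * a ^ 2) := by positivity
  linarith

/-- σ_η'(u) ∂_e u is the derivative of σ_η(u), which is bounded by 1. Integrating by parts moves the
derivative onto ∂_e u times the weight, so the factor σ_η' disappears and the order ℓ is not raised.
-/
lemma WeightBdd.sigmoidDeriv_mul_sq {ℓ : ℕ} {u : Ioc (0 : ℝ) 1 → (Fin n → ℝ) → ℝ}
    (hu : ∀ η, ContDiff ℝ ∞ (u η)) (h : WeightBdd ℓ (fun η => gauge e (u η))) :
    WeightBdd ℓ (fun η y => sigmoidDeriv η (u η y) * fderiv ℝ (u η) y e ^ 2) := by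
  have hD := fun η => contDiff_fderiv_dir e (hu η)
  have hc : ∀ η : Ioc (0 : ℝ) 1,
      Continuous (fun y => sigmoidDeriv η (u η y) * fderiv ℝ (u η) y e ^ 2) := fun η =>
    ((continuous_sigmoidDeriv η).comp (hu η).continuous).mul ((hD η).continuous.pow 2)
  have h0 : ∀ (η : Ioc (0 : ℝ) 1) y, 0 ≤ sigmoidDeriv η (u η y) * fderiv ℝ (u η) y e ^ 2 :=
    fun η y => mul_nonneg (sigmoidDeriv_nonneg η.2.1 _) (sq_nonneg _)
  -- The crude estimate σ_η' ≤ 1/η loses one order; it serves only for the polynomial bound and for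
  -- integrability.
  have hrough : WeightBdd (ℓ + 1)
      (fun η y => sigmoidDeriv η (u η y) * fderiv ℝ (u η) y e ^ 2) :=
    h.inv_mul.mono hc h0 fun η y => mul_le_mul (sigmoidDeriv_le η.2.1 _)
      (le_add_of_nonneg_right (abs_nonneg _)) (sq_nonneg _) (inv_nonneg.2 η.2.1.le)
  refine ⟨hc, h0, hrough.polyBdd, ?_⟩
  -- The derivative of the weight leaves |∂_e u| to the first power, which is bounded by (∂_e u)² +
  -- 1; hence the added constant.
  obtain ⟨K₀, hK₀⟩ := (h.add (one ℓ)).integral_le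
  obtain ⟨K₁, hK₁⟩ := (h.add (one ℓ)).integrable
  obtain ⟨K₂, hK₂⟩ := hrough.integrable
  refine ⟨K₀ + K₁ + K₂, fun K hK => ?_⟩
  obtain ⟨C, hC, hCi⟩ := hK₀ K (by omega)
  obtain ⟨B, hB, hBw⟩ := abs_fderiv_weight_le e K
  refine ⟨(1 + B) * C, by positivity, fun η => ?_⟩
  have hint := hK₁ K (by omega) η
  set S : (Fin n → ℝ) → ℝ := fun y => Real.sigmoid (u η y / η)
  have hS : ContDiff ℝ ∞ S :=
    (contDiff_sigmoid.of_le le_top : ContDiff ℝ ∞ Real.sigmoid).comp ((hu η).div_const _)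
  set D : (Fin n → ℝ) → ℝ := fun y => fderiv ℝ (u η) y e
  have hDc : ContDiff ℝ ∞ D := hD η
  have hDw : ContDiff ℝ ∞ (fun y => D y * weight K y) := hDc.mul (contDiff_weight K)
  have hderiv : ∀ y, fderiv ℝ (fun y => D y * weight K y) y e
      = D y * fderiv ℝ (weight K) y e + weight K y * fderiv ℝ D y e := fun y => by
    rw [fderiv_fun_mul (hDc.differentiable (by simp) y)
      ((contDiff_weight K).differentiable (by simp) y)]
    rfl
  have hSabs : ∀ y, |S y| ≤ 1 := fun y => by
    rw [abs_of_nonneg (Real.sigmoid_nonneg _)]; exact Real.sigmoid_le_one _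
  have hDabs : ∀ y, |D y| ≤ gauge e (u η) y + 1 := fun y => by
    have h1 : D y ^ 2 ≤ gauge e (u η) y := le_add_of_nonneg_right (abs_nonneg _)
    rw [abs_le]; constructor <;> nlinarith [sq_nonneg (D y + 1), sq_nonneg (D y - 1)]
  have hbound : ∀ y, |S y * fderiv ℝ (fun y => D y * weight K y) y e|
      ≤ (1 + B) * ((gauge e (u η) y + 1) * weight K y) := fun y => by
    have hw := (weight_pos K y).le
    have hg := gauge_nonneg e (u η) y
    have h1 : |fderiv ℝ D y e| ≤ gauge e (u η) y + 1 := by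
      have : |fderiv ℝ D y e| ≤ gauge e (u η) y := le_add_of_nonneg_left (sq_nonneg _)
      linarith
    rw [abs_mul, hderiv]
    calc _ ≤ 1 * (|D y| * |fderiv ℝ (weight K) y e| + weight K y * |fderiv ℝ D y e|) := by
          gcongr
          · exact hSabs y
          · refine (abs_add_le _ _).trans_eq ?_
            rw [abs_mul, abs_mul, abs_of_nonneg hw]
      _ ≤ 1 * ((gauge e (u η) y + 1) * (B * weight K y) + weight K y * (gauge e (u η) y + 1)) := by
          gcongr
          · exact hDabs y
          · exact hBw y
      _ = _ := by ring
  have hi2 : Integrable (fun y => S y * fderiv ℝ (fun y => D y * weight K y) y e) :=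
    (hint.const_mul (1 + B)).mono' (hS.continuous.mul
      (contDiff_fderiv_dir e hDw).continuous).aestronglyMeasurable (ae_of_all _ hbound)
  have hi3 : Integrable (fun y => S y * (D y * weight K y)) := by
    refine hint.mono' (hS.continuous.mul hDw.continuous).aestronglyMeasurable
      (ae_of_all _ fun y => ?_)
    have hw := (weight_pos K y).le
    rw [norm_mul, norm_mul, Real.norm_of_nonneg hw]
    calc _ ≤ 1 * ((gauge e (u η) y + 1) * weight K y) := by
          gcongr
          · exact hSabs y
          · exact hDabs y
      _ = _ := one_mul _
  have heq : ∀ y, sigmoidDeriv η (u η y) * fderiv ℝ (u η) y e ^ 2 * weight K y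
      = fderiv ℝ S y e * (D y * weight K y) := fun y => by
    rw [fderiv_sigmoid_div e (hu η)]; ring
  have hi1 := hK₂ K (by omega) η
  simp only [heq] at hi1 ⊢
  have hparts := integral_mul_fderiv_eq_neg_fderiv_mul_of_integrable hi1 hi2 hi3
    (fun y _ => hS.differentiable (by simp) y) (fun y _ => hDw.differentiable (by simp) y)
  calc _ = -∫ y, S y * fderiv ℝ (fun y => D y * weight K y) y e := by rw [hparts, neg_neg]
    _ ≤ ∫ y, |S y * fderiv ℝ (fun y => D y * weight K y) y e| :=
        (neg_le_abs _).trans abs_integral_le_integral_abs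
    _ ≤ ∫ y, (1 + B) * ((gauge e (u η) y + 1) * weight K y) :=
        integral_mono hi2.abs (hint.const_mul _) hbound
    _ = (1 + B) * ∫ y, (gauge e (u η) y + 1) * weight K y := integral_const_mul _ _
    _ ≤ (1 + B) * (C * ((η : ℝ) ^ ℓ)⁻¹) := by gcongr; exact hCi η
    _ = _ := by ring

lemma Expr.smooth_ite_eq (F G H : Expr n) (η : ℝ) : (Expr.ite F G H).smooth η =
    fun y => G.smooth η y + Real.sigmoid (F.smooth η y / η) * (H.smooth η y + -G.smooth η y) := by
  funext y
  simp only [Expr.smooth, neg_div, Real.sigmoid_neg]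
  ring

/-- Applications multiply the gauge by polynomially bounded factors and keep the order. A
conditional is G + σ_η(F)(H - G); its sigmoid contributes η⁻¹ times terms of the order of the guard,
which is one less than that allowed for the conditional. -/
theorem Expr.HasDepth.weightBdd_gauge {ℓ : ℕ} {F : Expr n} (hF : F.HasDepth ℓ) :
    WeightBdd ℓ (fun η => gauge e (F.smooth η)) := by
  have hpoly : ∀ F : Expr n, PolyBdd (fun (η : Ioc (0 : ℝ) 1) y => F.smooth η y) := fun F => by
    obtain ⟨C, N, hC, h⟩ := F.polyBdd_smooth
    exact ⟨C, N, hC, fun η y => h η y⟩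
  induction hF with
  | var j =>
    refine ((WeightBdd.one 0).mul_pow (sq_nonneg (e j)) 0).mono
      (fun η => continuous_gauge e (Expr.contDiff_smooth _ _)) (fun η y => gauge_nonneg _ _ _)
      fun η y => le_of_eq ?_
    have h1 : ∀ z, fderiv ℝ ((Expr.var j).smooth (n := n) (η : ℝ)) z
        = ContinuousLinearMap.proj (R := ℝ) (φ := fun _ : Fin n => ℝ) j := fun z =>
      (ContinuousLinearMap.proj (R := ℝ) (φ := fun _ : Fin n => ℝ) j).fderiv
    simp [gauge, h1]
  | app f hf args hargs ih =>
    have hR : PolyBdd (fun (η : Ioc (0 : ℝ) 1) y =>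
        ‖fderiv ℝ f (fun j => (args j).smooth η y)‖ ^ 2
        + ‖fderiv ℝ f (fun j => (args j).smooth η y)‖
        + ‖fderiv ℝ (fderiv ℝ f) (fun j => (args j).smooth η y)‖) := by
      have hf1 := hf.2 1
      have hf2 := hf.2 2
      simp only [norm_iteratedFDeriv_one] at hf1
      have hf2' : ∃ (k : ℕ) (C : ℝ), ∀ x, ‖‖fderiv ℝ (fderiv ℝ f) x‖‖ ≤
          C * (1 + ‖x‖) ^ k := by
        obtain ⟨k, C, h⟩ := hf2
        refine ⟨k, C, fun x => ?_⟩
        have := h x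
        rw [← norm_iteratedFDeriv_fderiv, norm_iteratedFDeriv_one] at this
        refine (le_of_eq (abs_of_nonneg ?_)).trans this
        exact ContinuousLinearMap.opNorm_nonneg _
      have hpi : PolyBdd (fun (η : Ioc (0 : ℝ) 1) y j => (args j).smooth η y) :=
        PolyBdd.pi fun j => hpoly (args j)
      have g1 : PolyBdd (fun (η : Ioc (0 : ℝ) 1) y =>
          ‖fderiv ℝ f (fun j => (args j).smooth η y)‖) :=
        (PolyBdd.comp hf1 hpi).mono fun i y => by simp
      have g2 : PolyBdd (fun (η : Ioc (0 : ℝ) 1) y =>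
          ‖fderiv ℝ (fderiv ℝ f) (fun j => (args j).smooth η y)‖) :=
        PolyBdd.comp (f := fun x => ‖fderiv ℝ (fderiv ℝ f) x‖) hf2' hpi
      exact ((g1.pow 2).add g1).add g2
    refine (WeightBdd.sum Finset.univ fun j _ => ih j).mono_mul hR
      (fun η => continuous_gauge e (Expr.contDiff_smooth _ _)) (fun η y => gauge_nonneg _ _ _)
      fun η y => ?_
    exact gauge_comp_le e hf.1 (fun j => (args j).contDiff_smooth η) y
  | @ite ℓ F G H hF hG hH ihF ihG ihH =>
    have hd : ∀ η : ℝ, ContDiff ℝ ∞ (fun y => H.smooth η y + -G.smooth η y) := fun η =>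
      (H.contDiff_smooth η).add (G.contDiff_smooth η).neg
    have hs : ∀ η : ℝ, ContDiff ℝ ∞ (fun y => Real.sigmoid (F.smooth η y / η)) := fun η =>
      (contDiff_sigmoid.of_le le_top : ContDiff ℝ ∞ Real.sigmoid).comp
        ((F.contDiff_smooth η).div_const _)
    have h1 : WeightBdd (ℓ + 1) (fun η y => gauge e (F.smooth η) y) := ihF.succ
    have h2 := ((ihF.sigmoidDeriv_mul_sq e fun η => F.contDiff_smooth η).add ihF).inv_mul
    have h3 := (ihG.add ihH).add h2
    have hV : PolyBdd (fun (η : Ioc (0 : ℝ) 1) y => H.smooth η y + -G.smooth η y) :=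
      (hpoly H).add ((hpoly G).mono fun η y => by simp)
    -- Here 18 = 2 + 2·4·2: the first sum rule costs 2 on G, and the factor H - G costs 2 for the
    -- outer sum, 4 from `k5` and 2 for its own difference. The 4 is 2 from the sum rule times 2
    -- from `gauge_sigmoid_le`.
    have hR : PolyBdd (fun (η : Ioc (0 : ℝ) 1) y =>
        18 + 4 * (2 * (H.smooth η y + -G.smooth η y) ^ 2 + |H.smooth η y + -G.smooth η y| + 1)) := by
      refine (PolyBdd.const 18).add ((PolyBdd.const 4).mul ?_)
      exact (((PolyBdd.const 2).mul (hV.pow 2)).add (hV.mono fun η y => by simp)).add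
        (PolyBdd.const 1)
    refine h3.mono_mul hR
      (fun η => continuous_gauge e (Expr.contDiff_smooth _ _)) (fun η y => gauge_nonneg _ _ _)
      fun η y => ?_
    rw [Expr.smooth_ite_eq]
    have k1 := gauge_add_le e (G.contDiff_smooth η) ((hs η).mul (hd η)) y
    have k2 := gauge_mul_le e (hs η) (hd η) y
    have k3 := gauge_sigmoid_le e (F.contDiff_smooth η) η.2.1 y
    have k4 := gauge_add_le e (H.contDiff_smooth η) (G.contDiff_smooth η).neg y
    rw [gauge_neg] at k4
    have hs0 := Real.sigmoid_nonneg (F.smooth η y / η)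
    have hs1 := Real.sigmoid_le_one (F.smooth η y / η)
    have k5 : 2 * Real.sigmoid (F.smooth η y / η) ^ 2 + |Real.sigmoid (F.smooth η y / η)| + 1 ≤ 4 := by
      rw [abs_of_nonneg hs0]; nlinarith
    have g1 := gauge_nonneg e (fun y => H.smooth η y + -G.smooth η y) y
    have g2 := gauge_nonneg e (G.smooth η) y
    have g3 := gauge_nonneg e (H.smooth η) y
    have k6 := mul_le_mul_of_nonneg_right k5 g1
    have hA : 0 ≤ 2 * (H.smooth η y + -G.smooth η y) ^ 2 + |H.smooth η y + -G.smooth η y| + 1 := by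
      positivity
    have k7 := mul_le_mul_of_nonneg_left k3 hA
    have g4 := h2.nonneg η y
    generalize (η : ℝ)⁻¹ * (sigmoidDeriv η (F.smooth η y) * fderiv ℝ (F.smooth η) y e ^ 2
      + gauge e (F.smooth η) y) = Z at *
    generalize 2 * (H.smooth η y + -G.smooth η y) ^ 2 + |H.smooth η y + -G.smooth η y| + 1 = A at *
    have := mul_nonneg hA g2
    have := mul_nonneg hA g3
    nlinarith
  | succ hF ih => exact ih.succ

end WeightBdd

end DSGD

namespace DSGD

/-! ### Diffeomorphisms of U preserve its interior. -/

section interior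

variable {n : ℕ}

/-- An injective differentiable map with surjective derivatives is open. -/
lemma isOpen_image_of_differentiable {f : (Fin n → ℝ) → (Fin n → ℝ)} {V : Set (Fin n → ℝ)}
    (hV : IsOpen V) (hf : DifferentiableOn ℝ f V) (hinj : InjOn f V)
    (hsurj : ∀ x ∈ V, Function.Surjective (fderiv ℝ f x)) : IsOpen (f '' V) := by
  rw [isOpen_iff_mem_nhds]
  rintro _ ⟨y, hy, rfl⟩
  obtain ⟨r, hr, hrV⟩ := Metric.nhds_basis_closedBall.mem_iff.1 (hV.mem_nhds hy)
  -- The target z is reached by minimising q(f x - z) over a closed ball. The sum of squares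
  -- replaces the sup norm because a critical point has to be exploited.
  let q : (Fin n → ℝ) → ℝ := fun z => ∑ i, z i ^ 2
  have hq : Continuous q := by fun_prop
  have hq0 : ∀ z, 0 ≤ q z := fun z => Finset.sum_nonneg fun _ _ => sq_nonneg _
  have hq_pos : ∀ z, z ≠ 0 → 0 < q z := fun z hz => by
    refine (hq0 z).lt_of_ne fun h => hz (funext fun i => ?_)
    have := (Finset.sum_eq_zero_iff_of_nonneg fun i _ => sq_nonneg (z i)).1 h.symm i (Finset.mem_univ i)
    simpa using this
  have hq_tri : ∀ a b c, q (a - b) ≤ 2 * q (a - c) + 2 * q (b - c) := fun a b c => by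
    simp only [q, Finset.mul_sum, ← Finset.sum_add_distrib]
    refine Finset.sum_le_sum fun i _ => ?_
    simp only [Pi.sub_apply]
    nlinarith [sq_nonneg (a i - c i + (b i - c i))]
  have hfc : ContinuousOn f (Metric.closedBall y r) := hf.continuousOn.mono hrV
  have hm : ∃ m > 0, ∀ x ∈ Metric.sphere y r, m ≤ q (f x - f y) := by
    rcases (Metric.sphere y r).eq_empty_or_nonempty with h | h
    · exact ⟨1, one_pos, by simp [h]⟩
    · have hc : ContinuousOn (fun x => q (f x - f y)) (Metric.sphere y r) :=
        hq.comp_continuousOn ((hfc.mono Metric.sphere_subset_closedBall).sub continuousOn_const)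
      obtain ⟨x, hx, hmin⟩ := (isCompact_sphere y r).exists_isMinOn h hc
      refine ⟨q (f x - f y), hq_pos _ (sub_ne_zero.2 fun hxy => ?_), fun z hz => hmin hz⟩
      have := hinj (hrV (Metric.sphere_subset_closedBall hx)) hy hxy
      rw [this, Metric.mem_sphere, dist_self] at hx
      exact hr.ne hx
  obtain ⟨m, hm0, hm⟩ := hm
  -- A minimiser x on the sphere would give m ≤ q(f x - f y) ≤ 2q(f x - z) + 2q(f y - z) ≤ 4q(f y -
  -- z) < m. So the minimiser is interior.
  have hnear : ∀ᶠ z in 𝓝 (f y), q (f y - z) < m / 4 := by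
    have hc : ContinuousAt (fun z => q (f y - z)) (f y) := by fun_prop
    refine hc.eventually (gt_mem_nhds ?_)
    simp only [q, sub_self]
    simpa using by positivity
  filter_upwards [hnear] with z hz
  have hc : ContinuousOn (fun x => q (f x - z)) (Metric.closedBall y r) :=
    hq.comp_continuousOn (hfc.sub continuousOn_const)
  obtain ⟨x, hx, hmin⟩ := (isCompact_closedBall y r).exists_isMinOn
    ⟨y, Metric.mem_closedBall_self hr.le⟩ hc
  have hxy : q (f x - z) ≤ q (f y - z) := hmin (Metric.mem_closedBall_self hr.le)
  have hxb : x ∈ Metric.ball y r := by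
    refine Metric.mem_ball.2 ((Metric.mem_closedBall.1 hx).lt_of_ne fun hs => ?_)
    have h1 := hm x hs
    have h2 := hq_tri (f x) (f y) z
    linarith
  have hloc : IsLocalMin (fun x => q (f x - z)) x := by
    filter_upwards [Metric.isOpen_ball.mem_nhds hxb] with w hw
    exact hmin (Metric.ball_subset_closedBall hw)
  have hxV := hrV hx
  have hfx := (hf.differentiableAt (hV.mem_nhds hxV)).hasFDerivAt
  have hd : HasFDerivAt (fun x => q (f x - z)) (∑ i, (2 * (f x i - z i)) •
      (ContinuousLinearMap.proj (R := ℝ) (φ := fun _ : Fin n => ℝ) i).comp (fderiv ℝ f x)) x := by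
    refine HasFDerivAt.fun_sum fun i _ => ?_
    have h := (((hasFDerivAt_pi'.1 hfx i).sub_const (z i)).pow 2)
    simpa using h
  have h0 := hloc.hasFDerivAt_eq_zero hd
  obtain ⟨v, hv⟩ := hsurj x hxV (f x - z)
  refine ⟨x, hxV, ?_⟩
  by_contra hne
  have h1 := congrArg (fun L : (Fin n → ℝ) →L[ℝ] ℝ => L v) h0
  simp only [sum_apply, smul_apply, ContinuousLinearMap.comp_apply, hv,
    ContinuousLinearMap.proj_apply, Pi.sub_apply, smul_eq_mul, zero_apply] at h1
  have h2 := hq_pos _ (sub_ne_zero.2 hne)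
  have h3 : ∑ i, 2 * (f x i - z i) * (f x i - z i) = 2 * q (f x - z) := by
    simp only [q, Finset.mul_sum, Pi.sub_apply]
    exact Finset.sum_congr rfl fun i _ => by ring
  linarith

/-- Differentiating g ∘ f = id at an interior point shows that the derivative of f is injective,
hence surjective. The image of the interior is then an open subset of U. As f x is so far only known
to lie in U, the derivative of g is taken within U. -/
lemma mapsTo_interior {U : Set (Fin n → ℝ)} {f g : (Fin n → ℝ) → (Fin n → ℝ)}
    (hf : DifferentiableOn ℝ f U) (hg : DifferentiableOn ℝ g U) (hfm : MapsTo f U U)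
    (hgf : LeftInvOn g f U) : MapsTo f (interior U) (interior U) := by
  have hfI : DifferentiableOn ℝ f (interior U) := hf.mono interior_subset
  have ho : IsOpen (f '' interior U) := by
    refine isOpen_image_of_differentiable isOpen_interior hfI
      (hgf.injOn.mono interior_subset) fun x hx => ?_
    have h1 := (hfI.differentiableAt (isOpen_interior.mem_nhds hx)).hasFDerivAt
    have hxU : U ∈ 𝓝 x := mem_interior_iff_mem_nhds.1 hx
    have h2 := (hg (f x) (hfm (interior_subset hx))).hasFDerivWithinAt
    have h3 : HasFDerivWithinAt (g ∘ f) ((fderivWithin ℝ g U (f x)).comp (fderiv ℝ f x)) U x :=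
      h2.comp x h1.hasFDerivWithinAt hfm
    have h4 : HasFDerivAt (g ∘ f) (ContinuousLinearMap.id ℝ (Fin n → ℝ)) x :=
      (hasFDerivAt_id x).congr_of_eventuallyEq (by filter_upwards [hxU] with z hz using hgf hz)
    have h5 := (h3.hasFDerivAt hxU).unique h4
    have h6 : Function.Injective (fderiv ℝ f x : (Fin n → ℝ) →ₗ[ℝ] (Fin n → ℝ)) := by
      refine Function.LeftInverse.injective (g := fderivWithin ℝ g U (f x)) fun v => ?_
      exact congrArg (fun L : (Fin n → ℝ) →L[ℝ] (Fin n → ℝ) => L v) h5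
    exact LinearMap.injective_iff_surjective.1 h6
  have hsub : f '' interior U ⊆ interior U :=
    interior_maximal ((image_mono interior_subset).trans hfm.image_subset) ho
  exact mapsTo_iff_image_subset.2 hsub

/-- A diffeomorphism of `U` restricts to a bijection of the interior, with continuous inverse. -/
lemma IsDiffeoOn.exists_inverse {U : Set (Fin n → ℝ)} {f : (Fin n → ℝ) → (Fin n → ℝ)}
    (hf : IsDiffeoOn f U) : ∃ g, MapsTo f (interior U) (interior U) ∧
      MapsTo g (interior U) (interior U) ∧ InvOn g f (interior U) (interior U) ∧
      ContinuousOn g (interior U) := by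
  obtain ⟨hb, hd, g, hinv, hg⟩ := hf
  have hgm : MapsTo g U U := hinv.1.mapsTo hb.surjOn
  exact ⟨g, mapsTo_interior hd hg hb.mapsTo hinv.1, mapsTo_interior hg hd hgm hinv.2,
    hinv.mono interior_subset interior_subset, hg.continuousOn.mono interior_subset⟩

end interior

/-! ### Functions with polynomially growing or rapidly decaying derivatives. -/

section GrowthLE

variable {E G H L : Type} [NormedAddCommGroup E] [NormedSpace ℝ E]
  [NormedAddCommGroup G] [NormedSpace ℝ G] [NormedAddCommGroup H] [NormedSpace ℝ H]
  [NormedAddCommGroup L] [NormedSpace ℝ L]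

/-- `f` is `C^l` on `W` and its derivatives up to order `l` are `O((1 + ‖x‖) ^ r)` on `W`. -/
def GrowthLE (W : Set E) (l : ℕ) (r : ℤ) (f : E → G) : Prop :=
  ContDiffOn ℝ l f W ∧
    ∀ i ≤ l, ∃ C, ∀ x ∈ W, ‖iteratedFDeriv ℝ i f x‖ ≤ C * (1 + ‖x‖) ^ r

/-- `f` is `C^l` on `W` and its derivatives up to order `l` are bounded by polynomials on `W`. -/
def PolyGrowth (W : Set E) (l : ℕ) (f : E → G) : Prop := ∃ r, GrowthLE W l r f

/-- `f` is `C^l` on `W` and its derivatives up to order `l` decay on `W` faster than any power. -/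
def RapidDecay (W : Set E) (l : ℕ) (f : E → G) : Prop := ∀ r, GrowthLE W l r f

lemma one_le_one_add_norm {E : Type*} [NormedAddCommGroup E] (x : E) : 1 ≤ 1 + ‖x‖ := by linarith [norm_nonneg x]

lemma one_add_norm_pos {E : Type*} [NormedAddCommGroup E] (x : E) : 0 < 1 + ‖x‖ := by linarith [norm_nonneg x]

namespace GrowthLE

variable {W : Set E} {l : ℕ} {r s : ℤ} {f : E → G} {g : E → H}

lemma zero_iff : GrowthLE W 0 r f ↔
    ContinuousOn f W ∧ ∃ C, ∀ x ∈ W, ‖f x‖ ≤ C * (1 + ‖x‖) ^ r := by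
  simp [GrowthLE, contDiffOn_zero]

lemma bound (hf : GrowthLE W l r f) : ∃ C, 0 ≤ C ∧ ∀ x ∈ W, ‖f x‖ ≤ C * (1 + ‖x‖) ^ r := by
  obtain ⟨C, h⟩ := hf.2 0 l.zero_le
  refine ⟨|C|, abs_nonneg C, fun x hx => ?_⟩
  have := h x hx
  rw [norm_iteratedFDeriv_zero] at this
  refine this.trans ?_
  gcongr
  exact le_abs_self C

lemma succ_iff (hW : IsOpen W) : GrowthLE W (l + 1) r f ↔ DifferentiableOn ℝ f W ∧
    (∃ C, ∀ x ∈ W, ‖f x‖ ≤ C * (1 + ‖x‖) ^ r) ∧ GrowthLE W l r (fderiv ℝ f) := by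
  have hc : ContDiffOn ℝ (l + 1 : ℕ) f W ↔
      DifferentiableOn ℝ f W ∧ ContDiffOn ℝ l (fderiv ℝ f) W := by
    push_cast
    rw [contDiffOn_succ_iff_fderiv_of_isOpen hW]
    simp
  constructor
  · rintro ⟨h1, h2⟩
    refine ⟨(hc.1 h1).1, ?_, (hc.1 h1).2, fun i hi => ?_⟩
    · simpa using h2 0 (Nat.zero_le _)
    · simpa only [norm_iteratedFDeriv_fderiv] using h2 (i + 1) (by omega)
  · rintro ⟨h1, h2, h3, h4⟩
    refine ⟨hc.2 ⟨h1, h3⟩, fun i hi => ?_⟩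
    rcases i with _ | i
    · simpa using h2
    · simpa only [norm_iteratedFDeriv_fderiv] using h4 i (by omega)

lemma mono_left {k : ℕ} (hf : GrowthLE W l r f) (h : k ≤ l) : GrowthLE W k r f :=
  ⟨hf.1.of_le (by exact_mod_cast h), fun i hi => hf.2 i (hi.trans h)⟩

lemma mono_right (hf : GrowthLE W l r f) (h : r ≤ s) : GrowthLE W l s f := by
  refine ⟨hf.1, fun i hi => ?_⟩
  obtain ⟨C, hC⟩ := hf.2 i hi
  refine ⟨|C|, fun x hx => (hC x hx).trans ?_⟩
  have h1 := one_le_one_add_norm x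
  have h2 := one_add_norm_pos x
  calc C * (1 + ‖x‖) ^ r ≤ |C| * (1 + ‖x‖) ^ r := by gcongr; exact le_abs_self C
    _ ≤ |C| * (1 + ‖x‖) ^ s := by gcongr

lemma congr {f' : E → G} (hW : IsOpen W) (hf : GrowthLE W l r f) (h : EqOn f' f W) :
    GrowthLE W l r f' := by
  refine ⟨hf.1.congr h, fun i hi => ?_⟩
  obtain ⟨C, hC⟩ := hf.2 i hi
  refine ⟨C, fun x hx => ?_⟩
  have : f' =ᶠ[𝓝 x] f := h.eventuallyEq_of_mem (hW.mem_nhds hx)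
  rw [(this.iteratedFDeriv ℝ i).eq_of_nhds]
  exact hC x hx

lemma add {f' : E → G} (hW : IsOpen W) (hf : GrowthLE W l r f) (hf' : GrowthLE W l r f') :
    GrowthLE W l r (fun x => f x + f' x) := by
  refine ⟨hf.1.add hf'.1, fun i hi => ?_⟩
  obtain ⟨C, hC⟩ := hf.2 i hi
  obtain ⟨D, hD⟩ := hf'.2 i hi
  refine ⟨C + D, fun x hx => ?_⟩
  have h1 : ContDiffAt ℝ i f x :=
    (hf.1.of_le (by exact_mod_cast hi)).contDiffAt (hW.mem_nhds hx)
  have h2 : ContDiffAt ℝ i f' x :=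
    (hf'.1.of_le (by exact_mod_cast hi)).contDiffAt (hW.mem_nhds hx)
  have h3 : (fun x => f x + f' x) = f + f' := rfl
  rw [h3, iteratedFDeriv_add_apply h1 h2, add_mul]
  exact (norm_add_le _ _).trans (add_le_add (hC x hx) (hD x hx))

lemma const (c : G) : GrowthLE W l 0 (fun _ => c) := by
  refine ⟨contDiffOn_const, fun i _ => ⟨‖c‖, fun x _ => ?_⟩⟩
  rcases i with _ | i
  · simp
  · simp [iteratedFDeriv_const_of_ne (𝕜 := ℝ) (Nat.succ_ne_zero i) c]

end GrowthLE

/-- The derivative of B(f, g) is a sum of two bilinear expressions valued in other spaces, so the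
induction quantifies over all spaces and all B. Integer exponents let one Leibniz estimate serve
growth and decay alike. -/
lemma GrowthLE.bilin {W : Set E} (hW : IsOpen W) (l : ℕ) : ∀ {G H L : Type}
    [NormedAddCommGroup G] [NormedSpace ℝ G] [NormedAddCommGroup H] [NormedSpace ℝ H]
    [NormedAddCommGroup L] [NormedSpace ℝ L] (B : G →L[ℝ] H →L[ℝ] L) {r s : ℤ}
    {f : E → G} {g : E → H}, GrowthLE W l r f → GrowthLE W l s g →
    GrowthLE W l (r + s) (fun x => B (f x) (g x)) := by
  have hbd : ∀ (l : ℕ) {G H L : Type}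
      [NormedAddCommGroup G] [NormedSpace ℝ G] [NormedAddCommGroup H] [NormedSpace ℝ H]
      [NormedAddCommGroup L] [NormedSpace ℝ L] (B : G →L[ℝ] H →L[ℝ] L) {r s : ℤ}
      {f : E → G} {g : E → H}, GrowthLE W l r f → GrowthLE W l s g →
      ∃ C, ∀ x ∈ W, ‖B (f x) (g x)‖ ≤ C * (1 + ‖x‖) ^ (r + s) := by
    intro l G H L _ _ _ _ _ _ B r s f g hf hg
    obtain ⟨C, hC0, hC⟩ := hf.bound
    obtain ⟨D, hD0, hD⟩ := hg.bound
    refine ⟨‖B‖ * C * D, fun x hx => ?_⟩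
    have h2 := one_add_norm_pos x
    calc ‖B (f x) (g x)‖ ≤ ‖B‖ * ‖f x‖ * ‖g x‖ := B.le_opNorm₂ _ _
      _ ≤ ‖B‖ * (C * (1 + ‖x‖) ^ r) * (D * (1 + ‖x‖) ^ s) := by
          gcongr
          exacts [hC x hx, hD x hx]
      _ = _ := by rw [zpow_add₀ h2.ne']; ring
  induction l with
  | zero =>
    intro G H L _ _ _ _ _ _ B r s f g hf hg
    refine zero_iff.2 ⟨?_, hbd 0 B hf hg⟩
    exact (B.continuous.comp_continuousOn (zero_iff.1 hf).1).clm_apply (zero_iff.1 hg).1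
  | succ l ih =>
    intro G H L _ _ _ _ _ _ B r s f g hf hg
    have hf' := (succ_iff hW).1 hf
    have hg' := (succ_iff hW).1 hg
    have hder : ∀ x ∈ W, HasFDerivAt (fun x => B (f x) (g x))
        (B.precompR E (f x) (fderiv ℝ g x) + B.precompL E (fderiv ℝ f x) (g x)) x := fun x hx =>
      B.hasFDerivAt_of_bilinear (hf'.1.differentiableAt (hW.mem_nhds hx)).hasFDerivAt
        (hg'.1.differentiableAt (hW.mem_nhds hx)).hasFDerivAt
    refine (succ_iff hW).2 ⟨fun x hx => (hder x hx).differentiableAt.differentiableWithinAt,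
      hbd (l + 1) B hf hg, ?_⟩
    refine ((ih (B.precompR E) (hf.mono_left l.le_succ) hg'.2.2).add hW
      (ih (B.precompL E) hf'.2.2 (hg.mono_left l.le_succ))).congr hW fun x hx => (hder x hx).fderiv

namespace PolyGrowth

variable {W : Set E} {l : ℕ} {f : E → G} {g : E → H}

lemma mono_left {k : ℕ} (hf : PolyGrowth W l f) (h : k ≤ l) : PolyGrowth W k f :=
  hf.imp fun _ hr => hr.mono_left h

lemma congr {f' : E → G} (hW : IsOpen W) (hf : PolyGrowth W l f) (h : EqOn f' f W) :
    PolyGrowth W l f' :=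
  hf.imp fun _ hr => hr.congr hW h

lemma const (c : G) : PolyGrowth W l (fun _ => c) := ⟨0, GrowthLE.const c⟩

lemma bilin (hW : IsOpen W) (B : G →L[ℝ] H →L[ℝ] L) (hf : PolyGrowth W l f)
    (hg : PolyGrowth W l g) : PolyGrowth W l (fun x => B (f x) (g x)) := by
  obtain ⟨r, hr⟩ := hf
  obtain ⟨s, hs⟩ := hg
  exact ⟨r + s, GrowthLE.bilin hW l B hr hs⟩

lemma clm (hW : IsOpen W) (B : G →L[ℝ] H) (hf : PolyGrowth W l f) :
    PolyGrowth W l (fun x => B (f x)) :=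
  bilin hW (ContinuousLinearMap.id ℝ (G →L[ℝ] H)) (const B) hf

lemma add (hW : IsOpen W) {f' : E → G} (hf : PolyGrowth W l f) (hf' : PolyGrowth W l f') :
    PolyGrowth W l (fun x => f x + f' x) := by
  obtain ⟨r, hr⟩ := hf
  obtain ⟨s, hs⟩ := hf'
  exact ⟨max r s, (hr.mono_right (le_max_left _ _)).add hW (hs.mono_right (le_max_right _ _))⟩

lemma smul (hW : IsOpen W) {a : E → ℝ} (ha : PolyGrowth W l a) (hf : PolyGrowth W l f) :
    PolyGrowth W l (fun x => a x • f x) :=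
  bilin hW (ContinuousLinearMap.lsmul ℝ ℝ) ha hf

lemma mul (hW : IsOpen W) {a b : E → ℝ} (ha : PolyGrowth W l a) (hb : PolyGrowth W l b) :
    PolyGrowth W l (fun x => a x * b x) := smul hW ha hb

lemma neg (hW : IsOpen W) (hf : PolyGrowth W l f) : PolyGrowth W l (fun x => -f x) := by
  simpa using smul hW (const (-1 : ℝ)) hf

lemma sum (hW : IsOpen W) {κ : Type*} (s : Finset κ) {F : κ → E → G}
    (h : ∀ j ∈ s, PolyGrowth W l (F j)) : PolyGrowth W l (fun x => ∑ j ∈ s, F j x) := by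
  classical
  induction s using Finset.induction_on with
  | empty => simpa using const (0 : G)
  | insert a s ha ih =>
    simp only [Finset.sum_insert ha]
    exact (h a (by simp)).add hW (ih fun j hj => h j (by simp [hj]))

lemma prod (hW : IsOpen W) {κ : Type*} (s : Finset κ) {F : κ → E → ℝ}
    (h : ∀ j ∈ s, PolyGrowth W l (F j)) : PolyGrowth W l (fun x => ∏ j ∈ s, F j x) := by
  classical
  induction s using Finset.induction_on with
  | empty => simpa using const (1 : ℝ)
  | insert a s ha ih =>
    simp only [Finset.prod_insert ha]
    exact (h a (by simp)).mul hW (ih fun j hj => h j (by simp [hj]))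

lemma fderiv (hW : IsOpen W) (hf : PolyGrowth W (l + 1) f) : PolyGrowth W l (fderiv ℝ f) :=
  hf.imp fun _ hr => ((GrowthLE.succ_iff hW).1 hr).2.2

lemma differentiableOn (hW : IsOpen W) (hf : PolyGrowth W (l + 1) f) : DifferentiableOn ℝ f W := by
  obtain ⟨r, hr⟩ := hf
  exact ((GrowthLE.succ_iff hW).1 hr).1

lemma of_bounded_succ (hW : IsOpen W) (hd : DifferentiableOn ℝ f W) {C : ℝ}
    (hC : ∀ x ∈ W, ‖f x‖ ≤ C) (hf : PolyGrowth W l (_root_.fderiv ℝ f)) :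
    PolyGrowth W (l + 1) f := by
  obtain ⟨r, hr⟩ := hf
  refine ⟨max r 0, (GrowthLE.succ_iff hW).2 ⟨hd, ⟨|C|, fun x hx => ?_⟩,
    hr.mono_right (le_max_left _ _)⟩⟩
  refine ((hC x hx).trans (le_abs_self C)).trans (le_mul_of_one_le_right (abs_nonneg C) ?_)
  exact one_le_zpow₀ (one_le_one_add_norm x) (le_max_right r 0)

/-- The derivative -d⁻¹ d⁻¹ Dd involves the reciprocal at one order less, so induction on the order
closes; the lower bound on |d| handles order zero. -/
lemma inv (hW : IsOpen W) {d : E → ℝ} (hd : PolyGrowth W l d) {c : ℝ} (hc : 0 < c)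
    (h : ∀ x ∈ W, c ≤ |d x|) : PolyGrowth W l (fun x => (d x)⁻¹) := by
  have hne : ∀ x ∈ W, d x ≠ 0 := fun x hx => abs_pos.1 (hc.trans_le (h x hx))
  have hb : ∀ x ∈ W, ‖(d x)⁻¹‖ ≤ c⁻¹ := fun x hx => by
    rw [norm_inv]; exact inv_anti₀ hc (h x hx)
  induction l with
  | zero =>
    obtain ⟨r, hr⟩ := hd
    refine ⟨0, GrowthLE.zero_iff.2 ⟨(GrowthLE.zero_iff.1 hr).1.inv₀ hne, c⁻¹, fun x hx => ?_⟩⟩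
    simpa using hb x hx
  | succ l ih =>
    have hu := ih (hd.mono_left l.le_succ)
    have hder : ∀ x ∈ W, HasFDerivAt (fun x => (d x)⁻¹)
        (-((d x)⁻¹ * (d x)⁻¹) • _root_.fderiv ℝ d x) x := fun x hx => by
      have h1 := (hasDerivAt_inv (hne x hx)).comp_hasFDerivAt x
        ((hd.differentiableOn hW).differentiableAt (hW.mem_nhds hx)).hasFDerivAt
      refine h1.congr_fderiv ?_
      rw [sq, mul_inv]
    refine of_bounded_succ hW (fun x hx => (hder x hx).differentiableAt.differentiableWithinAt) hb ?_
    exact (((hu.mul hW hu).neg hW).smul hW (hd.fderiv hW)).congr hW fun x hx => (hder x hx).fderiv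

/-- The same induction as for the reciprocal, with derivative -|d|⁻¹ d⁻¹ Dd. It is needed for the
Jacobian factor, whose sign is not prescribed. -/
lemma abs_inv (hW : IsOpen W) {d : E → ℝ} (hd : PolyGrowth W l d) {c : ℝ} (hc : 0 < c)
    (h : ∀ x ∈ W, c ≤ |d x|) : PolyGrowth W l (fun x => |d x|⁻¹) := by
  have hne : ∀ x ∈ W, d x ≠ 0 := fun x hx => abs_pos.1 (hc.trans_le (h x hx))
  have hb : ∀ x ∈ W, ‖|d x|⁻¹‖ ≤ c⁻¹ := fun x hx => by
    rw [norm_inv, Real.norm_eq_abs, abs_abs]; exact inv_anti₀ hc (h x hx)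
  induction l with
  | zero =>
    obtain ⟨r, hr⟩ := hd
    refine ⟨0, GrowthLE.zero_iff.2 ⟨(GrowthLE.zero_iff.1 hr).1.abs.inv₀
      fun x hx => abs_ne_zero.2 (hne x hx), c⁻¹, fun x hx => ?_⟩⟩
    simpa using hb x hx
  | succ l ih =>
    have hv := ih (hd.mono_left l.le_succ)
    have hu := (hd.mono_left l.le_succ).inv hW hc h
    have hder1 : ∀ t : ℝ, t ≠ 0 → HasDerivAt (fun t : ℝ => |t|⁻¹) (-(|t|⁻¹ * t⁻¹)) t := by
      intro t ht
      rcases lt_or_gt_of_ne ht with h0 | h0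
      · have h1 : HasDerivAt (fun t : ℝ => (-t)⁻¹) (-(|t|⁻¹ * t⁻¹)) t := by
          refine ((hasDerivAt_neg t).fun_inv (neg_ne_zero.2 ht)).congr_deriv ?_
          rw [abs_of_neg h0]
          field_simp
        refine h1.congr_of_eventuallyEq ?_
        filter_upwards [Iio_mem_nhds h0] with s hs
        rw [abs_of_neg hs]
      · have h1 : HasDerivAt (fun t : ℝ => t⁻¹) (-(|t|⁻¹ * t⁻¹)) t := by
          refine (hasDerivAt_inv ht).congr_deriv ?_
          rw [abs_of_pos h0, sq, mul_inv]
        refine h1.congr_of_eventuallyEq ?_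
        filter_upwards [Ioi_mem_nhds h0] with s hs
        rw [abs_of_pos hs]
    have hder : ∀ x ∈ W, HasFDerivAt (fun x => |d x|⁻¹)
        (-(|d x|⁻¹ * (d x)⁻¹) • _root_.fderiv ℝ d x) x := fun x hx =>
      (hder1 _ (hne x hx)).comp_hasFDerivAt x
        ((hd.differentiableOn hW).differentiableAt (hW.mem_nhds hx)).hasFDerivAt
    refine of_bounded_succ hW (fun x hx => (hder x hx).differentiableAt.differentiableWithinAt) hb ?_
    exact (((hv.mul hW hu).neg hW).smul hW (hd.fderiv hW)).congr hW fun x hx => (hder x hx).fderiv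

lemma det (hW : IsOpen W) {n : ℕ} {M : E → Matrix (Fin n) (Fin n) ℝ}
    (hM : ∀ i j, PolyGrowth W l (fun x => M x i j)) : PolyGrowth W l (fun x => (M x).det) := by
  simp only [Matrix.det_apply']
  exact sum hW _ fun σ _ => (const _).mul hW (prod hW _ fun i _ => hM _ _)

/-- The inverse of a matrix with polynomially bounded entries and determinant bounded away from
zero. -/
lemma matrix_inv (hW : IsOpen W) {n : ℕ} {M : E → Matrix (Fin n) (Fin n) ℝ}
    (hM : ∀ i j, PolyGrowth W l (fun x => M x i j)) {c : ℝ} (hc : 0 < c)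
    (h : ∀ x ∈ W, c ≤ |(M x).det|) (i j : Fin n) : PolyGrowth W l (fun x => (M x)⁻¹ i j) := by
  -- Cramer's rule reduces everything to determinants and one reciprocal.
  have h1 : ∀ x, (M x)⁻¹ i j = ((M x).det)⁻¹ * ((M x).updateRow j (Pi.single i 1)).det := fun x => by
    rw [Matrix.inv_def, Matrix.smul_apply, Matrix.adjugate_apply, Ring.inverse_eq_inv', smul_eq_mul]
  simp only [h1]
  refine ((det hW hM).inv hW hc h).mul hW (det hW fun a b => ?_)
  by_cases ha : a = j
  · subst ha
    simpa using const _
  · simpa [Matrix.updateRow_ne ha] using hM a b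

/-- The inverse of an operator-valued function of polynomial growth with determinant bounded away
from zero. -/
lemma exists_clm_inverse (hW : IsOpen W) {n : ℕ} {A : E → (Fin n → ℝ) →L[ℝ] (Fin n → ℝ)}
    (hA : PolyGrowth W l A) {c : ℝ} (hc : 0 < c) (h : ∀ x ∈ W, c ≤ |(A x).det|) :
    ∃ B : E → (Fin n → ℝ) →L[ℝ] (Fin n → ℝ), PolyGrowth W l B ∧
      ∀ x ∈ W, (B x).comp (A x) = ContinuousLinearMap.id ℝ _ ∧
        (A x).comp (B x) = ContinuousLinearMap.id ℝ _ := by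
  let M : E → Matrix (Fin n) (Fin n) ℝ := fun x => LinearMap.toMatrix' (A x : _ →ₗ[ℝ] _)
  have hM : ∀ i j, PolyGrowth W l (fun x => M x i j) := fun i j => by
    have := hA.clm hW ((ContinuousLinearMap.proj (R := ℝ) (φ := fun _ : Fin n => ℝ) i).comp
      (ContinuousLinearMap.apply ℝ (Fin n → ℝ) (Pi.single j (1 : ℝ) : Fin n → ℝ)))
    refine this.congr hW fun x hx => ?_
    simp [M, LinearMap.toMatrix'_apply]
  have hdet : ∀ x, (M x).det = (A x).det := fun x => LinearMap.det_toMatrix' _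
  have hMc : ∀ x ∈ W, c ≤ |(M x).det| := fun x hx => (hdet x).symm ▸ h x hx
  have hI := matrix_inv hW hM hc hMc
  let S : Fin n → Fin n → (Fin n → ℝ) →L[ℝ] (Fin n → ℝ) := fun i j =>
    (ContinuousLinearMap.proj (R := ℝ) (φ := fun _ : Fin n => ℝ) j).smulRight
      (Pi.single i (1 : ℝ) : Fin n → ℝ)
  have hS : ∀ x, LinearMap.toContinuousLinearMap (Matrix.toLin' (M x)⁻¹)
      = ∑ i, ∑ j, (M x)⁻¹ i j • S i j := fun x => by
    ext v k
    simp [S, Matrix.mulVec, dotProduct, Finset.sum_apply, Pi.single_apply]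
  refine ⟨fun x => LinearMap.toContinuousLinearMap (Matrix.toLin' (M x)⁻¹), ?_, fun x hx => ?_⟩
  · simp only [hS]
    exact sum hW _ fun i _ => sum hW _ fun j _ => (hI i j).smul hW (const _)
  · have hu : IsUnit (M x).det := isUnit_iff_ne_zero.2 (abs_pos.1 (hc.trans_le (hMc x hx)))
    have hAM : ∀ v, A x v = (M x).mulVec v := fun v => by
      have := congrArg (fun T : (Fin n → ℝ) →ₗ[ℝ] (Fin n → ℝ) => T v)
        (Matrix.toLin'_toMatrix' (A x : (Fin n → ℝ) →ₗ[ℝ] (Fin n → ℝ)))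
      exact this.symm
    constructor <;> ext1 v
    · simp [hAM, Matrix.nonsing_inv_mul _ hu]
    · simp [hAM, Matrix.mul_nonsing_inv _ hu]

lemma of_isSmoothPolyBoundedOn (hf : IsSmoothPolyBoundedOn f W) (l : ℕ) : PolyGrowth W l f := by
  obtain ⟨hf1, hf2⟩ := hf
  choose N C hC using hf2
  refine ⟨((Finset.range (l + 1)).sup N : ℕ), hf1.of_le (by exact_mod_cast le_top), fun i hi => ?_⟩
  refine ⟨|C i|, fun x hx => (hC i x hx).trans ?_⟩
  have h1 := one_le_one_add_norm x
  have h2 : N i ≤ (Finset.range (l + 1)).sup N := Finset.le_sup (by simp; omega)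
  rw [zpow_natCast]
  gcongr
  · exact le_abs_self _

lemma mono_set {W' : Set E} (hf : PolyGrowth W l f) (h : W' ⊆ W) : PolyGrowth W' l f := by
  obtain ⟨r, hr⟩ := hf
  exact ⟨r, hr.1.mono h, fun i hi => (hr.2 i hi).imp fun C hC x hx => hC x (h hx)⟩

end PolyGrowth

namespace RapidDecay

variable {W : Set E} {l : ℕ} {f : E → G} {g : E → H}

lemma bilin (hW : IsOpen W) (B : G →L[ℝ] H →L[ℝ] L) (hf : RapidDecay W l f)
    (hg : PolyGrowth W l g) : RapidDecay W l (fun x => B (f x) (g x)) := by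
  obtain ⟨s, hs⟩ := hg
  intro r
  simpa using GrowthLE.bilin hW l B (hf (r - s)) hs

lemma fderiv (hW : IsOpen W) (hf : RapidDecay W (l + 1) f) : RapidDecay W l (fderiv ℝ f) :=
  fun r => ((GrowthLE.succ_iff hW).1 (hf r)).2.2

lemma differentiableOn (hW : IsOpen W) (hf : RapidDecay W (l + 1) f) : DifferentiableOn ℝ f W :=
  ((GrowthLE.succ_iff hW).1 (hf 0)).1

lemma mono_left {k : ℕ} (hf : RapidDecay W l f) (h : k ≤ l) : RapidDecay W k f :=
  fun r => (hf r).mono_left h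

end RapidDecay

end GrowthLE

end DSGD

namespace DSGD

/-! ### The transported density and its parameter derivatives. -/

section kernel

variable {E : Type} [NormedAddCommGroup E] [NormedSpace ℝ E] {n : ℕ}

lemma PolyGrowth.clm_det {W : Set E} {l : ℕ} (hW : IsOpen W)
    {A : E → (Fin n → ℝ) →L[ℝ] (Fin n → ℝ)} (hA : PolyGrowth W l A) :
    PolyGrowth W l (fun x => (A x).det) := by
  have h1 : ∀ x, (A x).det =
      (LinearMap.toMatrix' (A x : (Fin n → ℝ) →ₗ[ℝ] (Fin n → ℝ))).det := fun x =>
    (LinearMap.det_toMatrix' _).symm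
  simp only [h1]
  refine PolyGrowth.det hW fun i j => ?_
  have := hA.clm hW ((ContinuousLinearMap.proj (R := ℝ) (φ := fun _ : Fin n => ℝ) i).comp
    (ContinuousLinearMap.apply ℝ (Fin n → ℝ) (Pi.single j (1 : ℝ) : Fin n → ℝ)))
  refine this.congr hW fun x hx => ?_
  simp [LinearMap.toMatrix'_apply]

/-- For bounded `O`, 1 + ‖(θ, s)‖ is at most a constant times 1 + ‖s‖, so decay in s is decay in the
pair. Boundedness is essential, as p does not depend on θ. -/
lemma IsSchwartzOn.rapidDecay {p : (Fin n → ℝ) → ℝ} {U : Set (Fin n → ℝ)} (hp : IsSchwartzOn p U)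
    {O : Set E} (hb : Bornology.IsBounded O) (l : ℕ) :
    RapidDecay (O ×ˢ interior U) l (fun x : E × (Fin n → ℝ) => p x.2) := by
  intro r
  obtain ⟨R, hR0, hR⟩ := hb.exists_pos_norm_le
  have hV : IsOpen (interior U) := isOpen_interior
  have key : ∀ i (x : E × (Fin n → ℝ)), x.2 ∈ interior U →
      ‖iteratedFDeriv ℝ i (fun x : E × (Fin n → ℝ) => p x.2) x‖ ≤ ‖iteratedFDeriv ℝ i p x.2‖ := by
    intro i x hx
    have hV' : IsOpen (ContinuousLinearMap.snd ℝ E (Fin n → ℝ) ⁻¹' interior U) :=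
      hV.preimage (ContinuousLinearMap.snd ℝ E (Fin n → ℝ)).continuous
    have h := (ContinuousLinearMap.snd ℝ E (Fin n → ℝ)).iteratedFDerivWithin_comp_right
      hp.contDiffOn hV.uniqueDiffOn hV'.uniqueDiffOn (x := x) hx (i := i)
      (by exact_mod_cast le_top)
    rw [iteratedFDerivWithin_of_isOpen i hV' hx, 
      iteratedFDerivWithin_of_isOpen i hV (x := ContinuousLinearMap.snd ℝ E (Fin n → ℝ) x) hx] at h
    have h' : (fun x : E × (Fin n → ℝ) => p x.2) = p ∘ (ContinuousLinearMap.snd ℝ E (Fin n → ℝ)) :=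
      rfl
    rw [h', h]
    refine (ContinuousMultilinearMap.norm_compContinuousLinearMap_le _ _).trans ?_
    refine mul_le_of_le_one_right (norm_nonneg _) ?_
    exact Finset.prod_le_one (fun _ _ => norm_nonneg _)
      fun _ _ => ContinuousLinearMap.norm_snd_le _ _ _
  refine ⟨(hp.contDiffOn.of_le (by exact_mod_cast le_top)).comp contDiffOn_snd fun x hx => hx.2,
    fun i hi => ?_⟩
  obtain ⟨C₀, h0⟩ := hp.decay 0 i
  obtain ⟨C₁, h1⟩ := hp.decay (-r).toNat i
  set N := (-r).toNat
  refine ⟨(1 + R) ^ N * (2 ^ N * (C₀ + C₁)), fun x hx => ?_⟩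
  refine (key i x hx.2).trans ?_
  have hx1 := one_add_norm_pos x
  have hs := norm_nonneg x.2
  have hxs : 1 + ‖x‖ ≤ (1 + R) * (1 + ‖x.2‖) := by
    have : ‖x‖ ≤ R + ‖x.2‖ := by
      rw [Prod.norm_def]
      exact max_le (by linarith [hR x.1 hx.1]) (by linarith)
    nlinarith
  have h2 : ‖iteratedFDeriv ℝ i p x.2‖ * (1 + ‖x‖) ^ N
      ≤ (1 + R) ^ N * (2 ^ N * (C₀ + C₁)) := by
    have h3 : (1 + ‖x.2‖) ^ N ≤ 2 ^ N * (1 + ‖x.2‖ ^ N) := by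
      calc (1 + ‖x.2‖) ^ N ≤ 2 ^ (N - 1) * (1 ^ N + ‖x.2‖ ^ N) :=
            add_pow_le zero_le_one hs N
        _ ≤ 2 ^ N * (1 + ‖x.2‖ ^ N) := by
            rw [one_pow]
            gcongr
            · norm_num
            · omega
    have h4 := h0 x.2 hx.2
    have h5 := h1 x.2 hx.2
    rw [pow_zero, one_mul] at h4
    calc _ ≤ ‖iteratedFDeriv ℝ i p x.2‖ * ((1 + R) * (1 + ‖x.2‖)) ^ N := by gcongr
      _ = (1 + R) ^ N * (‖iteratedFDeriv ℝ i p x.2‖ * (1 + ‖x.2‖) ^ N) := by rw [mul_pow]; ring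
      _ ≤ (1 + R) ^ N * (‖iteratedFDeriv ℝ i p x.2‖ * (2 ^ N * (1 + ‖x.2‖ ^ N))) := by gcongr
      _ = (1 + R) ^ N * (2 ^ N * (‖iteratedFDeriv ℝ i p x.2‖ +
            ‖x.2‖ ^ N * ‖iteratedFDeriv ℝ i p x.2‖)) := by ring
      _ ≤ _ := by gcongr
  have h6 : ‖iteratedFDeriv ℝ i p x.2‖ ≤ (1 + R) ^ N * (2 ^ N * (C₀ + C₁)) * (1 + ‖x‖) ^ (-(N : ℤ)) := by
    rw [zpow_neg, zpow_natCast, ← div_eq_mul_inv, le_div_iff₀ (by positivity)]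
    exact h2
  have h7 : 0 ≤ (1 + R) ^ N * (2 ^ N * (C₀ + C₁)) := le_trans (by positivity) h2
  refine h6.trans ?_
  gcongr
  · exact one_le_one_add_norm x
  · omega

/-- A reparameterisation `φ` of the open set `V` by the parameters in the bounded open set `O`,
with inverse `ψ`, and the base density `p`. -/
structure Reparam (O : Set E) (V : Set (Fin n → ℝ)) (φ ψ : E → (Fin n → ℝ) → (Fin n → ℝ))
    (p : (Fin n → ℝ) → ℝ) : Prop where
  isOpen_param : IsOpen O
  isOpen : IsOpen V
  mapsTo : ∀ θ ∈ O, MapsTo (φ θ) V V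
  mapsTo_inv : ∀ θ ∈ O, MapsTo (ψ θ) V V
  invOn : ∀ θ ∈ O, InvOn (ψ θ) (φ θ) V V
  continuousOn_inv : ∀ θ ∈ O, ContinuousOn (ψ θ) V
  poly : ∀ l, PolyGrowth (O ×ˢ V) l (Function.uncurry φ)
  det : ∃ c : ℝ, 0 < c ∧ ∀ θ ∈ O, ∀ s ∈ V, c ≤ |(fderiv ℝ (φ θ) s).det|
  rapid : ∀ l, RapidDecay (O ×ˢ V) l (fun x : E × (Fin n → ℝ) => p x.2)

namespace Reparam

variable {O : Set E} {V : Set (Fin n → ℝ)} {φ ψ : E → (Fin n → ℝ) → (Fin n → ℝ)}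
  {p : (Fin n → ℝ) → ℝ}

lemma isOpen_prod (h : Reparam O V φ ψ p) : IsOpen (O ×ˢ V) := h.isOpen_param.prod h.isOpen

lemma contDiffAt (h : Reparam O V φ ψ p) {x : E × (Fin n → ℝ)} (hx : x ∈ O ×ˢ V) :
    ContDiffAt ℝ 1 (Function.uncurry φ) x := by
  obtain ⟨r, hr⟩ := h.poly 1
  exact hr.1.contDiffAt (h.isOpen_prod.mem_nhds hx)

lemma hasFDerivAt_uncurry (h : Reparam O V φ ψ p) {x : E × (Fin n → ℝ)} (hx : x ∈ O ×ˢ V) :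
    HasFDerivAt (Function.uncurry φ) (fderiv ℝ (Function.uncurry φ) x) x :=
  ((h.contDiffAt hx).differentiableAt (by simp)).hasFDerivAt

lemma hasFDerivAt (h : Reparam O V φ ψ p) {θ : E} {s : Fin n → ℝ} (hθ : θ ∈ O) (hs : s ∈ V) :
    HasFDerivAt (φ θ) ((fderiv ℝ (Function.uncurry φ) (θ, s)).comp
      (ContinuousLinearMap.inr ℝ E (Fin n → ℝ))) s :=
  (h.hasFDerivAt_uncurry (x := (θ, s)) ⟨hθ, hs⟩).comp s (hasFDerivAt_prodMk_right θ s)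

lemma hasFDerivAt_param (h : Reparam O V φ ψ p) {θ : E} {s : Fin n → ℝ} (hθ : θ ∈ O)
    (hs : s ∈ V) : HasFDerivAt (fun t => φ t s) ((fderiv ℝ (Function.uncurry φ) (θ, s)).comp
      (ContinuousLinearMap.inl ℝ E (Fin n → ℝ))) θ :=
  HasFDerivAt.comp (f := fun t => (t, s)) θ (h.hasFDerivAt_uncurry (x := (θ, s)) ⟨hθ, hs⟩)
    (hasFDerivAt_prodMk_left (𝕜 := ℝ) θ s)

/-- ‖φ_θ(s)‖ is at most polynomial in ‖(θ, s)‖, so sufficiently fast decay in (θ, s) dominates any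
prescribed decay in φ_θ(s). -/
lemma le_weight (h : Reparam O V φ ψ p) {G : Type} [NormedAddCommGroup G] [NormedSpace ℝ G] {l : ℕ}
    {k : E × (Fin n → ℝ) → G} (hk : RapidDecay (O ×ˢ V) l k) (K : ℕ) :
    ∃ C, 0 ≤ C ∧ ∀ θ ∈ O, ∀ s ∈ V, ‖k (θ, s)‖ ≤ C * weight K (φ θ s) := by
  obtain ⟨r, hr⟩ := h.poly 0
  obtain ⟨C, hC0, hC⟩ := (hr.mono_right (Int.self_le_toNat r)).bound
  set N := r.toNat
  obtain ⟨D, hD0, hD⟩ := (hk (-(N * (2 * K) : ℕ))).bound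
  refine ⟨D * (1 + C) ^ (2 * K) * (1 + n) ^ K, by positivity, fun θ hθ s hs => ?_⟩
  have h1 := hC (θ, s) ⟨hθ, hs⟩
  have h2 := hD (θ, s) ⟨hθ, hs⟩
  have hx := one_le_one_add_norm (θ, s)
  have hx0 := one_add_norm_pos (θ, s)
  have hy := one_add_norm_pos (φ θ s)
  rw [zpow_natCast] at h1
  rw [zpow_neg, zpow_natCast] at h2
  have hxN : 1 ≤ (1 + ‖(θ, s)‖) ^ N := one_le_pow₀ hx
  have h3 : 1 + ‖φ θ s‖ ≤ (1 + C) * (1 + ‖(θ, s)‖) ^ N := by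
    have : ‖φ θ s‖ ≤ C * (1 + ‖(θ, s)‖) ^ N := h1
    linarith
  have h4 : ((1 + ‖(θ, s)‖) ^ (N * (2 * K)))⁻¹ ≤ (1 + C) ^ (2 * K) * ((1 + ‖φ θ s‖) ^ (2 * K))⁻¹ := by
    rw [← div_eq_mul_inv, le_div_iff₀ (by positivity), inv_mul_le_iff₀ (by positivity)]
    refine (pow_le_pow_left₀ hy.le h3 (2 * K)).trans_eq ?_
    rw [mul_pow, ← pow_mul, mul_comm]
  calc ‖k (θ, s)‖ ≤ D * ((1 + ‖(θ, s)‖) ^ (N * (2 * K)))⁻¹ := h2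
    _ ≤ D * ((1 + C) ^ (2 * K) * ((1 + n) ^ K * weight K (φ θ s))) := by
        gcongr
        refine h4.trans ?_
        gcongr
        exact inv_pow_le_weight K _
    _ = _ := by ring

/-- By the implicit function theorem the derivative is (id, -(∂_s φ)⁻¹ ∂_θ φ) at (θ, ψ_θ(y)).
Writing it as a function `T` of (θ, s) keeps it within the calculus of polynomial growth on the
product. -/
lemma exists_transport [CompleteSpace E] (h : Reparam O V φ ψ p) (l : ℕ) :
    ∃ T : E × (Fin n → ℝ) → E →L[ℝ] E × (Fin n → ℝ), PolyGrowth (O ×ˢ V) l T ∧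
      ∀ θ ∈ O, ∀ y ∈ V, HasFDerivAt (fun t => (t, ψ t y)) (T (θ, ψ θ y)) θ := by
  have hW := h.isOpen_prod
  have hD : PolyGrowth (O ×ˢ V) l (fderiv ℝ (Function.uncurry φ)) := (h.poly (l + 1)).fderiv hW
  set D := fderiv ℝ (Function.uncurry φ)
  have hDl : PolyGrowth (O ×ˢ V) l
      (fun x => (D x).comp (ContinuousLinearMap.inl ℝ E (Fin n → ℝ))) :=
    hD.clm hW ((ContinuousLinearMap.compL ℝ E (E × (Fin n → ℝ)) (Fin n → ℝ)).flip
      (ContinuousLinearMap.inl ℝ E (Fin n → ℝ)))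
  obtain ⟨A, hA⟩ : ∃ A : E × (Fin n → ℝ) → (Fin n → ℝ) →L[ℝ] (Fin n → ℝ),
    ∀ x, A x = (D x).comp (ContinuousLinearMap.inr ℝ E (Fin n → ℝ)) := ⟨_, fun _ => rfl⟩
  have hDr : PolyGrowth (O ×ˢ V) l A :=
    (hD.clm hW ((ContinuousLinearMap.compL ℝ (Fin n → ℝ) (E × (Fin n → ℝ)) (Fin n → ℝ)).flip
      (ContinuousLinearMap.inr ℝ E (Fin n → ℝ)))).congr hW fun x _ => hA x
  obtain ⟨c, hc, hdet⟩ := h.det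
  have hdet' : ∀ x ∈ O ×ˢ V, c ≤ |(A x).det| := by
    intro x hx
    have := hdet x.1 hx.1 x.2 hx.2
    rwa [(h.hasFDerivAt hx.1 hx.2).fderiv, ← hA x] at this
  obtain ⟨B, hB, hBinv⟩ := hDr.exists_clm_inverse hW hc hdet'
  refine ⟨fun x => ContinuousLinearMap.inl ℝ E (Fin n → ℝ) +
    ContinuousLinearMap.compL ℝ E (Fin n → ℝ) (E × (Fin n → ℝ))
    (ContinuousLinearMap.inr ℝ E (Fin n → ℝ))
    (-(ContinuousLinearMap.compL ℝ E (Fin n → ℝ) (Fin n → ℝ) (B x)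
      ((D x).comp (ContinuousLinearMap.inl ℝ E (Fin n → ℝ))))), ?_, ?_⟩
  · exact (PolyGrowth.const _).add hW ((((PolyGrowth.bilin hW
      (ContinuousLinearMap.compL ℝ E (Fin n → ℝ) (Fin n → ℝ)) hB hDl)).neg hW).clm hW _)
  · intro θ hθ y hy
    have hs := h.mapsTo_inv θ hθ hy
    have hx : (θ, ψ θ y) ∈ O ×ˢ V := ⟨hθ, hs⟩
    have hfu : HasStrictFDerivAt (Function.uncurry φ) (D (θ, ψ θ y)) (θ, ψ θ y) :=
      (h.contDiffAt hx).hasStrictFDerivAt (by simp)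
    let e : (Fin n → ℝ) ≃L[ℝ] (Fin n → ℝ) := ContinuousLinearEquiv.equivOfInverse
      (A (θ, ψ θ y)) (B (θ, ψ θ y))
      (fun v => congrArg (fun L : (Fin n → ℝ) →L[ℝ] (Fin n → ℝ) => L v) (hBinv _ hx).1)
      (fun v => congrArg (fun L : (Fin n → ℝ) →L[ℝ] (Fin n → ℝ) => L v) (hBinv _ hx).2)
    have he : (D (θ, ψ θ y)).comp (ContinuousLinearMap.inr ℝ E (Fin n → ℝ))
        = (e : (Fin n → ℝ) →L[ℝ] (Fin n → ℝ)) := (hA _).symm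
    have hinv : ((D (θ, ψ θ y)).comp (ContinuousLinearMap.inr ℝ E (Fin n → ℝ))).IsInvertible :=
      ⟨e, he.symm⟩
    have hBe : ((D (θ, ψ θ y)).comp (ContinuousLinearMap.inr ℝ E (Fin n → ℝ))).inverse
        = B (θ, ψ θ y) := by
      rw [he, ContinuousLinearMap.inverse_equiv]
      rfl
    have h1 := (hfu.hasStrictFDerivAt_implicitFunctionOfProdDomain hinv).hasFDerivAt
    rw [hBe] at h1
    have h2 := hfu.eventually_apply_implicitFunctionOfProdDomain hinv
    have h3 := (hfu.tendsto_implicitFunctionOfProdDomain hinv).eventually (h.isOpen.mem_nhds hs)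
    -- Continuity of ψ in the parameter is not known beforehand. The implicit function has values in
    -- V near θ, and injectivity of φ_t there identifies it with ψ_t(y).
    have h4 : (fun t => ψ t y) =ᶠ[𝓝 θ] hfu.implicitFunctionOfProdDomain hinv := by
      filter_upwards [h2, h3, h.isOpen_param.mem_nhds hθ] with t h2 h3 h4
      have h5 : φ t (hfu.implicitFunctionOfProdDomain hinv t) = y := by
        have : Function.uncurry φ (θ, ψ θ y) = y := (h.invOn θ hθ).2 hy
        rw [this] at h2
        exact h2
      have := (h.invOn t h4).1 h3
      rw [h5] at this
      exact this
    have h5 := (hasFDerivAt_id θ).prodMk (h1.congr_of_eventuallyEq h4)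
    refine h5.congr_fderiv ?_
    ext v <;> simp

/-- Q(θ, y) is k(θ, ψ_θ(y)) with k = p / |det ∂_s φ|. Differentiating q(θ, ψ_θ(y)) in θ replaces q
by Dq ∘ T, which again decays rapidly and has one order of smoothness less; two such steps start
from order 2. Decay in (θ, s) becomes decay in y through `le_weight`. -/
lemma exists_kernel [CompleteSpace E] (h : Reparam O V φ ψ p) :
    ∃ (Q : E → (Fin n → ℝ) → ℝ) (Q' : E → (Fin n → ℝ) → E →L[ℝ] ℝ)
      (Q'' : E → (Fin n → ℝ) → E →L[ℝ] E →L[ℝ] ℝ),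
      (∀ θ ∈ O, ∀ y ∈ V, HasFDerivAt (fun t => Q t y) (Q' θ y) θ) ∧
      (∀ θ ∈ O, ∀ y ∈ V, HasFDerivAt (fun t => Q' t y) (Q'' θ y) θ) ∧
      (∀ θ ∈ O, ContinuousOn (Q θ) V) ∧ (∀ θ ∈ O, ContinuousOn (Q' θ) V) ∧
      (∀ θ ∈ O, ContinuousOn (Q'' θ) V) ∧
      (∀ K, ∃ C, 0 ≤ C ∧ ∀ θ ∈ O, ∀ y ∈ V, ‖Q θ y‖ ≤ C * weight K y) ∧
      (∀ K, ∃ C, 0 ≤ C ∧ ∀ θ ∈ O, ∀ y ∈ V, ‖Q' θ y‖ ≤ C * weight K y) ∧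
      (∀ K, ∃ C, 0 ≤ C ∧ ∀ θ ∈ O, ∀ y ∈ V, ‖Q'' θ y‖ ≤ C * weight K y) ∧
      ∀ θ ∈ O, ∀ s ∈ V, |(fderiv ℝ (φ θ) s).det| * Q θ (φ θ s) = p s := by
  have hW := h.isOpen_prod
  obtain ⟨T, hT, hTd⟩ := h.exists_transport 2
  obtain ⟨c, hc, hdet⟩ := h.det
  set A : E × (Fin n → ℝ) → (Fin n → ℝ) →L[ℝ] (Fin n → ℝ) := fun x =>
    (fderiv ℝ (Function.uncurry φ) x).comp (ContinuousLinearMap.inr ℝ E (Fin n → ℝ))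
  have hA : PolyGrowth (O ×ˢ V) 2 A := ((h.poly 3).fderiv hW).clm hW
    ((ContinuousLinearMap.compL ℝ (Fin n → ℝ) (E × (Fin n → ℝ)) (Fin n → ℝ)).flip
      (ContinuousLinearMap.inr ℝ E (Fin n → ℝ)))
  have hAdet : ∀ x ∈ O ×ˢ V, (fderiv ℝ (φ x.1) x.2).det = (A x).det := fun x hx => by
    rw [(h.hasFDerivAt hx.1 hx.2).fderiv]
  have hdet' : ∀ x ∈ O ×ˢ V, c ≤ |(A x).det| := fun x hx => hAdet x hx ▸ hdet x.1 hx.1 x.2 hx.2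
  set k : E × (Fin n → ℝ) → ℝ := fun x => p x.2 * |(A x).det|⁻¹
  have hk : RapidDecay (O ×ˢ V) 2 k :=
    (h.rapid 2).bilin hW (ContinuousLinearMap.mul ℝ ℝ) ((hA.clm_det hW).abs_inv hW hc hdet')
  set k' : E × (Fin n → ℝ) → E →L[ℝ] ℝ := fun x => (fderiv ℝ k x).comp (T x)
  have hk' : RapidDecay (O ×ˢ V) 1 k' :=
    (hk.fderiv hW).bilin hW (ContinuousLinearMap.compL ℝ E (E × (Fin n → ℝ)) ℝ)
      (hT.mono_left one_le_two)
  set k'' : E × (Fin n → ℝ) → E →L[ℝ] E →L[ℝ] ℝ := fun x => (fderiv ℝ k' x).comp (T x)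
  have hk'' : RapidDecay (O ×ˢ V) 0 k'' := by
    have hk1 : RapidDecay (O ×ˢ V) 0 (fderiv ℝ k') := hk'.fderiv hW
    have hT0 : PolyGrowth (O ×ˢ V) 0 T := hT.mono_left zero_le_two
    exact RapidDecay.bilin (G := E × (Fin n → ℝ) →L[ℝ] E →L[ℝ] ℝ)
      (H := E →L[ℝ] E × (Fin n → ℝ)) (L := E →L[ℝ] E →L[ℝ] ℝ) hW
      (ContinuousLinearMap.compL ℝ E (E × (Fin n → ℝ)) (E →L[ℝ] ℝ)) hk1 hT0
  have hder : ∀ {G : Type} [NormedAddCommGroup G] [NormedSpace ℝ G] (q : E × (Fin n → ℝ) → G),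
      DifferentiableOn ℝ q (O ×ˢ V) → ∀ θ ∈ O, ∀ y ∈ V,
      HasFDerivAt (fun t => q (t, ψ t y)) ((fderiv ℝ q (θ, ψ θ y)).comp (T (θ, ψ θ y))) θ := by
    intro G _ _ q hq θ hθ y hy
    exact (hq.differentiableAt (hW.mem_nhds (x := (θ, ψ θ y))
      ⟨hθ, h.mapsTo_inv θ hθ hy⟩)).hasFDerivAt.comp θ (hTd θ hθ y hy)
  have hcont : ∀ {G : Type} [NormedAddCommGroup G] [NormedSpace ℝ G] (q : E × (Fin n → ℝ) → G),
      RapidDecay (O ×ˢ V) 0 q → ∀ θ ∈ O, ContinuousOn (fun y => q (θ, ψ θ y)) V := by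
    intro G _ _ q hq θ hθ
    refine (GrowthLE.zero_iff.1 (hq 0)).1.comp
      (continuousOn_const.prodMk (h.continuousOn_inv θ hθ)) fun y hy => ⟨hθ, h.mapsTo_inv θ hθ hy⟩
  have hbd : ∀ {G : Type} [NormedAddCommGroup G] [NormedSpace ℝ G] (q : E × (Fin n → ℝ) → G),
      RapidDecay (O ×ˢ V) 0 q → ∀ K, ∃ C, 0 ≤ C ∧ ∀ θ ∈ O, ∀ y ∈ V,
        ‖q (θ, ψ θ y)‖ ≤ C * weight K y := by
    intro G _ _ q hq K
    obtain ⟨C, hC0, hC⟩ := h.le_weight hq K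
    refine ⟨C, hC0, fun θ hθ y hy => ?_⟩
    have := hC θ hθ (ψ θ y) (h.mapsTo_inv θ hθ hy)
    rwa [(h.invOn θ hθ).2 hy] at this
  refine ⟨fun θ y => k (θ, ψ θ y), fun θ y => k' (θ, ψ θ y), fun θ y => k'' (θ, ψ θ y),
    hder k (hk.differentiableOn hW), hder k' (hk'.differentiableOn hW),
    hcont k (hk.mono_left zero_le_two), hcont k' (hk'.mono_left zero_le_one), hcont k'' hk'',
    hbd k (hk.mono_left zero_le_two), hbd k' (hk'.mono_left zero_le_one), hbd k'' hk'',
    fun θ hθ s hs => ?_⟩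
  have hx : (θ, s) ∈ O ×ˢ V := ⟨hθ, hs⟩
  have h0 : |(A (θ, s)).det| ≠ 0 := (hc.trans_le (hdet' _ hx)).ne'
  have h1 := hAdet _ hx
  simp only at h1
  simp only [k, (h.invOn θ hθ).1 hs, h1]
  field_simp

end Reparam

end kernel

end DSGD

namespace DSGD

/-! ### Integrals against the transported density. -/

section integrals

variable {E G : Type} [NormedAddCommGroup E] [NormedSpace ℝ E]
  [NormedAddCommGroup G] [NormedSpace ℝ G] {n : ℕ}

lemma norm_smul_le_of_polyBdd {V : Set (Fin n → ℝ)} {u : (Fin n → ℝ) → ℝ} {q : (Fin n → ℝ) → G}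
    {C D : ℝ} {N K : ℕ} (hC : ∀ y, ‖u y‖ ≤ C * (1 + ‖y‖) ^ N)
    (hD : ∀ y ∈ V, ‖q y‖ ≤ D * weight K y) {y : Fin n → ℝ} (hy : y ∈ V) :
    ‖u y • q y‖ ≤ C * D * ((1 + ‖y‖) ^ N * weight K y) := by
  have hw := weight_pos K y
  calc ‖u y • q y‖ = ‖u y‖ * ‖q y‖ := norm_smul _ _
    _ ≤ (C * (1 + ‖y‖) ^ N) * (D * weight K y) := by
        gcongr
        · exact (norm_nonneg _).trans (hC y)
        · exact hC y
        · exact hD y hy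
    _ = _ := by ring

lemma integrableOn_smul_of_polyBdd {V : Set (Fin n → ℝ)} (hV : IsOpen V) {u : (Fin n → ℝ) → ℝ}
    (hu : Measurable u) {q : (Fin n → ℝ) → G} (hq : ContinuousOn q V) {C D : ℝ} {N K : ℕ}
    (hK : N + n + 1 ≤ K) (hC : ∀ y, ‖u y‖ ≤ C * (1 + ‖y‖) ^ N)
    (hD : ∀ y ∈ V, ‖q y‖ ≤ D * weight K y) : IntegrableOn (fun y => u y • q y) V := by
  refine (((integrable_pow_mul_weight N hK).const_mul (C * D)).integrableOn).mono'
    (hu.aestronglyMeasurable.smul (hq.aestronglyMeasurable hV.measurableSet)) ?_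
  filter_upwards [ae_restrict_mem hV.measurableSet] with y hy
  exact norm_smul_le_of_polyBdd hC hD hy

/-- All dependence on θ sits in the kernel, so u may be discontinuous; decay of `q'` uniform over
`O` provides the dominating function. -/
lemma hasFDerivAt_integral_smul {O : Set E} (hO : IsOpen O) {V : Set (Fin n → ℝ)} (hV : IsOpen V)
    {q : E → (Fin n → ℝ) → G} {q' : E → (Fin n → ℝ) → E →L[ℝ] G}
    (hder : ∀ θ ∈ O, ∀ y ∈ V, HasFDerivAt (fun t => q t y) (q' θ y) θ)
    (hq : ∀ θ ∈ O, ContinuousOn (q θ) V) (hq' : ∀ θ ∈ O, ContinuousOn (q' θ) V)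
    (hb : ∀ K, ∃ C, 0 ≤ C ∧ ∀ θ ∈ O, ∀ y ∈ V, ‖q θ y‖ ≤ C * weight K y)
    (hb' : ∀ K, ∃ C, 0 ≤ C ∧ ∀ θ ∈ O, ∀ y ∈ V, ‖q' θ y‖ ≤ C * weight K y)
    {u : (Fin n → ℝ) → ℝ} (hu : Measurable u)
    (hup : ∃ (N : ℕ) (C : ℝ), ∀ y, ‖u y‖ ≤ C * (1 + ‖y‖) ^ N) {θ : E} (hθ : θ ∈ O) :
    HasFDerivAt (fun t => ∫ y in V, u y • q t y) (∫ y in V, u y • q' θ y) θ := by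
  obtain ⟨N, C, hC⟩ := hup
  obtain ⟨D, hD0, hD⟩ := hb (N + n + 1)
  obtain ⟨D', hD0', hD'⟩ := hb' (N + n + 1)
  refine hasFDerivAt_integral_of_dominated_of_fderiv_le (s := O)
    (F' := fun t y => u y • q' t y)
    (bound := fun y => C * D' * ((1 + ‖y‖) ^ N * weight (N + n + 1) y)) (hO.mem_nhds hθ) ?_
    (integrableOn_smul_of_polyBdd hV hu (hq θ hθ) le_rfl hC (hD θ hθ))
    (hu.aestronglyMeasurable.smul ((hq' θ hθ).aestronglyMeasurable hV.measurableSet)) ?_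
    (((integrable_pow_mul_weight N le_rfl).const_mul (C * D')).integrableOn) ?_
  · filter_upwards [hO.mem_nhds hθ] with t ht
    exact hu.aestronglyMeasurable.smul ((hq t ht).aestronglyMeasurable hV.measurableSet)
  · filter_upwards [ae_restrict_mem hV.measurableSet] with y hy t ht
    exact norm_smul_le_of_polyBdd hC (hD' t ht) hy
  · filter_upwards [ae_restrict_mem hV.measurableSet] with y hy t ht
    exact (hder t ht y hy).const_smul (u y)

lemma PolyGrowth.norm {W : Set E} {f : E → G} (hf : PolyGrowth W 0 f) :
    PolyGrowth W 0 (fun x => ‖f x‖) := by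
  obtain ⟨r, hr⟩ := hf
  have := GrowthLE.zero_iff.1 hr
  exact ⟨r, GrowthLE.zero_iff.2 ⟨this.1.norm, by simpa using this.2⟩⟩

lemma PolyGrowth.pow {W : Set E} {l : ℕ} (hW : IsOpen W) {f : E → ℝ} (hf : PolyGrowth W l f)
    (k : ℕ) : PolyGrowth W l (fun x => f x ^ k) := by
  simpa using PolyGrowth.prod hW (Finset.range k) (F := fun _ => f) fun _ _ => hf

lemma RapidDecay.mul {W : Set E} {l : ℕ} (hW : IsOpen W) {f g : E → ℝ} (hf : RapidDecay W l f)
    (hg : PolyGrowth W l g) : RapidDecay W l (fun x => f x * g x) :=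
  hf.bilin hW (ContinuousLinearMap.mul ℝ ℝ) hg

namespace Reparam

variable {O : Set E} {V : Set (Fin n → ℝ)} {φ ψ : E → (Fin n → ℝ) → (Fin n → ℝ)}
  {p : (Fin n → ℝ) → ℝ}

lemma image_eq (h : Reparam O V φ ψ p) {θ : E} (hθ : θ ∈ O) : φ θ '' V = V :=
  ((h.invOn θ hθ).bijOn (h.mapsTo θ hθ) (h.mapsTo_inv θ hθ)).image_eq

lemma hasFDerivWithinAt (h : Reparam O V φ ψ p) {θ : E} (hθ : θ ∈ O) :
    ∀ s ∈ V, HasFDerivWithinAt (φ θ) (fderiv ℝ (φ θ) s) V s := fun _ hs =>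
  (h.hasFDerivAt hθ hs).differentiableAt.hasFDerivAt.hasFDerivWithinAt

lemma continuousOn (h : Reparam O V φ ψ p) {θ : E} (hθ : θ ∈ O) : ContinuousOn (φ θ) V :=
  fun _ hs => (h.hasFDerivAt hθ hs).continuousAt.continuousWithinAt

lemma continuousOn_section {k : E × (Fin n → ℝ) → G}
    (hk : PolyGrowth (O ×ˢ V) 0 k) {θ : E} (hθ : θ ∈ O) : ContinuousOn (fun s => k (θ, s)) V := by
  obtain ⟨r, hr⟩ := hk
  exact (GrowthLE.zero_iff.1 hr).1.comp (continuousOn_const.prodMk continuousOn_id)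
    fun s hs => ⟨hθ, hs⟩

lemma continuousOn_density (h : Reparam O V φ ψ p) {θ : E} (hθ : θ ∈ O) : ContinuousOn p V :=
  continuousOn_section ⟨0, h.rapid 0 0⟩ hθ

lemma setIntegral_eq (h : Reparam O V φ ψ p) {Q : E → (Fin n → ℝ) → ℝ}
    (hQ : ∀ θ ∈ O, ∀ s ∈ V, |(fderiv ℝ (φ θ) s).det| * Q θ (φ θ s) = p s)
    (u : (Fin n → ℝ) → ℝ) {θ : E} (hθ : θ ∈ O) :
    ∫ s in V, p s * u (φ θ s) = ∫ y in V, u y • Q θ y := by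
  have h1 := integral_image_eq_integral_abs_det_fderiv_smul volume h.isOpen.measurableSet
    (h.hasFDerivWithinAt hθ) (h.invOn θ hθ).1.injOn (fun y => u y • Q θ y)
  rw [h.image_eq hθ] at h1
  rw [h1]
  refine setIntegral_congr_fun h.isOpen.measurableSet fun s hs => ?_
  simp only [smul_eq_mul]
  rw [← hQ θ hθ s hs]
  ring

/-- Integrals of nonnegative functions against the reparameterised density are bounded by
weighted Lebesgue integrals. -/
lemma integral_le_weight (h : Reparam O V φ ψ p) (hp : ∀ s ∈ V, 0 ≤ p s) (K : ℕ) :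
    ∃ C, 0 ≤ C ∧ ∀ θ ∈ O, ∀ v : (Fin n → ℝ) → ℝ, Continuous v → (∀ y, 0 ≤ v y) →
      Integrable (fun y => v y * weight K y) →
      IntegrableOn (fun s => p s *
        (‖fderiv ℝ (Function.uncurry φ) (θ, s)‖ ^ 2 * v (φ θ s))) V ∧
      ∫ s in V, p s * (‖fderiv ℝ (Function.uncurry φ) (θ, s)‖ ^ 2 * v (φ θ s)) ≤
        C * ∫ y, v y * weight K y := by
  have hW := h.isOpen_prod
  have hD : PolyGrowth (O ×ˢ V) 0 (fun x => ‖fderiv ℝ (Function.uncurry φ) x‖ ^ 2) :=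
    ((h.poly 1).fderiv hW).norm.pow hW 2
  have hR := (h.rapid 0).mul hW hD
  obtain ⟨C, hC0, hC⟩ := h.le_weight hR K
  obtain ⟨c, hc, hdet⟩ := h.det
  -- Inserting the Jacobian required by the change of variables costs 1/c, since |det| ≥ c.
  refine ⟨C / c, by positivity, fun θ hθ v hv hv0 hint => ?_⟩
  have hmeas := h.isOpen.measurableSet
  have hinj := (h.invOn θ hθ).1.injOn
  have h1 : IntegrableOn (fun s => |(fderiv ℝ (φ θ) s).det| • (v (φ θ s) * weight K (φ θ s))) V := by
    have := integrableOn_image_iff_integrableOn_abs_det_fderiv_smul volume hmeas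
      (h.hasFDerivWithinAt hθ) hinj (fun y => v y * weight K y)
    rw [h.image_eq hθ] at this
    exact this.1 hint.integrableOn
  have h2 : ∀ s ∈ V, p s * (‖fderiv ℝ (Function.uncurry φ) (θ, s)‖ ^ 2 * v (φ θ s)) ≤
      C / c * (|(fderiv ℝ (φ θ) s).det| • (v (φ θ s) * weight K (φ θ s))) := fun s hs => by
    have h3 := (Real.le_norm_self _).trans (hC θ hθ s hs)
    have h4 := hdet θ hθ s hs
    have h5 := hv0 (φ θ s)
    have h6 := (weight_pos K (φ θ s)).le
    calc _ = p s * ‖fderiv ℝ (Function.uncurry φ) (θ, s)‖ ^ 2 * v (φ θ s) := by ring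
      _ ≤ C * weight K (φ θ s) * v (φ θ s) := by gcongr
      _ = C / c * (c * (v (φ θ s) * weight K (φ θ s))) := by field_simp
      _ ≤ _ := by rw [smul_eq_mul]; gcongr
  have h0 : ∀ s ∈ V, 0 ≤ p s * (‖fderiv ℝ (Function.uncurry φ) (θ, s)‖ ^ 2 * v (φ θ s)) :=
    fun s hs => mul_nonneg (hp s hs) (mul_nonneg (sq_nonneg _) (hv0 _))
  have h3 : IntegrableOn (fun s => p s *
      (‖fderiv ℝ (Function.uncurry φ) (θ, s)‖ ^ 2 * v (φ θ s))) V := by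
    refine (h1.const_mul (C / c)).mono' ?_ ?_
    · refine ContinuousOn.aestronglyMeasurable ?_ hmeas
      exact (h.continuousOn_density hθ).mul ((continuousOn_section hD hθ).mul
        (hv.comp_continuousOn (h.continuousOn hθ)))
    · filter_upwards [ae_restrict_mem hmeas] with s hs
      rw [Real.norm_of_nonneg (h0 s hs)]
      exact h2 s hs
  refine ⟨h3, ?_⟩
  calc _ ≤ ∫ s in V, C / c * (|(fderiv ℝ (φ θ) s).det| • (v (φ θ s) * weight K (φ θ s))) :=
        setIntegral_mono_on h3 (h1.const_mul _) hmeas h2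
    _ = C / c * ∫ s in V, |(fderiv ℝ (φ θ) s).det| • (v (φ θ s) * weight K (φ θ s)) :=
        integral_const_mul _ _
    _ = C / c * ∫ y in V, v y * weight K y := by
        rw [← integral_image_eq_integral_abs_det_fderiv_smul volume hmeas
          (h.hasFDerivWithinAt hθ) hinj (fun y => v y * weight K y), h.image_eq hθ]
    _ ≤ _ := by
        gcongr
        · exact ae_of_all _ fun y => mul_nonneg (hv0 y) (weight_pos K y).le
        · exact Measure.restrict_le_self

/-- Differentiation under the integral sign for smooth integrands. -/
lemma hasFDerivAt_integral_smooth (h : Reparam O V φ ψ p) {u : (Fin n → ℝ) → ℝ}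
    (hu : ContDiff ℝ 1 u) (hup : ∃ (N : ℕ) (C : ℝ), ∀ y, ‖u y‖ ≤ C * (1 + ‖y‖) ^ N)
    (hup' : ∃ (N : ℕ) (C : ℝ), ∀ y, ‖fderiv ℝ u y‖ ≤ C * (1 + ‖y‖) ^ N) {θ : E} (hθ : θ ∈ O) :
    IntegrableOn (fun s => p s * u (φ θ s)) V ∧
    IntegrableOn (fun s => p s • fderiv ℝ (fun t => u (φ t s)) θ) V ∧
    HasFDerivAt (fun t => ∫ s in V, p s * u (φ t s))
      (∫ s in V, p s • fderiv ℝ (fun t => u (φ t s)) θ) θ := by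
  have hW := h.isOpen_prod
  have hmeas := h.isOpen.measurableSet
  obtain ⟨N, C, hC⟩ := hup
  obtain ⟨M, B, hB⟩ := hup'
  have hΦ : ∀ N : ℕ, PolyGrowth (O ×ˢ V) 0 (fun x => (1 + ‖Function.uncurry φ x‖) ^ N) := fun N =>
    ((PolyGrowth.const (1 : ℝ)).add hW (h.poly 0).norm).pow hW N
  have hD : PolyGrowth (O ×ˢ V) 0 (fderiv ℝ (Function.uncurry φ)) := (h.poly 1).fderiv hW
  have hdec : ∀ {k : E × (Fin n → ℝ) → ℝ}, RapidDecay (O ×ˢ V) 0 k → ∃ g : (Fin n → ℝ) → ℝ,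
      Integrable g ∧ ∀ t ∈ O, ∀ s ∈ V, ‖k (t, s)‖ ≤ g s := fun {k} hk => by
    obtain ⟨L, hL0, hL⟩ := (hk (-(n + 1 : ℕ))).bound
    have hi : Integrable (fun x : Fin n → ℝ => (1 + ‖x‖) ^ (-((n : ℝ) + 1))) :=
      integrable_one_add_norm (by simp)
    refine ⟨_, hi.const_mul L, fun t ht s hs => (hL (t, s) ⟨ht, hs⟩).trans ?_⟩
    have h1 : (1 + ‖s‖) ^ (-((n : ℝ) + 1)) = (1 + ‖s‖) ^ (-(n + 1 : ℕ) : ℤ) := by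
      rw [← Real.rpow_intCast]; push_cast; rfl
    rw [h1, zpow_neg, zpow_neg, zpow_natCast, zpow_natCast]
    have h2 := one_add_norm_pos s
    have h3 : ‖s‖ ≤ ‖(t, s)‖ := norm_snd_le (t, s)
    gcongr
  obtain ⟨g₀, hg₀, hg₀'⟩ := hdec ((h.rapid 0).mul hW (hΦ N))
  obtain ⟨g₁, hg₁, hg₁'⟩ := hdec ((h.rapid 0).mul hW ((hΦ M).mul hW hD.norm))
  have hder : ∀ t ∈ O, ∀ s ∈ V, HasFDerivAt (fun t => u (φ t s)) ((fderiv ℝ u (φ t s)).comp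
      ((fderiv ℝ (Function.uncurry φ) (t, s)).comp (ContinuousLinearMap.inl ℝ E (Fin n → ℝ)))) t :=
    fun t ht s hs => ((hu.differentiable (by simp) (φ t s)).hasFDerivAt).comp t
      (h.hasFDerivAt_param ht hs)
  have hcu : ∀ t ∈ O, ContinuousOn (fun s => p s * u (φ t s)) V := fun t ht =>
    (h.continuousOn_density ht).mul (hu.continuous.comp_continuousOn (h.continuousOn ht))
  have hcd : ∀ t ∈ O, ContinuousOn (fun s => p s • fderiv ℝ (fun t => u (φ t s)) t) V := by
    intro t ht
    have h1 : ContinuousOn (fun s => p s • (fderiv ℝ u (φ t s)).comp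
      ((fderiv ℝ (Function.uncurry φ) (t, s)).comp (ContinuousLinearMap.inl ℝ E (Fin n → ℝ)))) V :=
      (h.continuousOn_density ht).smul
        (((hu.continuous_fderiv (by simp)).comp_continuousOn (h.continuousOn ht)).clm_comp
          ((continuousOn_section hD ht).clm_comp continuousOn_const))
    exact h1.congr fun s hs => by simp only [(hder t ht s hs).fderiv]
  have hb0 : ∀ t ∈ O, ∀ s ∈ V, ‖p s * u (φ t s)‖ ≤ C * g₀ s := fun t ht s hs => by
    have h1 := hg₀' t ht s hs
    have hC0 : 0 ≤ C := by
      have := (norm_nonneg _).trans (hC 0)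
      simpa using this
    rw [norm_mul, Real.norm_of_nonneg (by positivity : 0 ≤ (1 + ‖Function.uncurry φ (t, s)‖) ^ N)]
      at h1
    calc ‖p s * u (φ t s)‖ ≤ ‖p s‖ * (C * (1 + ‖φ t s‖) ^ N) := by
          rw [norm_mul]; gcongr; exact hC _
      _ = C * (‖p s‖ * (1 + ‖φ t s‖) ^ N) := by ring
      _ ≤ C * g₀ s := by gcongr; exact h1
  have hb1 : ∀ t ∈ O, ∀ s ∈ V, ‖p s • fderiv ℝ (fun t => u (φ t s)) t‖ ≤ B * g₁ s :=
      fun t ht s hs => by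
    have h1 := hg₁' t ht s hs
    have hB0 : 0 ≤ B := by
      have := (norm_nonneg _).trans (hB 0)
      simpa using this
    rw [norm_mul, Real.norm_of_nonneg (by positivity : 0 ≤ (1 + ‖Function.uncurry φ (t, s)‖) ^ M *
      ‖fderiv ℝ (Function.uncurry φ) (t, s)‖)] at h1
    rw [(hder t ht s hs).fderiv, norm_smul]
    calc _ ≤ ‖p s‖ * ((B * (1 + ‖φ t s‖) ^ M) * (‖fderiv ℝ (Function.uncurry φ) (t, s)‖ * 1)) := by
          gcongr
          refine (ContinuousLinearMap.opNorm_comp_le _ _).trans ?_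
          gcongr
          · exact hB _
          · refine (ContinuousLinearMap.opNorm_comp_le _ _).trans ?_
            gcongr
            exact ContinuousLinearMap.norm_inl_le_one ℝ E (Fin n → ℝ)
      _ = B * (‖p s‖ * ((1 + ‖φ t s‖) ^ M * ‖fderiv ℝ (Function.uncurry φ) (t, s)‖)) := by ring
      _ ≤ B * g₁ s := by gcongr; exact h1
  have hi0 : IntegrableOn (fun s => p s * u (φ θ s)) V := by
    refine (hg₀.const_mul C).integrableOn.mono' ((hcu θ hθ).aestronglyMeasurable hmeas) ?_
    filter_upwards [ae_restrict_mem hmeas] with s hs using hb0 θ hθ s hs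
  refine ⟨hi0, ?_, ?_⟩
  · refine (hg₁.const_mul B).integrableOn.mono' ((hcd θ hθ).aestronglyMeasurable hmeas) ?_
    filter_upwards [ae_restrict_mem hmeas] with s hs using hb1 θ hθ s hs
  · refine hasFDerivAt_integral_of_dominated_of_fderiv_le (s := O)
      (F' := fun t s => p s • fderiv ℝ (fun t => u (φ t s)) t) (bound := fun s => B * g₁ s)
      (h.isOpen_param.mem_nhds hθ) ?_ hi0 ((hcd θ hθ).aestronglyMeasurable hmeas) ?_
      (hg₁.const_mul B).integrableOn ?_
    · filter_upwards [h.isOpen_param.mem_nhds hθ] with t ht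
      exact (hcu t ht).aestronglyMeasurable hmeas
    · filter_upwards [ae_restrict_mem hmeas] with s hs t ht using hb1 t ht s hs
    · filter_upwards [ae_restrict_mem hmeas] with s hs t ht
      exact ((hder t ht s hs).differentiableAt.hasFDerivAt).const_smul (p s)

end Reparam

end integrals

end DSGD

namespace DSGD

/-! ### Gradients for discontinuous integrands. -/

section gradient

variable {E : Type} [NormedAddCommGroup E] [NormedSpace ℝ E] {n : ℕ}

/-- A measurable function bounded by a polynomial. -/
def MeasPoly (u : (Fin n → ℝ) → ℝ) : Prop :=
  Measurable u ∧ ∃ (N : ℕ) (C : ℝ), ∀ y, ‖u y‖ ≤ C * (1 + ‖y‖) ^ N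

namespace Reparam

variable {O : Set E} {V : Set (Fin n → ℝ)} {φ ψ : E → (Fin n → ℝ) → (Fin n → ℝ)}
  {p : (Fin n → ℝ) → ℝ}

lemma integrableOn_mul_comp [CompleteSpace E] (h : Reparam O V φ ψ p) {u : (Fin n → ℝ) → ℝ}
    (hu : MeasPoly u) {θ : E} (hθ : θ ∈ O) : IntegrableOn (fun s => p s * u (φ θ s)) V := by
  obtain ⟨Q, Q', Q'', hQ1, hQ2, hc, hc', hc'', hb, hb', hb'', hQ⟩ := h.exists_kernel
  obtain ⟨N, C, hC⟩ := hu.2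
  obtain ⟨D, hD0, hD⟩ := hb (N + n + 1)
  have h1 := integrableOn_smul_of_polyBdd h.isOpen hu.1 (hc θ hθ) le_rfl hC (hD θ hθ)
  rw [← h.image_eq hθ, integrableOn_image_iff_integrableOn_abs_det_fderiv_smul volume
    h.isOpen.measurableSet (h.hasFDerivWithinAt hθ) (h.invOn θ hθ).1.injOn] at h1
  refine h1.congr_fun (fun s hs => ?_) h.isOpen.measurableSet
  simp only [smul_eq_mul]
  rw [← hQ θ hθ s hs]
  ring

/-- Every clause follows from D u θ = ∫ u Q'(θ, ·) and the uniform decay of Q, Q' and Q''. In the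
last clause the decay bound on Q' does not depend on θ, so a single dominated convergence gives one
error sequence for all of `O`. -/
theorem exists_gradient [CompleteSpace E] (h : Reparam O V φ ψ p) :
    ∃ D : ((Fin n → ℝ) → ℝ) → E → E →L[ℝ] ℝ,
      (∀ u, MeasPoly u → ∀ θ ∈ O,
        HasFDerivAt (fun t => ∫ s in V, p s * u (φ t s)) (D u θ) θ) ∧
      (∀ u, MeasPoly u → ∃ M, 0 ≤ M ∧ ∀ θ ∈ O, ‖∫ s in V, p s * u (φ θ s)‖ ≤ M) ∧
      (∀ u, MeasPoly u → ∃ M, 0 ≤ M ∧ ∀ θ ∈ O, ‖D u θ‖ ≤ M) ∧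
      (∀ u, MeasPoly u → ∃ M, 0 ≤ M ∧ ∀ θ ∈ O,
        ∃ D₂ : E →L[ℝ] E →L[ℝ] ℝ, HasFDerivAt (D u) D₂ θ ∧ ‖D₂‖ ≤ M) ∧
      (∀ (u : (Fin n → ℝ) → ℝ) (v : ℕ → (Fin n → ℝ) → ℝ), Measurable u → PolyBdd (fun _ : Unit => u) →
        (∀ k, Measurable (v k)) → PolyBdd v →
        (∀ᵐ y, Tendsto (fun k => v k y) atTop (𝓝 (u y))) →
        ∃ e : ℕ → ℝ, Tendsto e atTop (𝓝 0) ∧ ∀ k, ∀ θ ∈ O, ‖D (v k) θ - D u θ‖ ≤ e k) := by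
  obtain ⟨Q, Q', Q'', hQ1, hQ2, hc, hc', hc'', hb, hb', hb'', hQ⟩ := h.exists_kernel
  have hO := h.isOpen_param
  have hV := h.isOpen
  have hbound : ∀ {G : Type} [NormedAddCommGroup G] [NormedSpace ℝ G] (q : E → (Fin n → ℝ) → G),
      (∀ K, ∃ C, 0 ≤ C ∧ ∀ θ ∈ O, ∀ y ∈ V, ‖q θ y‖ ≤ C * weight K y) →
      ∀ u, MeasPoly u → ∃ M, 0 ≤ M ∧ ∀ θ ∈ O, ‖∫ y in V, u y • q θ y‖ ≤ M := by
    intro G _ _ q hq u hu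
    obtain ⟨N, C, hC⟩ := hu.2
    obtain ⟨D, hD0, hD⟩ := hq (N + n + 1)
    refine ⟨|∫ y in V, C * D * ((1 + ‖y‖) ^ N * weight (N + n + 1) y)|, abs_nonneg _,
      fun θ hθ => le_trans ?_ (le_abs_self _)⟩
    refine norm_integral_le_of_norm_le
      (((integrable_pow_mul_weight N le_rfl).const_mul (C * D)).integrableOn) ?_
    filter_upwards [ae_restrict_mem hV.measurableSet] with y hy
    exact norm_smul_le_of_polyBdd hC (hD θ hθ) hy
  refine ⟨fun u θ => ∫ y in V, u y • Q' θ y, ?_, ?_, hbound Q' hb', ?_, ?_⟩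
  · intro u hu θ hθ
    refine (hasFDerivAt_integral_smul hO hV hQ1 hc hc' hb hb' hu.1 hu.2 hθ).congr_of_eventuallyEq ?_
    filter_upwards [hO.mem_nhds hθ] with t ht using h.setIntegral_eq hQ u ht
  · intro u hu
    obtain ⟨M, hM0, hM⟩ := hbound Q hb u hu
    refine ⟨M, hM0, fun θ hθ => ?_⟩
    rw [h.setIntegral_eq hQ u hθ]
    exact hM θ hθ
  · intro u hu
    obtain ⟨M, hM0, hM⟩ := hbound Q'' hb'' u hu
    exact ⟨M, hM0, fun θ hθ =>
      ⟨_, hasFDerivAt_integral_smul hO hV hQ2 hc' hc'' hb' hb'' hu.1 hu.2 hθ, hM θ hθ⟩⟩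
  · intro u v hu hup hv hvp hlim
    obtain ⟨C, N, hC0, hC⟩ := hup
    obtain ⟨B, M, hB0, hB⟩ := hvp
    obtain ⟨D, hD0, hD⟩ := hb' (N + M + n + 1)
    have hpow : ∀ y : Fin n → ℝ, 1 ≤ 1 + ‖y‖ := one_le_one_add_norm
    have hC' : ∀ y, ‖u y‖ ≤ C * (1 + ‖y‖) ^ (N + M) := fun y => (hC () y).trans (by
      gcongr
      · exact hpow y
      · omega)
    have hB' : ∀ k y, ‖v k y‖ ≤ B * (1 + ‖y‖) ^ (N + M) := fun k y => (hB k y).trans (by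
      gcongr
      · exact hpow y
      · omega)
    have hw : ∀ y : Fin n → ℝ, 0 < weight (N + M + n + 1) y := weight_pos _
    have hcw : Continuous (weight (n := n) (N + M + n + 1)) := continuous_weight _
    have hdiff : ∀ k y, ‖‖v k y - u y‖ * (D * weight (N + M + n + 1) y)‖
        ≤ (B + C) * D * ((1 + ‖y‖) ^ (N + M) * weight (N + M + n + 1) y) := fun k y => by
      have h1 := (norm_sub_le (v k y) (u y)).trans (add_le_add (hB' k y) (hC' y))
      have h2 := (hw y).le
      rw [norm_mul, norm_norm, Real.norm_of_nonneg (mul_nonneg hD0 h2)]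
      calc _ ≤ (B * (1 + ‖y‖) ^ (N + M) + C * (1 + ‖y‖) ^ (N + M)) *
            (D * weight (N + M + n + 1) y) := by gcongr
        _ = _ := by ring
    have hmeas : ∀ k, AEStronglyMeasurable
        (fun y => ‖v k y - u y‖ * (D * weight (N + M + n + 1) y)) volume := fun k =>
      (((hv k).sub hu).norm.mul (hcw.measurable.const_mul D)).aestronglyMeasurable
    have hdom := (integrable_pow_mul_weight (n := n) (N + M) (K := N + M + n + 1) le_rfl).const_mul
      ((B + C) * D)
    have hint : ∀ k, Integrable (fun y => ‖v k y - u y‖ * (D * weight (N + M + n + 1) y)) :=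
      fun k => hdom.mono' (hmeas k) (ae_of_all _ (hdiff k))
    refine ⟨fun k => ∫ y, ‖v k y - u y‖ * (D * weight (N + M + n + 1) y), ?_, fun k θ hθ => ?_⟩
    · have := tendsto_integral_of_dominated_convergence _ hmeas hdom
        (fun k => ae_of_all _ (hdiff k)) (f := fun _ => 0) (by
          filter_upwards [hlim] with y hy
          have h1 : Tendsto (fun k => ‖v k y - u y‖) atTop (𝓝 0) := by
            simpa using (hy.sub_const (u y)).norm
          simpa using h1.mul_const (D * weight (N + M + n + 1) y))
      simpa using this
    · have hi1 := integrableOn_smul_of_polyBdd hV (hv k) (hc' θ hθ) le_rfl (hB' k) (hD θ hθ)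
      have hi2 := integrableOn_smul_of_polyBdd hV hu (hc' θ hθ) le_rfl hC' (hD θ hθ)
      rw [← integral_sub hi1 hi2]
      refine (norm_integral_le_of_norm_le (hint k).integrableOn ?_).trans
        (setIntegral_le_integral (hint k) (ae_of_all _ fun y => ?_))
      · filter_upwards [ae_restrict_mem hV.measurableSet] with y hy
        rw [← sub_smul, norm_smul]
        gcongr
        exact hD θ hθ y hy
      · have := (hw y).le
        positivity

end Reparam

end gradient

end DSGD

namespace DSGD

/-! ### Processes driven by independent samples. -/

section stochastic

variable {E S Ω : Type*} [MeasurableSpace S] [MeasurableSpace E]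

/-- The process driven by the samples `s` through the transition maps `H`. -/
def chain (H : ℕ → E × S → E) (θ₀ : E) (s : ℕ → S) : ℕ → E
  | 0 => θ₀
  | k + 1 => H k (chain H θ₀ s k, s k)

/-- State k is a function of the samples before k only; this sharp σ-algebra makes it independent of
sample k. -/
lemma measurable_chain {H : ℕ → E × S → E} (hH : ∀ k, Measurable (H k)) (θ₀ : E)
    {s : ℕ → Ω → S} (k : ℕ) :
    Measurable[⨆ i ∈ Iio k, MeasurableSpace.comap (s i) inferInstance]
      (fun a => chain H θ₀ (fun i => s i a) k) := by
  induction k with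
  | zero => exact measurable_const
  | succ k ih =>
    refine (hH k).comp (Measurable.prodMk (ih.mono ?_ le_rfl) ?_)
    · exact biSup_mono fun i hi => lt_trans hi (Nat.lt_succ_self k)
    · refine (comap_measurable (s k)).mono ?_ le_rfl
      exact le_biSup (fun i => MeasurableSpace.comap (s i) inferInstance)
        (Nat.lt_succ_self k : k ∈ Iio (k + 1))

variable [MeasurableSpace Ω] {P : Measure Ω}

lemma indepFun_chain {H : ℕ → E × S → E} (hH : ∀ k, Measurable (H k)) (θ₀ : E)
    {s : ℕ → Ω → S} (hs : ∀ k, Measurable (s k)) (hind : iIndepFun s P) (k : ℕ) :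
    IndepFun (fun a => chain H θ₀ (fun i => s i a) k) (s k) P := by
  have h1 := indep_iSup_of_disjoint (fun i => (hs i).comap_le) hind.iIndep
    (S := Iio k) (T := {k}) (by simp)
  rw [IndepFun_iff_Indep]
  refine indep_of_indep_of_le_right (indep_of_indep_of_le_left h1 ?_) ?_
  · exact (measurable_chain hH θ₀ k).comap_le
  · simp

lemma measurable_chain' {H : ℕ → E × S → E} (hH : ∀ k, Measurable (H k)) (θ₀ : E)
    {s : ℕ → Ω → S} (hs : ∀ k, Measurable (s k)) (k : ℕ) :
    Measurable (fun a => chain H θ₀ (fun i => s i a) k) :=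
  (measurable_chain hH θ₀ k).mono (iSup₂_le fun i _ => (hs i).comap_le) le_rfl

/-- The joint law of state k and sample k is a product, so Fubini does the work of a conditional
expectation. -/
lemma integral_chain_succ [IsProbabilityMeasure P] {H : ℕ → E × S → E} (hH : ∀ k, Measurable (H k))
    (θ₀ : E) {s : ℕ → Ω → S} (hs : ∀ k, Measurable (s k)) (hind : iIndepFun s P)
    {V : E → ℝ} (hV : Measurable V) {M : ℝ} (hM : ∀ θ, ‖V θ‖ ≤ M) (k : ℕ) :
    ∫ a, V (chain H θ₀ (fun i => s i a) (k + 1)) ∂P =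
      ∫ a, (∫ x, V (H k (chain H θ₀ (fun i => s i a) k, x)) ∂(P.map (s k))) ∂P := by
  have hθ := measurable_chain' hH θ₀ hs k
  have hprod := (indepFun_iff_map_prod_eq_prod_map_map hθ.aemeasurable (hs k).aemeasurable).1
    (indepFun_chain hH θ₀ hs hind k)
  have := Measure.isProbabilityMeasure_map (μ := P) hθ.aemeasurable
  have := Measure.isProbabilityMeasure_map (μ := P) (hs k).aemeasurable
  have hVH : Measurable (fun z : E × S => V (H k z)) := hV.comp (hH k)
  have hint : Integrable (fun z : E × S => V (H k z))
      ((P.map (fun a => chain H θ₀ (fun i => s i a) k)).prod (P.map (s k))) :=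
    Integrable.of_bound hVH.aestronglyMeasurable M (ae_of_all _ fun z => hM _)
  calc _ = ∫ a, (fun z : E × S => V (H k z)) (chain H θ₀ (fun i => s i a) k, s k a) ∂P := rfl
    _ = ∫ z, V (H k z) ∂(P.map (fun a => (chain H θ₀ (fun i => s i a) k, s k a))) :=
        (integral_map (hθ.prodMk (hs k)).aemeasurable hVH.aestronglyMeasurable).symm
    _ = ∫ θ, ∫ x, V (H k (θ, x)) ∂(P.map (s k))
          ∂(P.map (fun a => chain H θ₀ (fun i => s i a) k)) := by
        rw [hprod, integral_prod _ hint]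
    _ = _ := integral_map hθ.aemeasurable hint.integral_prod_left.aestronglyMeasurable

end stochastic

/-! ### Expected decrease of a bounded potential. -/

section descent

variable {E S Ω : Type*} [MeasurableSpace Ω] {P : Measure Ω} [IsProbabilityMeasure P]
  [MeasurableSpace S]
  [NormedAddCommGroup E] [InnerProductSpace ℝ E] [CompleteSpace E] [MeasurableSpace E]
  [BorelSpace E] [SecondCountableTopology E]

/-- If the gradients are bounded away from zero along a stochastic gradient process as long as it is
active, then almost surely it does not stay active forever. -/
theorem ae_exists_notMem_active {V : E → ℝ} (hV : Measurable V) {M : ℝ} (hM : ∀ θ, ‖V θ‖ ≤ M)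
    {f' : E → E} {G : ℕ → E × S → E} (hG : ∀ k, Measurable (G k)) {A : ℕ → Set E}
    (hA : ∀ k, MeasurableSet (A k)) (hGA : ∀ k, ∀ θ ∉ A k, ∀ x, G k (θ, x) = 0)
    {C : ℝ} (hC : 0 ≤ C) {N : ℕ}
    (hdesc : ∀ k ≥ N, ∀ θ ∈ A k, ∀ θ', V θ' ≤ V θ + inner ℝ (f' θ) (θ' - θ) + C * ‖θ' - θ‖ ^ 2)
    {δ : ℝ} (hδ : 0 < δ) (hf' : ∀ k ≥ N, ∀ θ ∈ A k, δ ≤ ‖f' θ‖)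
    {D : Measure S} [IsProbabilityMeasure D] {B γ : ℕ → ℝ}
    (hγ : ∀ k, 0 < γ k) (hint : ∀ k ≥ N, ∀ θ ∈ A k, Integrable (fun x => G k (θ, x)) D)
    (hint2 : ∀ k ≥ N, ∀ θ ∈ A k, Integrable (fun x => ‖G k (θ, x)‖ ^ 2) D)
    (hB : ∀ k ≥ N, ∀ θ ∈ A k, ∫ x, ‖G k (θ, x)‖ ^ 2 ∂D ≤ B k)
    (hB0 : ∀ k ≥ N, 0 ≤ B k)
    (hbias : ∀ k ≥ N, ∀ θ ∈ A k, ‖∫ x, G k (θ, x) ∂D - f' θ‖ ≤ δ / 2)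
    (hsum : Summable (fun k => γ k ^ 2 * B k)) (hdiv : ¬ Summable γ)
    {s : ℕ → Ω → S} (hs : ∀ k, Measurable (s k)) (hind : iIndepFun s P)
    (hlaw : ∀ k, P.map (s k) = D) (θ₀ : E) :
    ∀ᵐ a ∂P, ∃ k ≥ N, chain (fun k z => z.1 - γ k • G k z) θ₀ (fun i => s i a) k ∉ A k := by
  set H : ℕ → E × S → E := fun k z => z.1 - γ k • G k z
  have hH : ∀ k, Measurable (H k) := fun k => measurable_fst.sub ((hG k).const_smul (γ k))
  set X : ℕ → Ω → E := fun k a => chain H θ₀ (fun i => s i a) k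
  have hX : ∀ k, Measurable (X k) := measurable_chain' hH θ₀ hs
  have hVX : ∀ k, Integrable (fun a => V (X k a)) P := fun k =>
    Integrable.of_bound (hV.comp (hX k)).aestronglyMeasurable M (ae_of_all _ fun a => hM _)
  -- One step averaged over the sample: the potential drops by γ_k δ²/2 on the active set up to the
  -- second-moment error. Off the active set nothing moves.
  have hpt : ∀ k ≥ N, ∀ θ, ∫ x, V (H k (θ, x)) ∂D ≤
      V θ - (A k).indicator (fun _ => γ k * (δ ^ 2 / 2)) θ + C * (γ k ^ 2 * B k) := by
    intro k hk θ
    have hC2 : 0 ≤ C * (γ k ^ 2 * B k) := mul_nonneg hC (mul_nonneg (sq_nonneg _) (hB0 k hk))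
    by_cases hθ : θ ∈ A k
    · rw [indicator_of_mem hθ]
      have h1 := (hint k hk θ hθ)
      have h2 := (hint2 k hk θ hθ)
      have h3 : Integrable (fun x => inner ℝ (f' θ) (G k (θ, x))) D := h1.const_inner _
      have hi : Integrable (fun x => V θ - γ k * inner ℝ (f' θ) (G k (θ, x))
          + C * γ k ^ 2 * ‖G k (θ, x)‖ ^ 2) D :=
        ((integrable_const _).sub (h3.const_mul _)).add (h2.const_mul _)
      have hVi : Integrable (fun x => V (H k (θ, x))) D :=
        Integrable.of_bound (hV.comp ((hH k).comp measurable_prodMk_left)).aestronglyMeasurable M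
          (ae_of_all _ fun a => hM _)
      have h4 : ∫ x, V (H k (θ, x)) ∂D ≤ ∫ x, (V θ - γ k * inner ℝ (f' θ) (G k (θ, x))
          + C * γ k ^ 2 * ‖G k (θ, x)‖ ^ 2) ∂D := by
        refine integral_mono hVi hi fun x => (hdesc k hk θ hθ _).trans_eq ?_
        have : H k (θ, x) - θ = -(γ k • G k (θ, x)) := by simp [H]
        rw [this, inner_neg_right, inner_smul_right, norm_neg, norm_smul, mul_pow,
          Real.norm_eq_abs, sq_abs]
        ring
      have h5 : ∫ x, (V θ - γ k * inner ℝ (f' θ) (G k (θ, x))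
          + C * γ k ^ 2 * ‖G k (θ, x)‖ ^ 2) ∂D = V θ - γ k * inner ℝ (f' θ) (∫ x, G k (θ, x) ∂D)
          + C * γ k ^ 2 * ∫ x, ‖G k (θ, x)‖ ^ 2 ∂D := by
        have hs1 : Integrable (fun x => V θ - γ k * inner ℝ (f' θ) (G k (θ, x))) D :=
          (integrable_const _).sub (h3.const_mul _)
        rw [integral_add hs1 (h2.const_mul _), integral_sub (integrable_const _) (h3.const_mul _), integral_const_mul,
          integral_const_mul, integral_inner h1]
        simp
      -- With m the mean estimate, ⟨f', m⟩ ≥ ‖f'‖² - ‖f'‖ δ/2 ≥ δ²/2, because the bias is at most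
      -- δ/2 and ‖f'‖ ≥ δ.
      have h6 : δ ^ 2 / 2 ≤ inner ℝ (f' θ) (∫ x, G k (θ, x) ∂D) := by
        have e1 := hbias k hk θ hθ
        have e2 := hf' k hk θ hθ
        set m := ∫ x, G k (θ, x) ∂D
        have e3 : inner ℝ (f' θ) m = ‖f' θ‖ ^ 2 + inner ℝ (f' θ) (m - f' θ) := by
          rw [inner_sub_right, real_inner_self_eq_norm_sq]; ring
        have e4 := (abs_le.1 (abs_real_inner_le_norm (f' θ) (m - f' θ))).1
        have e5 : ‖f' θ‖ * ‖m - f' θ‖ ≤ ‖f' θ‖ * (δ / 2) := by gcongr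
        rw [e3]
        nlinarith
      have h7 := hB k hk θ hθ
      have h8 : C * γ k ^ 2 * ∫ x, ‖G k (θ, x)‖ ^ 2 ∂D ≤ C * γ k ^ 2 * B k := by gcongr
      have h9 := mul_le_mul_of_nonneg_left h6 (hγ k).le
      rw [h5] at h4
      linarith
    · rw [indicator_of_notMem hθ]
      have : ∀ x, H k (θ, x) = θ := fun x => by simp [H, hGA k θ hθ x]
      simp only [this]
      simpa using hC2
  set B₀ : Set Ω := {a | ∀ k ≥ N, X k a ∈ A k}
  have hB₀ : MeasurableSet B₀ := by
    have : B₀ = ⋂ k ≥ N, X k ⁻¹' A k := by ext; simp [B₀]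
    rw [this]
    exact MeasurableSet.iInter fun k => MeasurableSet.iInter fun _ => hX k (hA k)
  have hstep : ∀ k ≥ N, γ k * (δ ^ 2 / 2 * P.real B₀) ≤
      ∫ a, V (X k a) ∂P - ∫ a, V (X (k + 1) a) ∂P + C * (γ k ^ 2 * B k) := by
    intro k hk
    have h1 := integral_chain_succ hH θ₀ hs hind hV hM k
    rw [hlaw k] at h1
    have hmI : Measurable ((A k).indicator (fun _ => γ k * (δ ^ 2 / 2))) :=
      measurable_const.indicator (hA k)
    have hcγ : 0 ≤ γ k * (δ ^ 2 / 2) := mul_nonneg (hγ k).le (by positivity)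
    have hiI : Integrable (fun a => (A k).indicator (fun _ => γ k * (δ ^ 2 / 2)) (X k a)) P := by
      refine Integrable.of_bound (hmI.comp (hX k)).aestronglyMeasurable (γ k * (δ ^ 2 / 2))
        (ae_of_all _ fun a => ?_)
      refine (norm_indicator_le_norm_self _ _).trans ?_
      rw [Real.norm_of_nonneg hcγ]
    have hmm : Measurable fun θ => ∫ x, V (H k (θ, x)) ∂D :=
      ((hV.comp (hH k)).stronglyMeasurable.integral_prod_right' (ν := D)).measurable
    have hi1 : Integrable (fun a => ∫ x, V (H k (X k a, x)) ∂D) P := by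
      refine Integrable.of_bound (hmm.comp (hX k)).aestronglyMeasurable M (ae_of_all _ fun a => ?_)
      refine (norm_integral_le_of_norm_le_const (ae_of_all _ fun x => hM _)).trans_eq ?_
      simp
    have h2 : ∫ a, V (X (k + 1) a) ∂P ≤ ∫ a, (V (X k a) -
        (A k).indicator (fun _ => γ k * (δ ^ 2 / 2)) (X k a) + C * (γ k ^ 2 * B k)) ∂P :=
      h1.trans_le (integral_mono hi1 (((hVX k).sub hiI).add (integrable_const _))
        fun a => hpt k hk (X k a))
    have h3 : γ k * (δ ^ 2 / 2) * P.real B₀ ≤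
        ∫ a, (A k).indicator (fun _ => γ k * (δ ^ 2 / 2)) (X k a) ∂P := by
      calc γ k * (δ ^ 2 / 2) * P.real B₀ = ∫ a, B₀.indicator (fun _ => γ k * (δ ^ 2 / 2)) a ∂P := by
            rw [integral_indicator_const _ hB₀, smul_eq_mul, mul_comm]
        _ ≤ _ := by
            refine integral_mono ((integrable_const _).indicator hB₀) hiI fun a => ?_
            by_cases ha : a ∈ B₀
            · have : X k a ∈ A k := ha k hk
              simp [ha, this]
            · rw [indicator_of_notMem ha]
              exact indicator_nonneg (fun _ _ => hcγ) _
    have hs1 : Integrable (fun a => V (X k a) -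
        (A k).indicator (fun _ => γ k * (δ ^ 2 / 2)) (X k a)) P := (hVX k).sub hiI
    rw [integral_add hs1 (integrable_const _), integral_sub (hVX k) hiI] at h2
    simp only [integral_const, probReal_univ, one_smul] at h2
    linarith
  -- The potential differences telescope and |V| ≤ M. So the sums of γ_k P(B₀) stay bounded, which
  -- forces P(B₀) = 0 as ∑ γ_k diverges.
  have hbound : ∀ K, ∑ k ∈ Finset.range K, γ (N + k) * (δ ^ 2 / 2 * P.real B₀) ≤
      2 * M + C * ∑' k, γ (N + k) ^ 2 * B (N + k) := by
    intro K
    have hsum' : Summable (fun k => γ (N + k) ^ 2 * B (N + k)) := by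
      have := (summable_nat_add_iff N).2 hsum
      simpa only [add_comm] using this
    have hV1 : ∀ k, |∫ a, V (X k a) ∂P| ≤ M := fun k => by
      refine (norm_integral_le_of_norm_le_const (ae_of_all _ fun a => hM (X k a))).trans_eq ?_
      simp
    calc _ ≤ ∑ k ∈ Finset.range K, (∫ a, V (X (N + k) a) ∂P - ∫ a, V (X (N + k + 1) a) ∂P
          + C * (γ (N + k) ^ 2 * B (N + k))) :=
          Finset.sum_le_sum fun k _ => hstep (N + k) (Nat.le_add_right N k)
      _ = (∫ a, V (X N a) ∂P - ∫ a, V (X (N + K) a) ∂P)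
          + C * ∑ k ∈ Finset.range K, γ (N + k) ^ 2 * B (N + k) := by
          rw [Finset.sum_add_distrib, Finset.mul_sum]
          congr 1
          exact Finset.sum_range_sub' (fun k => ∫ a, V (X (N + k) a) ∂P) K
      _ ≤ _ := by
          have h1 := (abs_le.1 (hV1 N)).2
          have h2 := (abs_le.1 (hV1 (N + K))).1
          have h3 : ∑ k ∈ Finset.range K, γ (N + k) ^ 2 * B (N + k) ≤
              ∑' k, γ (N + k) ^ 2 * B (N + k) :=
            hsum'.sum_le_tsum _ fun k _ =>
              mul_nonneg (sq_nonneg _) (hB0 _ (Nat.le_add_right N k))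
          have h4 := mul_le_mul_of_nonneg_left h3 hC
          linarith
  have hzero : P.real B₀ = 0 := by
    by_contra hne
    have hpos : 0 < δ ^ 2 / 2 * P.real B₀ :=
      mul_pos (by positivity) (lt_of_le_of_ne measureReal_nonneg (Ne.symm hne))
    have h1 : Summable (fun k => γ (N + k) * (δ ^ 2 / 2 * P.real B₀)) :=
      summable_of_sum_range_le (fun k => mul_nonneg (hγ _).le hpos.le) hbound
    have h2 := (summable_mul_right_iff hpos.ne').1 h1
    refine hdiv ((summable_nat_add_iff N).1 ?_)
    simpa only [add_comm] using h2
  have hnull : P B₀ = 0 := by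
    rwa [Measure.real, ENNReal.toReal_eq_zero_iff, or_iff_left (measure_ne_top P B₀)] at hzero
  have := measure_eq_zero_iff_ae_notMem.1 hnull
  filter_upwards [this] with a ha
  simpa [B₀] using ha

end descent

end DSGD

namespace DSGD

/-! ### The base distribution lives on the interior of U. -/

section density

variable {n : ℕ} {U : Set (Fin n → ℝ)} {p : (Fin n → ℝ) → ℝ}

lemma IsSchwartzOn.densityMeasure_eq (hp : IsSchwartzOn p U) :
    densityMeasure p U =
      (volume.restrict (interior U)).withDensity (fun x => ENNReal.ofReal (p x)) := by
  rw [densityMeasure, Measure.restrict_congr_set (interior_ae_eq_of_null_frontier hp.frontier_null)]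

lemma IsSchwartzOn.aemeasurable (hp : IsSchwartzOn p U) :
    AEMeasurable (fun x => ENNReal.ofReal (p x)) (volume.restrict (interior U)) :=
  (hp.contDiffOn.continuousOn.aemeasurable isOpen_interior.measurableSet).ennreal_ofReal

lemma IsSchwartzOn.ae_mem (hp : IsSchwartzOn p U) :
    ∀ᵐ x ∂densityMeasure p U, x ∈ interior U := by
  rw [hp.densityMeasure_eq]
  exact (withDensity_absolutelyContinuous _ _).ae_le (ae_restrict_mem isOpen_interior.measurableSet)

variable {G : Type*} [NormedAddCommGroup G] [NormedSpace ℝ G]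

lemma IsSchwartzOn.toReal_smul_ae_eq (hp0 : ∀ x ∈ interior U, 0 ≤ p x)
    (f : (Fin n → ℝ) → G) : (fun x => (ENNReal.ofReal (p x)).toReal • f x)
      =ᵐ[volume.restrict (interior U)] fun x => p x • f x := by
  filter_upwards [ae_restrict_mem isOpen_interior.measurableSet] with x hx
  rw [ENNReal.toReal_ofReal (hp0 x hx)]

lemma IsSchwartzOn.integral_densityMeasure (hp : IsSchwartzOn p U)
    (hp0 : ∀ x ∈ interior U, 0 ≤ p x) (f : (Fin n → ℝ) → G) :
    ∫ x, f x ∂densityMeasure p U = ∫ x in interior U, p x • f x := by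
  rw [hp.densityMeasure_eq, integral_withDensity_eq_integral_toReal_smul₀ hp.aemeasurable
    (ae_of_all _ fun x => ENNReal.ofReal_lt_top)]
  exact integral_congr_ae (toReal_smul_ae_eq hp0 f)

lemma IsSchwartzOn.integrable_densityMeasure_iff (hp : IsSchwartzOn p U)
    (hp0 : ∀ x ∈ interior U, 0 ≤ p x) (f : (Fin n → ℝ) → G) :
    Integrable f (densityMeasure p U) ↔ IntegrableOn (fun x => p x • f x) (interior U) := by
  rw [hp.densityMeasure_eq, integrable_withDensity_iff_integrable_smul₀' hp.aemeasurable
    (ae_of_all _ fun x => ENNReal.ofReal_lt_top)]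
  exact integrable_congr (toReal_smul_ae_eq hp0 f)

end density

/-! ### The potential that survives leaving Θ. -/

section descent

/-- A step can leave Θ by any distance, so f is replaced outside Θ by its lower bound -M, and
leaving never raises the potential above f. Steps shorter than δ stay in the thickening, where
Taylor's bound applies; for longer ones 2M and M'‖Δ‖ are dominated by multiples of ‖Δ‖², whence
2M/δ² and M'/δ. -/
lemma exists_descent {E : Type*} [NormedAddCommGroup E] [NormedSpace ℝ E] {Θ : Set E} {δ : ℝ}
    (hδ : 0 < δ) {f : E → ℝ} {Df : E → E →L[ℝ] ℝ}
    (hf : ∀ θ ∈ Metric.thickening δ Θ, HasFDerivAt f (Df θ) θ) {M M' L : ℝ}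
    (hM : ∀ θ ∈ Metric.thickening δ Θ, ‖f θ‖ ≤ M) (hM0 : 0 ≤ M) (hM0' : 0 ≤ M') (hL0 : 0 ≤ L)
    (hM' : ∀ θ ∈ Metric.thickening δ Θ, ‖Df θ‖ ≤ M')
    (hL : ∀ θ ∈ Metric.thickening δ Θ, ∃ D₂ : E →L[ℝ] E →L[ℝ] ℝ, HasFDerivAt Df D₂ θ ∧ ‖D₂‖ ≤ L)
    {V : E → ℝ} (hV : ∀ θ ∈ Θ, V θ = f θ) (hV' : ∀ θ ∉ Θ, V θ = -M) :
    ∃ C, 0 ≤ C ∧ ∀ θ ∈ Θ, ∀ θ', V θ' ≤ V θ + Df θ (θ' - θ) + C * ‖θ' - θ‖ ^ 2 := by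
  refine ⟨L + (2 * M / δ ^ 2 + M' / δ), by positivity, fun θ hθ θ' => ?_⟩
  have hsub : Metric.ball θ δ ⊆ Metric.thickening δ Θ := Metric.ball_subset_thickening hθ δ
  have hθO := hsub (Metric.mem_ball_self hδ)
  have hΘO : Θ ⊆ Metric.thickening δ Θ := Metric.self_subset_thickening hδ Θ
  rw [hV θ hθ]
  set Δ := θ' - θ
  have hVM : ∀ t, V t ≤ M := fun t => by
    by_cases ht : t ∈ Θ
    · rw [hV t ht]; exact (Real.le_norm_self _).trans (hM t (hΘO ht))
    · rw [hV' t ht]; linarith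
  rcases lt_or_ge ‖Δ‖ δ with h | h
  · have hVf : V θ' ≤ f θ' := by
      by_cases ht : θ' ∈ Θ
      · rw [hV θ' ht]
      · rw [hV' θ' ht]
        refine (abs_le.1 (hM θ' (hsub ?_))).1
        rwa [Metric.mem_ball, dist_eq_norm]
    have hball : Metric.closedBall θ ‖Δ‖ ⊆ Metric.thickening δ Θ :=
      (Metric.closedBall_subset_ball h).trans hsub
    have hDf : ∀ x ∈ Metric.closedBall θ ‖Δ‖, ‖Df x - Df θ‖ ≤ L * ‖Δ‖ := fun x hx => by
      have h1 := (convex_closedBall θ ‖Δ‖).norm_image_sub_le_of_norm_hasFDerivWithin_le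
        (f := Df) (f' := fderiv ℝ Df) (C := L) (x := θ) (y := x)
        (fun y hy => by
          obtain ⟨D₂, h2, -⟩ := hL y (hball hy)
          exact h2.differentiableAt.hasFDerivAt.hasFDerivWithinAt)
        (fun y hy => by
          obtain ⟨D₂, h2, h3⟩ := hL y (hball hy)
          rwa [h2.fderiv])
        (Metric.mem_closedBall_self (norm_nonneg _)) hx
      refine h1.trans ?_
      gcongr
      rwa [← dist_eq_norm]
    have h1 := (convex_closedBall θ ‖Δ‖).norm_image_sub_le_of_norm_hasFDerivWithin_le'
      (f := f) (f' := Df) (φ := Df θ) (C := L * ‖Δ‖) (x := θ) (y := θ')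
      (fun x hx => (hf x (hball hx)).hasFDerivWithinAt) hDf
      (Metric.mem_closedBall_self (norm_nonneg _)) (by rw [Metric.mem_closedBall, dist_eq_norm])
    have h2 := (abs_le.1 h1).2
    have h3 : 0 ≤ (2 * M / δ ^ 2 + M' / δ) * ‖Δ‖ ^ 2 := by positivity
    nlinarith
  · have h1 := hVM θ'
    have h2 := (abs_le.1 (hM θ hθO)).1
    have h3 : -(M' * ‖Δ‖) ≤ Df θ Δ := by
      have := (abs_le.1 ((Df θ).le_opNorm Δ)).1
      have h4 : ‖Df θ‖ * ‖Δ‖ ≤ M' * ‖Δ‖ := by gcongr; exact hM' θ hθO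
      linarith
    have h4 : 2 * M ≤ 2 * M / δ ^ 2 * ‖Δ‖ ^ 2 := by
      rw [div_mul_eq_mul_div, le_div_iff₀ (by positivity)]
      gcongr
    have h5 : M' * ‖Δ‖ ≤ M' / δ * ‖Δ‖ ^ 2 := by
      rw [div_mul_eq_mul_div, le_div_iff₀ hδ, sq, mul_assoc]
      gcongr
    have h6 : 0 ≤ L * ‖Δ‖ ^ 2 := by positivity
    nlinarith

end descent

/-! ### Step sizes and accuracy coefficients. -/

section steps

variable {ℓ : ℕ} {ε : ℝ} {γ η : ℕ → ℝ}

lemma not_summable_of_isTheta (hγ : γ =Θ[atTop] fun k : ℕ => 1 / (k : ℝ)) : ¬ Summable γ :=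
  fun h => Real.not_summable_one_div_natCast (summable_of_isBigO_nat h hγ.2)

lemma exponent_neg (hεℓ : ε < 1 / (ℓ : ℝ)) : -(1 / (ℓ : ℝ)) + ε < 0 := by linarith

lemma tendsto_accuracy (hεℓ : ε < 1 / (ℓ : ℝ)) (hη_pos : ∀ k, 0 < η k)
    (hη : η =Θ[atTop] fun k : ℕ => (k : ℝ) ^ (-(1 / (ℓ : ℝ)) + ε)) :
    Tendsto η atTop (𝓝[>] 0) := by
  have h1 : Tendsto (fun k : ℕ => (k : ℝ) ^ (-(1 / (ℓ : ℝ)) + ε)) atTop (𝓝 0) := by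
    have := (tendsto_rpow_neg_atTop (neg_pos.2 (exponent_neg hεℓ))).comp
      tendsto_natCast_atTop_atTop
    simpa only [neg_neg, Function.comp_def] using this
  exact tendsto_nhdsWithin_iff.2 ⟨hη.1.trans_tendsto h1, Eventually.of_forall hη_pos⟩

/-- The terms are O(k⁻² · k^(1-εℓ)) = O(k^(-(1+εℓ))): the exponent -1/ℓ + ε is what pays for the
variance η^(-ℓ). -/
lemma summable_sq_mul_inv_pow (hℓ : 1 ≤ ℓ) (hε : 0 < ε)
    (hγ : γ =Θ[atTop] fun k : ℕ => 1 / (k : ℝ))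
    (hη : η =Θ[atTop] fun k : ℕ => (k : ℝ) ^ (-(1 / (ℓ : ℝ)) + ε)) :
    Summable (fun k => γ k ^ 2 * (η k ^ ℓ)⁻¹) := by
  have hl : (0 : ℝ) < ℓ := by exact_mod_cast hℓ
  have h1 := (hγ.pow 2).mul (hη.pow ℓ).inv
  refine summable_of_isBigO_nat (g := fun k : ℕ => (k : ℝ) ^ (-(1 + ε * ℓ))) ?_ ?_
  · exact Real.summable_nat_rpow.2 (by nlinarith)
  · refine h1.1.trans (EventuallyEq.isBigO ?_)
    filter_upwards [eventually_gt_atTop 0] with k hk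
    have hk0 : (0 : ℝ) < k := by exact_mod_cast hk
    have e1 : (1 / (k : ℝ)) ^ 2 = (k : ℝ) ^ (-2 : ℝ) := by
      rw [Real.rpow_neg hk0.le, one_div, inv_pow]
      norm_cast
    have e2 : (((k : ℝ) ^ (-(1 / (ℓ : ℝ)) + ε)) ^ ℓ)⁻¹
        = (k : ℝ) ^ (-((-(1 / (ℓ : ℝ)) + ε) * ℓ)) := by
      rw [Real.rpow_neg hk0.le, Real.rpow_mul hk0.le, Real.rpow_natCast]
    rw [e1, e2, ← Real.rpow_add hk0]
    congr 1
    field_simp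
    ring

end steps

/-! ### From directional derivatives to operator norms. -/

section fderiv

variable {n : ℕ}

/-- The norm dual to the sup norm is the ℓ¹ norm of the coordinates; Cauchy–Schwarz costs the factor
n. -/
lemma norm_sq_le_sum_single (L : (Fin n → ℝ) →L[ℝ] ℝ) :
    ‖L‖ ^ 2 ≤ n * ∑ i, L (Pi.single i 1) ^ 2 := by
  have h1 : ‖L‖ ≤ ∑ i, |L (Pi.single i 1)| := by
    refine L.opNorm_le_bound (Finset.sum_nonneg fun _ _ => abs_nonneg _) fun x => ?_
    have hx : L x = ∑ i, x i * L (Pi.single i 1) := by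
      conv_lhs => rw [pi_eq_sum_univ' x]
      simp only [map_sum, map_smul, smul_eq_mul]
    rw [hx, Finset.sum_mul]
    refine (norm_sum_le _ _).trans (Finset.sum_le_sum fun i _ => ?_)
    rw [norm_mul, mul_comm, Real.norm_eq_abs (L _)]
    gcongr
    exact norm_le_pi_norm x i
  calc ‖L‖ ^ 2 ≤ (∑ i, |L (Pi.single i 1)|) ^ 2 := by gcongr
    _ ≤ (Finset.univ : Finset (Fin n)).card * ∑ i, |L (Pi.single i 1)| ^ 2 :=
        sq_sum_le_card_mul_sum_sq
    _ = _ := by simp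

lemma Expr.HasDepth.exists_weightBdd {ℓ : ℕ} {F : Expr n} (hF : F.HasDepth ℓ) :
    ∃ v : Ioc (0 : ℝ) 1 → (Fin n → ℝ) → ℝ, WeightBdd ℓ v ∧
      ∀ (η : Ioc (0 : ℝ) 1) y, ‖fderiv ℝ (F.smooth η) y‖ ^ 2 ≤ v η y := by
  refine ⟨_, (WeightBdd.sum Finset.univ fun i _ =>
    hF.weightBdd_gauge (Pi.single i 1)).mul_pow (Nat.cast_nonneg n) 0, fun η y => ?_⟩
  rw [pow_zero, mul_one]
  refine (norm_sq_le_sum_single _).trans ?_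
  gcongr with i
  exact le_add_of_nonneg_right (abs_nonneg _)

lemma WeightBdd.poly_of_sq_le {ℓ : ℕ} {v : Ioc (0 : ℝ) 1 → (Fin n → ℝ) → ℝ} (hv : WeightBdd ℓ v)
    {G : Type*} [NormedAddCommGroup G] (η : Ioc (0 : ℝ) 1) {w : (Fin n → ℝ) → G}
    (hw : ∀ y, ‖w y‖ ^ 2 ≤ v η y) :
    ∃ (N : ℕ) (C : ℝ), ∀ y, ‖w y‖ ≤ C * (1 + ‖y‖) ^ N := by
  obtain ⟨M, C, N, hC, h⟩ := hv.polyBdd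
  have hη : 0 < (η : ℝ) ^ M := pow_pos η.2.1 M
  refine ⟨N, 1 + C / (η : ℝ) ^ M, fun y => ?_⟩
  have h1 := h η y
  rw [norm_mul, Real.norm_of_nonneg hη.le, Real.norm_of_nonneg (hv.nonneg η y),
    ← le_div_iff₀' hη] at h1
  have h2 : 1 ≤ (1 + ‖y‖) ^ N := one_le_pow₀ (one_le_one_add_norm y)
  have h3 : C * (1 + ‖y‖) ^ N / (η : ℝ) ^ M = C / (η : ℝ) ^ M * (1 + ‖y‖) ^ N := by ring
  nlinarith [hw y, sq_nonneg (‖w y‖ - 1)]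

end fderiv

end DSGD

namespace DSGD

/-! ### Gradients through the Riesz isometry. -/

section riesz

variable {E : Type*} [NormedAddCommGroup E] [InnerProductSpace ℝ E] [CompleteSpace E]

/-- The inverse of the Riesz isometry, as an `ℝ`-linear map. -/
noncomputable def riesz : (E →L[ℝ] ℝ) →ₗᵢ[ℝ] E where
  toFun := (InnerProductSpace.toDual ℝ E).symm
  map_add' := map_add _
  map_smul' c x := by simp
  norm_map' x := by simp

lemma gradient_eq_riesz (f : E → ℝ) (x : E) : gradient f x = riesz (fderiv ℝ f x) := rfl

lemma inner_riesz (L : E →L[ℝ] ℝ) (x : E) : inner ℝ (riesz L) x = L x :=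
  InnerProductSpace.toDual_symm_apply

end riesz

/-! ### Sample gradients and their second moments. -/

namespace Reparam

variable {E : Type} [NormedAddCommGroup E] [NormedSpace ℝ E] {n : ℕ}
  {O : Set E} {V : Set (Fin n → ℝ)} {φ ψ : E → (Fin n → ℝ) → (Fin n → ℝ)}
  {p : (Fin n → ℝ) → ℝ}

lemma fderiv_comp_param (h : Reparam O V φ ψ p) {u : (Fin n → ℝ) → ℝ} (hu : ContDiff ℝ 1 u)
    {x : E × (Fin n → ℝ)} (hx : x ∈ O ×ˢ V) :
    fderiv ℝ (fun t => u (φ t x.2)) x.1 = (fderiv ℝ u (φ x.1 x.2)).comp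
      ((fderiv ℝ (Function.uncurry φ) x).comp (ContinuousLinearMap.inl ℝ E (Fin n → ℝ))) :=
  (((hu.differentiable (by simp)) _).hasFDerivAt.comp x.1 (h.hasFDerivAt_param hx.1 hx.2)).fderiv

lemma norm_fderiv_comp_param_le (h : Reparam O V φ ψ p) {u : (Fin n → ℝ) → ℝ}
    (hu : ContDiff ℝ 1 u) {x : E × (Fin n → ℝ)} (hx : x ∈ O ×ˢ V) :
    ‖fderiv ℝ (fun t => u (φ t x.2)) x.1‖ ≤
      ‖fderiv ℝ u (φ x.1 x.2)‖ * ‖fderiv ℝ (Function.uncurry φ) x‖ := by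
  rw [h.fderiv_comp_param hu hx]
  refine (ContinuousLinearMap.opNorm_comp_le _ _).trans ?_
  gcongr
  refine (ContinuousLinearMap.opNorm_comp_le _ _).trans ?_
  exact mul_le_of_le_one_right (norm_nonneg _) (ContinuousLinearMap.norm_inl_le_one ℝ E _)

lemma continuousOn_fderiv_comp_param (h : Reparam O V φ ψ p) {u : (Fin n → ℝ) → ℝ}
    (hu : ContDiff ℝ 1 u) :
    ContinuousOn (fun x : E × (Fin n → ℝ) => fderiv ℝ (fun t => u (φ t x.2)) x.1) (O ×ˢ V) := by
  have h1 : ContinuousOn (fderiv ℝ (Function.uncurry φ)) (O ×ˢ V) := by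
    obtain ⟨r, hr⟩ := h.poly 1
    exact hr.1.continuousOn_fderiv_of_isOpen h.isOpen_prod le_rfl
  have h2 : ContinuousOn (Function.uncurry φ) (O ×ˢ V) := by
    obtain ⟨r, hr⟩ := h.poly 1
    exact hr.1.continuousOn
  refine ContinuousOn.congr ?_ fun x hx => h.fderiv_comp_param hu hx
  exact ((hu.continuous_fderiv (by simp)).comp_continuousOn h2).clm_comp
    (h1.clm_comp continuousOn_const)

/-- The chain rule bounds the sample gradient by ‖D⟦F⟧_η‖ ‖Dφ‖. The change of variables in
`integral_le_weight` absorbs ‖Dφ‖² and leaves a weighted Lebesgue integral of order η^(-ℓ). -/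
lemma exists_integral_sq_fderiv_le (h : Reparam O V φ ψ p) (hp : ∀ s ∈ V, 0 ≤ p s) {ℓ : ℕ}
    {F : Expr n} (hF : F.HasDepth ℓ) :
    ∃ C, 0 ≤ C ∧ ∀ η ∈ Ioc (0 : ℝ) 1, ∀ θ ∈ O,
      IntegrableOn (fun s => p s * ‖fderiv ℝ (fun t => F.smooth η (φ t s)) θ‖ ^ 2) V ∧
      ∫ s in V, p s * ‖fderiv ℝ (fun t => F.smooth η (φ t s)) θ‖ ^ 2 ≤ C * (η ^ ℓ)⁻¹ := by
  obtain ⟨v, hv, hFv⟩ := hF.exists_weightBdd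
  obtain ⟨K₁, hK₁⟩ := hv.integrable
  obtain ⟨K₂, hK₂⟩ := hv.integral_le
  obtain ⟨C₁, hC₁, hw⟩ := h.integral_le_weight hp (max K₁ K₂)
  obtain ⟨C₂, hC₂, hC⟩ := hK₂ _ (le_max_right K₁ K₂)
  refine ⟨C₁ * C₂, by positivity, fun η hη θ hθ => ?_⟩
  obtain ⟨hi, hle⟩ := hw θ hθ (v ⟨η, hη⟩) (hv.continuous _) (hv.nonneg _)
    (hK₁ _ (le_max_left K₁ K₂) _)
  have hmeas := h.isOpen.measurableSet
  have hu : ContDiff ℝ 1 (F.smooth η) := (F.contDiff_smooth η).of_le (by simp)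
  have hpt : ∀ s ∈ V, p s * ‖fderiv ℝ (fun t => F.smooth η (φ t s)) θ‖ ^ 2 ≤
      p s * (‖fderiv ℝ (Function.uncurry φ) (θ, s)‖ ^ 2 * v ⟨η, hη⟩ (φ θ s)) := fun s hs => by
    refine mul_le_mul_of_nonneg_left ?_ (hp s hs)
    calc _ ≤ (‖fderiv ℝ (F.smooth η) (φ θ s)‖ * ‖fderiv ℝ (Function.uncurry φ) (θ, s)‖) ^ 2 := by
          gcongr
          exact h.norm_fderiv_comp_param_le hu (x := (θ, s)) ⟨hθ, hs⟩
      _ = ‖fderiv ℝ (Function.uncurry φ) (θ, s)‖ ^ 2 * ‖fderiv ℝ (F.smooth η) (φ θ s)‖ ^ 2 := by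
          ring
      _ ≤ _ := by gcongr; exact hFv ⟨η, hη⟩ _
  have hcp : ContinuousOn p V := by
    obtain ⟨r, hr⟩ : PolyGrowth (O ×ˢ V) 0 (fun x : E × (Fin n → ℝ) => p x.2) := ⟨0, h.rapid 0 0⟩
    exact hr.1.continuousOn.comp (f := fun s => (θ, s)) (by fun_prop) fun s hs => ⟨hθ, hs⟩
  have hcont : ContinuousOn (fun s => p s * ‖fderiv ℝ (fun t => F.smooth η (φ t s)) θ‖ ^ 2) V :=
    hcp.mul (((h.continuousOn_fderiv_comp_param hu).comp (f := fun s => (θ, s)) (by fun_prop)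
      fun s hs => ⟨hθ, hs⟩).norm.pow 2)
  have hint : IntegrableOn (fun s => p s * ‖fderiv ℝ (fun t => F.smooth η (φ t s)) θ‖ ^ 2) V := by
    refine hi.mono' (hcont.aestronglyMeasurable hmeas) ?_
    filter_upwards [ae_restrict_mem hmeas] with s hs
    rw [Real.norm_of_nonneg (mul_nonneg (hp s hs) (sq_nonneg _))]
    exact hpt s hs
  refine ⟨hint, (setIntegral_mono_on hint hi hmeas hpt).trans (hle.trans ?_)⟩
  rw [mul_assoc]
  gcongr
  exact hC _

end Reparam

end DSGD

namespace DSGD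

lemma Expr.measPoly_sem {n : ℕ} (F : Expr n) : MeasPoly F.sem := by
  obtain ⟨N, C, -, h⟩ := F.polyBdd_sem
  exact ⟨F.measurable_sem, C, N, fun y => h () y⟩

lemma Expr.measPoly_smooth {n : ℕ} (F : Expr n) (η : ℝ) : MeasPoly (F.smooth η) := by
  obtain ⟨N, C, -, h⟩ := F.polyBdd_smooth
  exact ⟨(F.contDiff_smooth η).continuous.measurable, C, N, fun y => h η y⟩

lemma Reparam.hasFDerivAt_integral_expr {E : Type} [NormedAddCommGroup E] [NormedSpace ℝ E]
    {n : ℕ} {O : Set E} {V : Set (Fin n → ℝ)} {φ ψ : E → (Fin n → ℝ) → (Fin n → ℝ)}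
    {p : (Fin n → ℝ) → ℝ} (h : Reparam O V φ ψ p) {F : Expr n} {ℓ : ℕ} (hF : F.HasDepth ℓ)
    {η : ℝ} (hη : η ∈ Ioc (0 : ℝ) 1) {θ : E} (hθ : θ ∈ O) :
    IntegrableOn (fun s => p s • fderiv ℝ (fun t => F.smooth η (φ t s)) θ) V ∧
    HasFDerivAt (fun t => ∫ s in V, p s * F.smooth η (φ t s))
      (∫ s in V, p s • fderiv ℝ (fun t => F.smooth η (φ t s)) θ) θ := by
  obtain ⟨v, hv, hFv⟩ := hF.exists_weightBdd
  exact (h.hasFDerivAt_integral_smooth ((F.contDiff_smooth η).of_le (by simp))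
    (F.measPoly_smooth η).2 (hv.poly_of_sq_le ⟨η, hη⟩ (hFv ⟨η, hη⟩)) hθ).2

/-! ### Application to the SGD iterates. -/

section objective

variable {m n : ℕ} {U : Set (Fin n → ℝ)} {p : (Fin n → ℝ) → ℝ}
  {Θ O : Set (EuclideanSpace ℝ (Fin m))} {φ : EuclideanSpace ℝ (Fin m) → (Fin n → ℝ) → (Fin n → ℝ)}

/-- Passing from `O` to a thickening of the compact Θ makes the parameter domain bounded, as rapid
decay requires, and leaves a uniform margin around Θ for the descent estimate. -/
lemma exists_reparam (hp : IsSchwartzOn p U) (hΘ : IsCompact Θ) (hO : IsOpen O) (hΘO : Θ ⊆ O)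
    (hφ_diffeo : ∀ θ ∈ O, IsDiffeoOn (φ θ) U)
    (hφ_poly : IsSmoothPolyBoundedOn (Function.uncurry φ) (O ×ˢ interior U))
    (hφ_det : ∃ c : ℝ, 0 < c ∧ ∀ θ ∈ O, ∀ s ∈ interior U, c ≤ |(fderiv ℝ (φ θ) s).det|) :
    ∃ r > 0, ∃ ψ, Reparam (Metric.thickening r Θ) (interior U) φ ψ p := by
  obtain ⟨r, hr, hsub⟩ := hΘ.exists_thickening_subset_open hO hΘO
  choose! ψ hψ using fun θ (hθ : θ ∈ O) => (hφ_diffeo θ hθ).exists_inverse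
  obtain ⟨c, hc, hdet⟩ := hφ_det
  exact ⟨r, hr, ψ, {
    isOpen_param := Metric.isOpen_thickening
    isOpen := isOpen_interior
    mapsTo := fun θ hθ => (hψ θ (hsub hθ)).1
    mapsTo_inv := fun θ hθ => (hψ θ (hsub hθ)).2.1
    invOn := fun θ hθ => (hψ θ (hsub hθ)).2.2.1
    continuousOn_inv := fun θ hθ => (hψ θ (hsub hθ)).2.2.2
    poly := fun l => (PolyGrowth.of_isSmoothPolyBoundedOn hφ_poly l).mono_set
      (prod_mono hsub subset_rfl)
    det := ⟨c, hc, fun θ hθ => hdet θ (hsub hθ)⟩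
    rapid := fun l => hp.rapidDecay hΘ.isBounded.thickening l }⟩

set_option maxHeartbeats 1000000 in
/-- If the gradient norms of the objective stay above `δ` from time `N` on, the iterates almost
surely leave the parameter space. -/
theorem ae_exists_iterate (hp : IsSchwartzOn p U) (hp0 : ∀ x ∈ U, 0 ≤ p x)
    [IsProbabilityMeasure (densityMeasure p U)] (hΘ : IsCompact Θ) {r : ℝ} (hr : 0 < r)
    {ψ : EuclideanSpace ℝ (Fin m) → (Fin n → ℝ) → (Fin n → ℝ)}
    (h : Reparam (Metric.thickening r Θ) (interior U) φ ψ p)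
    {F : Expr n} {ℓ : ℕ} (hℓ : 1 ≤ ℓ) (hF_safe : F.Safe) (hF_depth : F.HasDepth ℓ)
    {ε : ℝ} (hε : 0 < ε) (hεℓ : ε < 1 / (ℓ : ℝ))
    {γ η : ℕ → ℝ} (hγ_pos : ∀ k, 0 < γ k) (hη_pos : ∀ k, 0 < η k)
    (hγ : γ =Θ[atTop] fun k : ℕ => 1 / (k : ℝ))
    (hη : η =Θ[atTop] fun k : ℕ => (k : ℝ) ^ (-(1 / (ℓ : ℝ)) + ε))
    {Ω : Type*} [MeasurableSpace Ω] {P : Measure Ω} [IsProbabilityMeasure P]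
    {s : ℕ → Ω → (Fin n → ℝ)} (hs_meas : ∀ k, Measurable (s k))
    (hs_indep : iIndepFun s P) (hs_law : ∀ k, P.map (s k) = densityMeasure p U)
    (θ₀ : EuclideanSpace ℝ (Fin m)) {δ : ℝ} (hδ : 0 < δ) :
    ∀ᶠ N in atTop, ∀ᵐ a ∂P, (∃ k, iterate φ F γ η θ₀ (fun k => s k a) k ∉ Θ) ∨
      ∃ k ≥ N, ‖gradient (objective (densityMeasure p U) φ F)
        (iterate φ F γ η θ₀ (fun k => s k a) k)‖ < δ := by
  classical
  set V := interior U
  set O := Metric.thickening r Θ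
  have hΘO : Θ ⊆ O := Metric.self_subset_thickening hr Θ
  have hp0' : ∀ x ∈ V, 0 ≤ p x := fun x hx => hp0 x (interior_subset hx)
  have hVm : MeasurableSet V := isOpen_interior.measurableSet
  obtain ⟨D, hD1, hD2, hD3, hD4, hD5⟩ := h.exists_gradient
  obtain ⟨M, hM0, hM⟩ := hD2 _ F.measPoly_sem
  obtain ⟨M', hM0', hM'⟩ := hD3 _ F.measPoly_sem
  obtain ⟨L, hL0, hL⟩ := hD4 _ F.measPoly_sem
  have hηt := tendsto_accuracy hεℓ hη_pos hη
  have hpoly : PolyBdd (fun k y => F.smooth (η k) y) := by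
    obtain ⟨N, C, hC, hb⟩ := F.polyBdd_smooth
    exact ⟨N, C, hC, fun k y => hb (η k) y⟩
  obtain ⟨e, he0, he⟩ := hD5 F.sem (fun k => F.smooth (η k)) F.measurable_sem F.polyBdd_sem
    (fun k => (F.measPoly_smooth (η k)).1) hpoly (hF_safe.ae_tendsto hηt)
  obtain ⟨B, hB0, hB⟩ := h.exists_integral_sq_fderiv_le hp0' hF_depth
  have hobj : objective (densityMeasure p U) φ F = fun θ => ∫ s in V, p s * F.sem (φ θ s) := by
    funext θ
    exact hp.integral_densityMeasure hp0' _
  have hDobj : ∀ θ ∈ O, HasFDerivAt (objective (densityMeasure p U) φ F) (D F.sem θ) θ := by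
    rw [hobj]
    exact hD1 _ F.measPoly_sem
  have hgrad : ∀ θ ∈ O, gradient (objective (densityMeasure p U) φ F) θ = riesz (D F.sem θ) :=
    fun θ hθ => by rw [gradient_eq_riesz, (hDobj θ hθ).fderiv]
  have hDcont : ContinuousOn (D F.sem) O := fun θ hθ => by
    obtain ⟨D₂, h2, -⟩ := hL θ hθ
    exact h2.continuousAt.continuousWithinAt
  have hev : ∀ᶠ N in atTop, ∀ k ≥ N, η k ≤ 1 ∧ e k ≤ δ / 2 := by
    rw [eventually_forall_ge_atTop]
    filter_upwards [(tendsto_nhdsWithin_iff.1 hηt).1.eventually (Iic_mem_nhds one_pos),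
      he0.eventually (Iic_mem_nhds (half_pos hδ))] with k h1 h2 using ⟨h1, h2⟩
  filter_upwards [hev] with N hN
  set W : EuclideanSpace ℝ (Fin m) → ℝ := Θ.piecewise (objective (densityMeasure p U) φ F) (fun _ => -M)
  have hWm : Measurable W := by
    refine ContinuousOn.measurable_piecewise (fun θ hθ => ?_) continuousOn_const hΘ.measurableSet
    exact (hDobj θ (hΘO hθ)).continuousAt.continuousWithinAt
  have hfM : ∀ θ ∈ O, ‖objective (densityMeasure p U) φ F θ‖ ≤ M := by
    rw [hobj]; exact hM
  have hWM : ∀ θ, ‖W θ‖ ≤ M := fun θ => by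
    by_cases hθ : θ ∈ Θ
    · simp only [W, piecewise_eq_of_mem _ _ _ hθ]; exact hfM θ (hΘO hθ)
    · simp only [W, piecewise_eq_of_notMem _ _ _ hθ]; rw [norm_neg, Real.norm_of_nonneg hM0]
  obtain ⟨C, hC0, hC⟩ := exists_descent hr hDobj hfM hM0 hM0' hL0 hM' hL (V := W)
    (fun θ hθ => piecewise_eq_of_mem _ _ _ hθ) (fun θ hθ => piecewise_eq_of_notMem _ _ _ hθ)
  -- Before N only staying in Θ is required, since the bounds on accuracy and bias hold from N on.
  -- From N on, being active also means a gradient norm of at least δ.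
  set A : ℕ → Set (EuclideanSpace ℝ (Fin m)) := fun k => if k < N then Θ else Θ ∩ {θ | δ ≤ ‖D F.sem θ‖}
  have hAΘ : ∀ k, A k ⊆ Θ := fun k => by
    simp only [A]; split_ifs
    exacts [subset_rfl, inter_subset_left]
  have hAge : ∀ k ≥ N, A k = Θ ∩ {θ | δ ≤ ‖D F.sem θ‖} := fun k hk => if_neg (not_lt.2 hk)
  have hA : ∀ k, MeasurableSet (A k) := fun k => by
    simp only [A]; split_ifs
    · exact hΘ.measurableSet
    · exact ((hDcont.mono hΘO).norm.preimage_isClosed_of_isClosed hΘ.isClosed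
        isClosed_Ici).measurableSet
  -- Cutting off outside A k × V makes the estimator jointly measurable, as nothing is known about φ
  -- elsewhere. Runs that stay active do not notice the cut.
  set G : ℕ → EuclideanSpace ℝ (Fin m) × (Fin n → ℝ) → EuclideanSpace ℝ (Fin m) := fun k => (A k ×ˢ V).indicator
    fun z => gradient (fun t => F.smooth (η k) (φ t z.2)) z.1
  have hsm : ∀ k, ContDiff ℝ 1 (F.smooth (η k)) := fun k =>
    (F.contDiff_smooth (η k)).of_le (by simp)
  have hG : ∀ k, Measurable (G k) := fun k => by
    simp only [G]
    rw [← piecewise_eq_indicator]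
    refine ContinuousOn.measurable_piecewise ?_ continuousOn_const ((hA k).prod hVm)
    exact riesz.continuous.comp_continuousOn ((h.continuousOn_fderiv_comp_param (hsm k)).mono
      (prod_mono ((hAΘ k).trans hΘO) subset_rfl))
  have hGA : ∀ k, ∀ θ ∉ A k, ∀ x, G k (θ, x) = 0 := fun k θ hθ x =>
    indicator_of_notMem (fun hx => hθ hx.1) _
  have hGe : ∀ k, ∀ θ ∈ A k, ∀ x ∈ V,
      G k (θ, x) = riesz (fderiv ℝ (fun t => F.smooth (η k) (φ t x)) θ) := fun k θ hθ x hx =>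
    indicator_of_mem (show (θ, x) ∈ A k ×ˢ V from ⟨hθ, hx⟩) _
  have hη1 : ∀ k ≥ N, η k ∈ Ioc (0 : ℝ) 1 := fun k hk => ⟨hη_pos k, (hN k hk).1⟩
  -- The smoothed objective is differentiated both through the kernel and pathwise. Uniqueness of
  -- the derivative makes the sample gradient unbiased for it, so only the smoothing error `e k`
  -- remains as bias.
  have hder : ∀ k ≥ N, ∀ θ ∈ A k,
      IntegrableOn (fun x => p x • fderiv ℝ (fun t => F.smooth (η k) (φ t x)) θ) V ∧
      D (F.smooth (η k)) θ = ∫ x in V, p x • fderiv ℝ (fun t => F.smooth (η k) (φ t x)) θ := by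
    intro k hk θ hθ
    obtain ⟨h2, h3⟩ := h.hasFDerivAt_integral_expr hF_depth (hη1 k hk) (hΘO (hAΘ k hθ))
    exact ⟨h2, (hD1 _ (F.measPoly_smooth (η k)) θ (hΘO (hAΘ k hθ))).unique h3⟩
  have hpG : ∀ k, ∀ θ ∈ A k, ∀ x ∈ V,
      riesz (p x • fderiv ℝ (fun t => F.smooth (η k) (φ t x)) θ) = p x • G k (θ, x) :=
    fun k θ hθ x hx => by rw [map_smul, hGe k θ hθ x hx]
  have hpG2 : ∀ k, ∀ θ ∈ A k, ∀ x ∈ V,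
      p x * ‖fderiv ℝ (fun t => F.smooth (η k) (φ t x)) θ‖ ^ 2 = p x • ‖G k (θ, x)‖ ^ 2 :=
    fun k θ hθ x hx => by rw [hGe k θ hθ x hx, LinearIsometry.norm_map, smul_eq_mul]
  have hsum : Summable (fun k => γ k ^ 2 * (B * (η k ^ ℓ)⁻¹)) := by
    simpa only [mul_left_comm] using (summable_sq_mul_inv_pow hℓ hε hγ hη).mul_left B
  have hmain := ae_exists_notMem_active (f' := fun θ => riesz (D F.sem θ)) hWm hWM hG hA hGA hC0
    (N := N) (fun k _ θ hθ θ' => by rw [inner_riesz]; exact hC θ (hAΘ k hθ) θ') hδ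
    (fun k hk θ hθ => by
      rw [hAge k hk] at hθ
      rw [LinearIsometry.norm_map]
      exact hθ.2) (D := densityMeasure p U) hγ_pos
    (fun k hk θ hθ => by
      rw [hp.integrable_densityMeasure_iff hp0']
      exact ((integrableOn_congr_fun (hpG k θ hθ) hVm).1
        (riesz.toContinuousLinearMap.integrable_comp (hder k hk θ hθ).1)))
    (fun k hk θ hθ => by
      rw [hp.integrable_densityMeasure_iff hp0']
      exact (integrableOn_congr_fun (hpG2 k θ hθ) hVm).1
        (hB _ (hη1 k hk) θ (hΘO (hAΘ k hθ))).1)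
    (fun k hk θ hθ => by
      rw [hp.integral_densityMeasure hp0', ← setIntegral_congr_fun hVm (hpG2 k θ hθ)]
      exact (hB _ (hη1 k hk) θ (hΘO (hAΘ k hθ))).2)
    (fun k hk => by have := (pow_pos (hη_pos k) ℓ); positivity)
    (fun k hk θ hθ => by
      have h1 := riesz.toContinuousLinearMap.integral_comp_comm (hder k hk θ hθ).1
      rw [← (hder k hk θ hθ).2] at h1
      rw [hp.integral_densityMeasure hp0', ← setIntegral_congr_fun hVm (hpG k θ hθ)]
      refine (le_of_eq ?_).trans ((he k θ (hΘO (hAΘ k hθ))).trans (hN k hk).2)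
      rw [← riesz.norm_map, map_sub]
      exact congrArg (fun z => ‖z - riesz (D F.sem θ)‖) h1)
    hsum (not_summable_of_isTheta hγ) hs_meas hs_indep hs_law θ₀
  have hmem : ∀ᵐ a ∂P, ∀ k, s k a ∈ V := ae_all_iff.2 fun k =>
    ae_of_ae_map (hs_meas k).aemeasurable (by rw [hs_law k]; exact hp.ae_mem)
  filter_upwards [hmain, hmem] with a ha hsa
  by_contra! hcon
  obtain ⟨hin, hge⟩ := hcon
  have hact : ∀ k, iterate φ F γ η θ₀ (fun k => s k a) k ∈ A k := fun k => by
    simp only [A]; split_ifs with hk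
    · exact hin k
    · refine ⟨hin k, ?_⟩
      have := hge k (not_lt.1 hk)
      rwa [hgrad _ (hΘO (hin k)), LinearIsometry.norm_map] at this
  have heq : ∀ k, chain (fun k z => z.1 - γ k • G k z) θ₀ (fun i => s i a) k =
      iterate φ F γ η θ₀ (fun k => s k a) k := fun k => by
    induction k with
    | zero => rfl
    | succ k ih =>
      simp only [chain, iterate, ih]
      rw [hGe k _ (hact k) _ (hsa k), gradient_eq_riesz]
  obtain ⟨k, -, hk⟩ := ha
  exact hk (heq k ▸ hact k)

end objective

end DSGD

/-! ### The theorem. -/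

theorem theorem5p4 {m n : ℕ}
    -- the base distribution: density `p`, a Schwartz function on `U`
    (U : Set (Fin n → ℝ)) (p : (Fin n → ℝ) → ℝ)
    (hp : DSGD.IsSchwartzOn p U) (hp_nonneg : ∀ x ∈ U, 0 ≤ p x)
    (hp_prob : IsProbabilityMeasure (DSGD.densityMeasure p U))
    -- the compact parameter space `Θ`, inside an open set `O` on which `φ` is defined
    (Θ O : Set (EuclideanSpace ℝ (Fin m)))
    (hΘ : IsCompact Θ) (hO : IsOpen O) (hΘO : Θ ⊆ O)
    -- the reparameterisation
    (φ : EuclideanSpace ℝ (Fin m) → (Fin n → ℝ) → (Fin n → ℝ))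
    (hφ_diffeo : ∀ θ ∈ O, DSGD.IsDiffeoOn (φ θ) U)
    (hφ_poly : DSGD.IsSmoothPolyBoundedOn (Function.uncurry φ) (O ×ˢ interior U))
    (hφ_det : ∃ c : ℝ, 0 < c ∧ ∀ θ ∈ O, ∀ s ∈ interior U, c ≤ |(fderiv ℝ (φ θ) s).det|)
    -- the safe expression of guard-nesting depth `ℓ`
    (F : DSGD.Expr n) (ℓ : ℕ) (hℓ : 1 ≤ ℓ) (hF_safe : F.Safe) (hF_depth : F.HasDepth ℓ)
    -- step sizes and accuracy coefficients
    (ε : ℝ) (hε : 0 < ε) (hεℓ : ε < 1 / (ℓ : ℝ))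
    (γ η : ℕ → ℝ) (hγ_pos : ∀ k, 0 < γ k) (hη_pos : ∀ k, 0 < η k)
    (hγ : γ =Θ[atTop] fun k : ℕ => 1 / (k : ℝ))
    (hη : η =Θ[atTop] fun k : ℕ => (k : ℝ) ^ (-(1 / (ℓ : ℝ)) + ε))
    -- independent samples from the base distribution, and the starting point
    {Ω : Type*} [MeasurableSpace Ω] (P : Measure Ω) [IsProbabilityMeasure P]
    (s : ℕ → Ω → (Fin n → ℝ)) (hs_meas : ∀ k, Measurable (s k))
    (hs_indep : iIndepFun s P) (hs_law : ∀ k, P.map (s k) = DSGD.densityMeasure p U)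
    (θ₀ : EuclideanSpace ℝ (Fin m)) :
    -- the objective is well defined and differentiable on `Θ`
    (∀ θ ∈ Θ, Integrable (fun x => F.sem (φ θ x)) (DSGD.densityMeasure p U) ∧
      DifferentiableAt ℝ (DSGD.objective (DSGD.densityMeasure p U) φ F) θ) ∧
    -- and almost surely its gradient norms along the run have limit inferior zero
    ∀ᵐ a ∂P,
      liminf (fun i => ‖gradient (DSGD.objective (DSGD.densityMeasure p U) φ F)
        (DSGD.iterate φ F γ η θ₀ (fun k => s k a) i)‖ₑ) atTop = 0 ∨
      ∃ i, DSGD.iterate φ F γ η θ₀ (fun k => s k a) i ∉ Θ := by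
  have hp0 : ∀ x ∈ interior U, 0 ≤ p x := fun x hx => hp_nonneg x (interior_subset hx)
  obtain ⟨r, hr, ψ, h⟩ := DSGD.exists_reparam hp hΘ hO hΘO hφ_diffeo hφ_poly hφ_det
  refine ⟨fun θ hθ => ?_, ?_⟩
  · have hθ' := Metric.self_subset_thickening hr Θ hθ
    refine ⟨(hp.integrable_densityMeasure_iff hp0 _).2 (h.integrableOn_mul_comp F.measPoly_sem hθ'),
      ?_⟩
    obtain ⟨D, hD, -⟩ := h.exists_gradient
    have h1 := (hD F.sem F.measPoly_sem θ hθ').differentiableAt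
    have h2 : DSGD.objective (DSGD.densityMeasure p U) φ F =
        fun θ => ∫ s in interior U, p s * F.sem (φ θ s) :=
      funext fun θ => hp.integral_densityMeasure hp0 _
    rwa [h2]
  · have hδ := fun j : ℕ => DSGD.ae_exists_iterate hp hp_nonneg hΘ hr h hℓ hF_safe hF_depth hε hεℓ
      hγ_pos hη_pos hγ hη hs_meas hs_indep hs_law θ₀ (δ := ((j : ℝ) + 1)⁻¹) (by positivity)
    choose N hN using fun j => eventually_atTop.1 (hδ j)
    -- Using every threshold N j + i, and not only N j, gives small gradients infinitely often for
    -- each of the countably many δ = 1/(j+1).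
    have hae := ae_all_iff.2 fun j => ae_all_iff.2 fun i => hN j (N j + i) (Nat.le_add_right _ _)
    filter_upwards [hae] with a ha
    refine or_iff_not_imp_right.2 fun hin => ?_
    have hfreq : ∀ j : ℕ, ∃ᶠ i in atTop,
        ‖gradient (DSGD.objective (DSGD.densityMeasure p U) φ F)
          (DSGD.iterate φ F γ η θ₀ (fun k => s k a) i)‖ < ((j : ℝ) + 1)⁻¹ := fun j =>
      frequently_atTop.2 fun i => by
        obtain ⟨k, hk, hlt⟩ := (ha j i).resolve_left hin
        exact ⟨k, (Nat.le_add_left i (N j)).trans hk, hlt⟩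
    by_contra hne
    obtain ⟨j, hj⟩ := ENNReal.exists_inv_nat_lt hne
    refine hfreq j ((eventually_lt_of_lt_liminf hj).mono fun i hi hlt => ?_)
    refine hi.not_ge ?_
    calc _ ≤ ENNReal.ofReal ((j : ℝ) + 1)⁻¹ := by
          rw [← ofReal_norm]
          exact ENNReal.ofReal_le_ofReal hlt.le
      _ = ((j : ℝ≥0∞) + 1)⁻¹ := by
          rw [ENNReal.ofReal_inv_of_pos (by positivity), ENNReal.ofReal_add (by positivity) one_pos.le,
            ENNReal.ofReal_natCast, ENNReal.ofReal_one]
      _ ≤ _ := ENNReal.inv_le_inv.2 le_self_add
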